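/- Let $q>0$ be real. Put $[x]=(q^x-q^{-x})/(q-q^{-1})$ (with $[x]=x$ for $q=1$), $[n]!=[1][2]\cdots[n]$, $[0]!=1$, and $$\nabla[abc]=\left(\frac{[a+b-c]!\,[a-b+c]!\,[a+b+c+1]!}{[b+c-a]!}\right)^{1/2},\qquad Z_{deh}=-d(d+1)-e(e+1)-h(h+1).$$ A triad is a triple of spins (elements of $\{0,\frac12,1,\frac32,\dots\}$) $x,y,z$ with $|x-y|\le z\le x+y$ and $x+y+z\in\mathbb Z$. In every sum over $z$ or $z_1,z_2,z_3$ below, the summation variables run over all integers for which the arguments of all $q$-factorials in the denominator are non-negative. If $(a,b,e),(d,c,e),(a,c,f),(d,b,f)$ are triads, the $q$-$6j$ coefficient is $$\left\{\begin{array}{ccc}a&b&e\\ d&c&f\end{array}\right\}_q=\frac{\nabla[acf]\nabla[dbf]}{\nabla[abe]\nabla[dce]}\sum_z\frac{(-1)^{a+b+c+d+z}[c+f-a+z]!\,[b+f-d+z]!\,[a+d+e-f-z]!}{[z]!\,[a+c-f-z]!\,[b+d-f-z]!\,[e+f-a-d+z]!\,[2f+z+1]!}.$$ For spins such that the rows $(a,b,e),(c,d,f),(h,k,g)$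 and the columns $(a,c,h),(b,d,k),(e,f,g)$ are triads, the $q$-$9j$ coefficient is $$\left\{\begin{array}{ccc}a&b&e\\ c&d&f\\ h&k&g\end{array}\right\}_q=\sum_j(-1)^{2j}q^{Z_{deh}-j(j+1)}[2j+1]\left\{\begin{array}{ccc}a&c&h\\ k&g&j\end{array}\right\}_q\left\{\begin{array}{ccc}k&j&c\\ f&d&b\end{array}\right\}_q\left\{\begin{array}{ccc}a&g&j\\ f&b&e\end{array}\right\}_q,$$ where $j$ runs over all spins such that $(a,g,j),(b,f,j),(c,k,j)$ are triads. Then, for all such spins, $$\begin{aligned}\left\{\begin{array}{ccc}a&b&e\\ c&d&f\\ h&k&g\end{array}\right\}_q={}&(-1)^{a+c-h}\frac{\nabla[abe]\nabla[feg]\nabla[kbd]}{\nabla[ach]\nabla[fcd]\nabla[kgh]}\,q^{Z_{deh}-(a+b+f-g)(f+g-e+1)-(g-a)(g-a+1)}\\ &\times\sum_{z_1,z_2,z_3}\frac{(-1)^{z_1+z_2+z_3}[g-h+k+z_1]!\,[g+h+k+z_1+1]!}{[z_1]!\,[g+k-a-c+z_1]!\,[c+g+k-a+z_1+1]!}\\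 &\times\frac{[2b-z_2]!\,[b+f+k-c-z_2]!\,[b+f+k+c-z_2+1]!}{[2g+z_1+1]!\,[z_2]!\,[b+k-d-z_2]!\,[b+d+k-z_2+1]!}\\ &\times\frac{[b+e-a+z_3]!\,[e-f+g+z_3]!\,q^{-z_1(b+e-a-z_2+z_3)+z_2(f+g-e-z_3+1)+z_3(a+b+f-g)}}{[z_3]!\,[a+b-e-z_3]!\,[f+g-e-z_3]!\,[2e+z_3+1]!}\\ &\times\frac{[f+g-e+z_1-z_3]!}{[a+b+f-g-z_1-z_2]!\,[b+e-a-z_2+z_3]!}\end{aligned}$$ and $$\begin{aligned}\left\{\begin{array}{ccc}a&b&e\\ c&d&f\\ h&k&g\end{array}\right\}_q={}&(-1)^{a+c-h-e-f+g}\frac{\nabla[abe]\nabla[feg]\nabla[kbd]}{\nabla[ach]\nabla[fcd]\nabla[kgh]}\,q^{Z_{deh}-(a+b+f-g)(e+f+g+2)-(g-a)(g-a+1)}\\ &\times\sum_{z_1,z_2,z_3}\frac{(-1)^{z_1+z_3}[g-h+k+z_1]!\,[g+h+k+z_1+1]!}{[z_1]!\,[g+k-a-c+z_1]!\,[c+g+k-a+z_1+1]!}\\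 &\times\frac{[2b-z_2]!\,[b+f+k-c-z_2]!\,[b+f+k+c-z_2+1]!}{[2g+z_1+1]!\,[z_2]!\,[b+k-d-z_2]!\,[b+d+k-z_2+1]!}\\ &\times\frac{[2e-z_3]!\,q^{z_1(a-b+e+z_2-z_3+1)+z_2(e+f+g-z_3+2)+z_3(a+b+f-g)}}{[z_3]!\,[a-b+e-z_3]!\,[e+f-g-z_3]!\,[a+b+e-z_3+1]!}\\ &\times\frac{[e+f+g+z_1-z_3+1]!\,[a-b+e+z_2-z_3]!}{[e+f+g-z_3+1]!\,[a+b+f-g-z_1-z_2]!}.\end{aligned}$$ -/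

import Mathlib

open Finset

noncomputable section

namespace QNineJ

/-- `x` is a spin: a nonnegative integer or half-integer. -/
def IsSpin (x : ℝ) : Prop := ∃ n : ℕ, x = n / 2

/-- The triangle condition for three spins: `|x - y| ≤ z ≤ x + y`, and `x + y + z` is an integer. -/
def Triad (x y z : ℝ) : Prop := |x - y| ≤ z ∧ z ≤ x + y ∧ ∃ n : ℤ, x + y + z = n

/-- The `q`-number `[x] = (q^x - q^{-x}) / (q - q^{-1})`, with its limiting value `x` at `q = 1`. -/
def qNum (q x : ℝ) : ℝ := if q = 1 then x else (q ^ x - q ^ (-x)) / (q - q⁻¹)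

/-- The `q`-factorial `[x]! = [1][2]⋯[x]`, used only at nonnegative integers `x`. -/
def qFact (q x : ℝ) : ℝ := ∏ i ∈ range ⌊x⌋₊, qNum q (i + 1)

/-- The sign `(-1)^x`, used only at integers `x`. -/
def sgn (x : ℝ) : ℝ := (-1) ^ ⌊x⌋

/-- The asymmetric triangle coefficient `∇[xyz]`. -/
def nabla (q x y z : ℝ) : ℝ :=
  √(qFact q (x + y - z) * qFact q (x - y + z) * qFact q (x + y + z + 1) / qFact q (y + z - x))

/-- The `q`-`6j` coefficient `{a b e; d c f}_q`, for spins such that `(a, b, e)`, `(d, c, e)`,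
`(a, c, f)`, `(d, b, f)` are triads. The sum runs over all integers `z` for which the arguments of
the factorials in the denominator are nonnegative (`2f + z + 1` is so automatically). -/
def sixJ (q a b e d c f : ℝ) : ℝ :=
  nabla q a c f * nabla q d b f / (nabla q a b e * nabla q d c e) *
    ∑ z ∈ range (⌊a + c - f⌋₊ + 1) with
        (0 ≤ a + c - f - ((z : ℕ) : ℝ) ∧ 0 ≤ b + d - f - ((z : ℕ) : ℝ) ∧ 0 ≤ e + f - a - d + ((z : ℕ) : ℝ)),
      sgn (a + b + c + d + z) *
        (qFact q (c + f - a + z) * qFact q (b + f - d + z) * qFact q (a + d + e - f - z)) /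
        (qFact q z * qFact q (a + c - f - z) * qFact q (b + d - f - z) *
          qFact q (e + f - a - d + z) * qFact q (2 * f + z + 1))

/-- `Z_{xyz} = -x(x+1) - y(y+1) - z(z+1)`. -/
def zExp (x y z : ℝ) : ℝ := -(x * (x + 1)) - y * (y + 1) - z * (z + 1)

open Classical in
/-- The `q`-`9j` coefficient `{a b e; c d f; h k g}_q`, given by its expansion in `q`-`6j`
coefficients. The sum runs over all spins `j = n / 2` that form triads with `(a, g)`, `(b, f)` and
`(c, k)`; in particular `n ≤ 2(a + g)`. -/
def nineJ (q a b e c d f h k g : ℝ) : ℝ :=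
  ∑ n ∈ range (⌊2 * (a + g)⌋₊ + 1) with
      (Triad a g (((n : ℕ) : ℝ) / 2) ∧ Triad b f (n / 2) ∧ Triad c k (n / 2)),
    (-1) ^ n * q ^ (zExp d e h - (n : ℝ) / 2 * ((n : ℝ) / 2 + 1)) * qNum q (n + 1) *
      sixJ q a c h k g (n / 2) * sixJ q k (n / 2) c f d b * sixJ q a g (n / 2) f b e

end QNineJ

end

open QNineJ

/-! Write `m = b + f - j` for the summation spin `j`, `T = 2b + 2f`, and `ℓ(m) = [m][T + 1 - m]`. In
their mirror form (`sum_eq_mirror_sum`, proved by two applications of the balanced summation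
`saalschutz_po`) the first two `q`-`6j` sums depend on `m` only through products that are, up to a
common prefactor, Newton polynomials in `ℓ(m)`. They are therefore values at `ℓ(m)` of two
polynomials `Q₁ = ∑ c₁(x) N↓ₓ` and `Q₂ = ∑ c₂(y) N_y`, and the `9j` coefficient is a weighted sum of
`Q₁(ℓ(m)) Q₂(ℓ(m))`, the weight containing `[2j + 1]`, the power of `q` and the third `6j` sum.

Each triple sum has the form `∑ c₁(x) c₂(y) Φ(x, y)`, where `Φ` is its inner sum over `z₃`. The
array `Φ` satisfies the recurrence that the products `N↓ₓ N_y` obey because `(ℓ(P - x) - X) + (X -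
ℓ(y)) = ℓ(P - x) - ℓ(y)`. Hence `Φ(x, y) = Λ(N↓ₓ N_y)` for a linear functional `Λ`, and the triple
sum is `Λ(Q₁ Q₂)`. Since `Φ` vanishes beyond certain bounds, `Λ` (after splitting off a factor when
`2f < 2b`) is a quadrature rule at finitely many nodes `ℓ(m)`. Its weight at `ℓ(m)` is read off from
`Φ(P - m, m)`, because `N↓_{P-m} N_m` vanishes at the other nodes in use; on this antidiagonal the
powers of `q` no longer depend on `z₃`, and `Φ` is the third `6j` sum. This is `coupling_sum`.

The two formulas differ only in `Φ`: the antidiagonal of `phiTwo` is the mirror form of that of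
`phiOne`. What remains is the boundary: nodes whose spin violates a triangle inequality must
contribute zero. This is supplied by the vanishing of alternating `q`-binomial sums of
`q`-polynomials of low degree (`QPoly.sum_eq_zero`). -/

noncomputable section

namespace QNineJ

/-! ### `q`-numbers, factorials and shifted factorials at integers -/

/-- The `q`-number `[n]` of an integer. -/
def qi (q : ℝ) (n : ℤ) : ℝ := qNum q n

/-- The `q`-factorial of an integer (equal to `1` at negative integers). -/
def fa (q : ℝ) (n : ℤ) : ℝ := qFact q n

/-- The reciprocal `q`-factorial of an integer, vanishing at negative integers. -/
def rf (q : ℝ) (n : ℤ) : ℝ := if n < 0 then 0 else (fa q n)⁻¹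

/-- The `q`-shifted factorial `[x][x + 1]⋯[x + n - 1]`. -/
def po (q : ℝ) (x : ℤ) (n : ℕ) : ℝ := ∏ i ∈ range n, qi q (x + i)

variable {q : ℝ}

lemma qi_one_base (n : ℤ) : qi 1 n = n := by simp [qi, qNum]

lemma qi_of_ne (hq : 0 < q) (h : q ≠ 1) (n : ℤ) :
    qi q n = (q ^ n - (q ^ n)⁻¹) / (q - q⁻¹) := by
  have h1 : q ^ (-(n : ℝ)) = (q ^ n)⁻¹ := by
    rw [Real.rpow_neg hq.le, Real.rpow_intCast]
  simp [qi, qNum, h, h1]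

lemma sub_inv_ne_zero (hq : 0 < q) (h : q ≠ 1) : q - q⁻¹ ≠ 0 := by
  intro h0
  have h1 : q * q = 1 := by
    have : q = q⁻¹ := by linarith
    nth_rewrite 2 [this]
    exact mul_inv_cancel₀ hq.ne'
  apply h
  nlinarith

/-- Equality of the two argument sums cancels the terms `q^(±(x + y))`. This identity drives both
the telescoping in `saalschutz_po` and the factorization of differences of nodes. -/
lemma qi_mul_sub_mul (hq : 0 < q) {x y z w : ℤ} (h : x + y = z + w) :
    qi q x * qi q y - qi q z * qi q w = qi q (x - w) * qi q (z - x) := by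
  obtain rfl : y = z + w - x := by omega
  by_cases h1 : q = 1
  · subst h1; simp only [qi_one_base]; push_cast; ring
  · have h2 := sub_inv_ne_zero hq h1
    simp only [qi_of_ne hq h1, zpow_sub₀ hq.ne', zpow_add₀ hq.ne']
    have hx : q ^ x ≠ 0 := (zpow_pos hq x).ne'
    have hz : q ^ z ≠ 0 := (zpow_pos hq z).ne'
    have hw : q ^ w ≠ 0 := (zpow_pos hq w).ne'
    generalize q ^ x = X at *
    generalize q ^ z = Z at *
    generalize q ^ w = W at *
    generalize q - q⁻¹ = d at *
    field_simp
    ring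

lemma qi_add (hq : 0 < q) (x y : ℤ) :
    qi q (x + y) = q ^ y * qi q x + (q ^ x)⁻¹ * qi q y := by
  by_cases h1 : q = 1
  · subst h1; simp only [qi_one_base]; push_cast; simp
  · have h2 := sub_inv_ne_zero hq h1
    simp only [qi_of_ne hq h1, zpow_add₀ hq.ne']
    have hx : q ^ x ≠ 0 := (zpow_pos hq x).ne'
    have hy : q ^ y ≠ 0 := (zpow_pos hq y).ne'
    generalize q ^ x = X at *
    generalize q ^ y = Y at *
    generalize q - q⁻¹ = d at *
    field_simp
    ring

lemma qi_zero : qi q 0 = 0 := by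
  simp [qi, qNum]

lemma qi_neg (n : ℤ) : qi q (-n) = -qi q n := by
  by_cases h1 : q = 1
  · subst h1; simp [qi_one_base]
  · simp only [qi, qNum, h1, if_false]
    push_cast
    rw [neg_neg, ← neg_div, neg_sub]

lemma qi_one (hq : 0 < q) : qi q 1 = 1 := by
  by_cases h1 : q = 1
  · subst h1; simp [qi_one_base]
  · rw [qi_of_ne hq h1, zpow_one, div_self (sub_inv_ne_zero hq h1)]

lemma qi_pos (hq : 0 < q) {n : ℤ} (hn : 0 < n) : 0 < qi q n := by
  obtain ⟨k, rfl⟩ : ∃ k : ℕ, n = k + 1 := ⟨(n - 1).toNat, by omega⟩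
  induction k with
  | zero => simp [qi_one hq]
  | succ k ih =>
    have := ih (by omega)
    push_cast at this ⊢
    rw [qi_add hq, qi_one hq]
    have h1 := zpow_pos hq (1 : ℤ)
    have h2 := zpow_pos hq ((k : ℤ) + 1)
    positivity

lemma qi_ne_zero (hq : 0 < q) {n : ℤ} (hn : n ≠ 0) : qi q n ≠ 0 := by
  rcases lt_or_gt_of_ne hn with h | h
  · rw [← neg_neg n, qi_neg]
    exact neg_ne_zero.2 (qi_pos hq (by omega)).ne'
  · exact (qi_pos hq h).ne'

lemma fa_eq_prod (n : ℤ) : fa q n = ∏ i ∈ range n.toNat, qi q (i + 1) := by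
  have : ⌊(n : ℝ)⌋₊ = n.toNat := by
    rw [← Int.floor_toNat, Int.floor_intCast]
  simp [fa, qFact, this, qi]

lemma fa_zero : fa q 0 = 1 := by simp [fa_eq_prod]

lemma fa_succ {n : ℤ} (hn : 0 ≤ n) : fa q (n + 1) = qi q (n + 1) * fa q n := by
  obtain ⟨k, rfl⟩ := Int.eq_ofNat_of_zero_le hn
  have h : ((k : ℤ) + 1).toNat = k + 1 := by omega
  rw [fa_eq_prod, h, prod_range_succ, fa_eq_prod, mul_comm]
  simp

lemma fa_pos (hq : 0 < q) (n : ℤ) : 0 < fa q n := by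
  rw [fa_eq_prod]
  exact prod_pos fun i _ => qi_pos hq (by omega)

lemma fa_ne_zero (hq : 0 < q) (n : ℤ) : fa q n ≠ 0 := (fa_pos hq n).ne'

lemma rf_of_neg {n : ℤ} (hn : n < 0) : rf q n = 0 := by simp [rf, hn]

lemma rf_of_nonneg {n : ℤ} (hn : 0 ≤ n) : rf q n = (fa q n)⁻¹ := by
  simp [rf, not_lt.2 hn]

lemma rf_ne_zero (hq : 0 < q) {n : ℤ} (hn : 0 ≤ n) : rf q n ≠ 0 := by
  rw [rf_of_nonneg hn]; exact inv_ne_zero (fa_ne_zero hq n)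

lemma rf_zero : rf q 0 = 1 := by rw [rf_of_nonneg le_rfl, fa_zero, inv_one]

lemma fa_mul_rf (hq : 0 < q) {n : ℤ} (hn : 0 ≤ n) : fa q n * rf q n = 1 := by
  rw [rf_of_nonneg hn, mul_inv_cancel₀ (fa_ne_zero hq n)]

/-- No sign condition is needed, since both sides vanish for `n ≤ 0`. Recurrences can thus be
checked term by term, with no boundary cases from these factors. -/
lemma rf_pred (hq : 0 < q) (n : ℤ) : rf q (n - 1) = qi q n * rf q n := by
  rcases lt_trichotomy n 0 with h | h | h
  · rw [rf_of_neg h, rf_of_neg (by omega), mul_zero]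
  · subst h; rw [qi_zero, zero_mul, rf_of_neg (by omega)]
  · rw [rf_of_nonneg (by omega), rf_of_nonneg h.le]
    have := fa_succ (q := q) (n := n - 1) (by omega)
    rw [sub_add_cancel] at this
    have h1 := (qi_pos hq h).ne'
    have h2 := fa_ne_zero hq (n - 1)
    rw [this]; field_simp

lemma po_zero (x : ℤ) : po q x 0 = 1 := by simp [po]

lemma po_succ (x : ℤ) (n : ℕ) : po q x (n + 1) = po q x n * qi q (x + n) := by
  simp [po, prod_range_succ]

lemma po_succ' (x : ℤ) (n : ℕ) : po q x (n + 1) = qi q x * po q (x + 1) n := by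
  simp only [po, prod_range_succ']
  rw [mul_comm]
  congr 1
  · simp
  · refine prod_congr rfl fun i _ => ?_
    congr 1; push_cast; ring

lemma po_eq_fa_mul_rf (hq : 0 < q) (x : ℤ) (n : ℕ) (h : 0 ≤ x + n - 1) :
    po q x n = fa q (x + n - 1) * rf q (x - 1) := by
  induction n generalizing x with
  | zero =>
    simp only [Nat.cast_zero, add_zero] at h ⊢
    rw [po_zero, fa_mul_rf hq h]
  | succ n ih =>
    rw [po_succ', rf_pred hq]
    push_cast at h ⊢
    by_cases h' : 0 ≤ x + n - 1 + 1
    · have := ih (x + 1) (by omega)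
      rw [this]
      rw [show x + 1 + (n : ℤ) - 1 = x + (n + 1) - 1 by ring, show x + 1 - 1 = x by ring]
      ring
    · omega

lemma po_of_nonpos (hq : 0 < q) (m : ℤ) (hm : 0 ≤ m) (n : ℕ) :
    po q (-m) n = (-1) ^ n * (fa q m * rf q (m - n)) := by
  induction n with
  | zero => simp [po_zero, fa_mul_rf hq hm]
  | succ n ih =>
    rw [po_succ, ih]
    push_cast
    rw [show m - ((n : ℤ) + 1) = m - n - 1 by ring, rf_pred hq,
      show -m + (n : ℤ) = -(m - n) by ring, qi_neg]
    ring

/-! ### The balanced summation theorem and its factorial forms -/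

/-- The terminating balanced `₃φ₂` summation in polynomial form. -/
theorem saalschutz_po (hq : 0 < q) (n : ℕ) (a b c : ℤ) :
    ∑ s ∈ range (n + 1), fa q n * rf q s * rf q ((n : ℤ) - s) *
        (po q a s * po q b s * po q (c + s) (n - s) * po q (c - a - b) (n - s)) =
      po q (c - a) n * po q (c - b) n := by
  induction n generalizing c with
  | zero => simp [po_zero, fa_zero, rf_zero]
  | succ n ih =>
    have key := ih (c + 1)
    -- Telescoping certificate: the summand for `(n + 1, c)` minus `[c - a][c - b]` times the
    -- summand for `(n, c + 1)` equals `G (s + 1) - G s`. After common factors are removed this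
    -- reduces to `i1` and `i2`, both cases of `qi_mul_sub_mul`.
    set G : ℕ → ℝ := fun s => -(fa q n * rf q ((s : ℤ) - 1) * rf q ((n : ℤ) + 1 - s)) *
      (po q a s * po q b s * po q (c + s) (n + 1 - s) * po q (c - a - b + 1) (n + 1 - s)) with hG
    have tel := Finset.sum_range_sub G (n + 1)
    have hterm : ∀ s ∈ range (n + 1), G (s + 1) - G s =
        fa q ((n + 1 : ℕ) : ℤ) * rf q s * rf q (((n + 1 : ℕ) : ℤ) - s) *
          (po q a s * po q b s * po q (c + s) (n + 1 - s) * po q (c - a - b) (n + 1 - s)) -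
        qi q (c - a) * qi q (c - b) * (fa q n * rf q s * rf q ((n : ℤ) - s) *
          (po q a s * po q b s * po q (c + 1 + s) (n - s) * po q (c + 1 - a - b) (n - s))) := by
      intro s hs
      obtain ⟨r, rfl⟩ : ∃ r, n = s + r := ⟨n - s, by have := mem_range.1 hs; omega⟩
      have e1 : s + r + 1 - s = r + 1 := by omega
      have e2 : s + r + 1 - (s + 1) = r := by omega
      have e3 : s + r - s = r := by omega
      simp only [hG, e1, e2, e3]
      have h1 : po q (c + s) (r + 1) = qi q (c + s) * po q (c + 1 + s) r := by
        rw [po_succ', show c + (s : ℤ) + 1 = c + 1 + s by ring]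
      have h2 : po q (c - a - b) (r + 1) = qi q (c - a - b) * po q (c + 1 - a - b) r := by
        rw [po_succ', show c - a - b + 1 = c + 1 - a - b by ring]
      have h3 : po q (c - a - b + 1) (r + 1) = po q (c + 1 - a - b) r * qi q (c - a - b + 1 + r) := by
        rw [po_succ, show c - a - b + 1 = c + 1 - a - b by ring]
      have h4 : rf q ((s : ℤ) - 1) = qi q s * rf q s := rf_pred hq _
      have h5 : rf q (((s + r : ℕ) : ℤ) - s) = qi q (r + 1) * rf q (r + 1) := by
        rw [← rf_pred hq]; congr 1; push_cast; ring
      have h6 : fa q ((s + r + 1 : ℕ) : ℤ) = qi q (s + r + 1) * fa q ((s + r : ℕ) : ℤ) := by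
        have := fa_succ (q := q) (n := ((s + r : ℕ) : ℤ)) (by omega)
        push_cast at this ⊢
        exact this
      have h7 : (((s + r + 1 : ℕ) : ℤ) - s) = r + 1 := by push_cast; ring
      have h8 : (((s + r : ℕ) : ℤ) + 1 - (s : ℤ)) = r + 1 := by push_cast; ring
      have h9 : (((s + r : ℕ) : ℤ) + 1 - ((s + 1 : ℕ) : ℤ)) = ((s + r : ℕ) : ℤ) - s := by
        push_cast; ring
      have h10 : (((s + 1 : ℕ) : ℤ) - 1) = s := by push_cast; ring
      have h11 : po q (c + ((s + 1 : ℕ) : ℤ)) r = po q (c + 1 + s) r := by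
        congr 1; push_cast; ring
      have h12 : c - a - b + 1 = c + 1 - a - b := by ring
      rw [h9, h10, h11, h7, h8, h4, h5, h6, h1, h2, h3, po_succ, po_succ, h12]
      have i1 : qi q (c - a) * qi q (c - b) = qi q (c + s) * qi q (c - a - b - s) +
          qi q (a + s) * qi q (b + s) := by
        have := qi_mul_sub_mul hq (x := c - a) (y := c - b) (z := c + s) (w := c - a - b - s)
          (by ring)
        rw [show c - a - (c - a - b - (s : ℤ)) = b + s by ring,
          show c + (s : ℤ) - (c - a) = a + s by ring] at this
        linear_combination this
      have i2 : qi q (s + r + 1) * qi q (c - a - b) = qi q s * qi q (c + 1 - a - b + r) +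
          qi q (r + 1) * qi q (c - a - b - s) := by
        have := qi_mul_sub_mul hq (x := (s : ℤ) + r + 1) (y := c - a - b) (z := s)
          (w := c + 1 - a - b + r) (by ring)
        rw [show (s : ℤ) + r + 1 - (c + 1 - a - b + r) = -(c - a - b - s) by ring,
          show (s : ℤ) - (s + r + 1) = -(r + 1) by ring, qi_neg, qi_neg] at this
        linear_combination this
      push_cast
      linear_combination (rf q s * rf q (r + 1) * fa q ((s : ℤ) + r) * po q a s * po q b s *
        po q (c + 1 + s) r * po q (c + 1 - a - b) r) *
        (qi q (r + 1) * i1 - qi q (c + s) * i2)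
    rw [sum_congr rfl hterm, sum_sub_distrib, ← mul_sum, key] at tel
    have G0 : G 0 = 0 := by
      simp only [hG]; rw [rf_of_neg (n := ((0 : ℕ) : ℤ) - 1) (by norm_num)]; ring
    have Gn : G (n + 1) = -(po q a (n + 1) * po q b (n + 1)) := by
      simp only [hG]
      rw [show ((n + 1 : ℕ) : ℤ) - 1 = n by push_cast; ring,
        show (n : ℤ) + 1 - ((n + 1 : ℕ) : ℤ) = 0 by push_cast; ring, rf_zero, Nat.sub_self,
        po_zero, po_zero, fa_mul_rf hq (by omega)]
      ring
    rw [sum_range_succ]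
    rw [show ((n + 1 : ℕ) : ℤ) - ((n + 1 : ℕ) : ℤ) = 0 by ring, rf_zero, Nat.sub_self,
        po_zero, po_zero, fa_mul_rf hq (by omega)]
    rw [po_succ' (c - a), po_succ' (c - b), show c - a + 1 = c + 1 - a by ring,
      show c - b + 1 = c + 1 - b by ring]
    rw [G0, Gn] at tel
    linear_combination tel

lemma sum_range_of_eq_zero (f : ℕ → ℝ) {K L : ℕ} (hf : ∀ i, K ≤ i → f i = 0) (h : K ≤ L) :
    ∑ i ∈ range L, f i = ∑ i ∈ range K, f i := by
  symm
  refine sum_subset (range_subset_range.2 h) fun i _ hi => hf i ?_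
  simpa using hi

lemma sum_range_shift (f : ℕ → ℝ) {t L : ℕ} (ht : t ≤ L) (hf : ∀ i, i < t → f i = 0) :
    ∑ i ∈ range L, f i = ∑ i ∈ range (L - t), f (t + i) := by
  obtain ⟨r, rfl⟩ := Nat.exists_eq_add_of_le ht
  rw [sum_range_add, sum_eq_zero fun i hi => hf i (mem_range.1 hi), zero_add,
    Nat.add_sub_cancel_left]

/-- For `y < 0` both sides vanish, so no lower bound on `y` is required. This allows a ratio of
factorials to be treated as a `q`-polynomial also where its denominator has a negative argument. -/
lemma fa_mul_rf_eq_po (hq : 0 < q) {x y : ℤ} (n : ℕ) (hx : 0 ≤ x) (h : x - y = n) :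
    fa q x * rf q y = po q (y + 1) n := by
  rw [po_eq_fa_mul_rf hq _ _ (by omega)]
  congr 2 <;> omega

/-- The case of `saalschutz_po` with nonpositive upper parameters `-p`, `-r` and lower parameter `v
+ 1`; the two signs from the upper parameters cancel. -/
lemma saalschutz_neg_neg (hq : 0 < q) (p r v : ℤ) (n L : ℕ) (hp : 0 ≤ p) (hr : 0 ≤ r)
    (hpv : 0 ≤ p + v) (hrv : 0 ≤ r + v) (hnv : 0 ≤ n + v) (hL : n < L) :
    ∑ t ∈ range L, fa q (p + r + n + v - t) *
        (rf q t * rf q (p - t) * rf q (r - t) * rf q (n - t) * rf q (v + t)) =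
      fa q (p + r + v) * fa q (p + n + v) * fa q (r + n + v) *
        (rf q p * rf q r * rf q n * rf q (p + v) * rf q (r + v) * rf q (n + v)) := by
  rw [sum_range_of_eq_zero (K := n + 1) _ _ (by omega)]
  swap
  · intro i hi
    rw [rf_of_neg (n := (n : ℤ) - i) (by omega)]; ring
  have key := saalschutz_po hq n (-p) (-r) (v + 1)
  rw [← fa_mul_rf_eq_po hq (x := v + p + n) (y := v + p) n (by omega) (by omega) |>.trans
      (congrArg (po q · n) (show v + p + 1 = v + 1 - -p by ring)),
    ← fa_mul_rf_eq_po hq (x := v + r + n) (y := v + r) n (by omega) (by omega) |>.trans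
      (congrArg (po q · n) (show v + r + 1 = v + 1 - -r by ring))] at key
  have hK : rf q n * rf q p * rf q r * rf q (n + v) * fa q (p + r + v) *
      (fa q (v + p + n) * rf q (v + p) * (fa q (v + r + n) * rf q (v + r))) =
      fa q (p + r + v) * fa q (p + n + v) * fa q (r + n + v) *
        (rf q p * rf q r * rf q n * rf q (p + v) * rf q (r + v) * rf q (n + v)) := by
    rw [show v + p + n = p + n + v by ring, show v + r + n = r + n + v by ring,
      add_comm v p, add_comm v r]
    ring
  rw [← hK, ← key, mul_sum]
  refine sum_congr rfl fun s hs => ?_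
  have hs' : s ≤ n := by have := mem_range.1 hs; omega
  rw [po_of_nonpos hq p hp, po_of_nonpos hq r hr,
    ← (fa_mul_rf_eq_po hq (x := n + v) (y := v + s) (n - s) (by omega) (by omega)).trans
      (congrArg (po q · (n - s)) (show v + s + 1 = v + 1 + s by ring)),
    ← (fa_mul_rf_eq_po hq (x := p + r + n + v - s) (y := p + r + v) (n - s) (by omega)
      (by omega)).trans
      (congrArg (po q · (n - s)) (show p + r + v + 1 = v + 1 - -p - -r by ring))]
  rw [rf_of_nonneg (n := (n : ℤ)) (by omega), rf_of_nonneg hp, rf_of_nonneg hr,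
    rf_of_nonneg hnv, rf_of_nonneg (n := p + r + v) (by omega)]
  have h1 := fa_ne_zero hq n
  have h2 := fa_ne_zero hq p
  have h3 := fa_ne_zero hq r
  have h4 := fa_ne_zero hq (n + v)
  have h5 := fa_ne_zero hq (p + r + v)
  have h6 : ((-1 : ℝ) ^ s) * (-1) ^ s = 1 := by rw [← mul_pow]; simp
  field_simp
  linear_combination (-fa q (p + r + n + v - s) * rf q s * rf q (p - s) * rf q (r - s) *
    rf q (n - s) * rf q (v + s)) * h6

/-- The case with upper parameters `P + 1` and `-m` and lower parameter `P + w + 2`; one sign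
`(-1)^s` survives. -/
lemma saalschutz_pos_neg (hq : 0 < q) (P m w : ℤ) (n L : ℕ) (hP : 0 ≤ P) (hm : 0 ≤ m)
    (hmw : 0 ≤ m + w) (hnw : 0 ≤ n + w) (hPw : 0 ≤ P + w + 1) (hL : n < L) :
    ∑ s ∈ range L, (-1) ^ s * (fa q (P + s) * fa q (m + n + w - s)) *
        (rf q s * rf q (m - s) * rf q (n - s) * rf q (P + w + 1 + s)) =
      fa q P * fa q (m + w) * fa q (n + w) * fa q (P + m + n + w + 1) *
        (rf q m * rf q n * rf q w * rf q (P + w + 1 + m) * rf q (P + w + 1 + n)) := by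
  rw [sum_range_of_eq_zero (K := n + 1) _ _ (by omega)]
  swap
  · intro i hi
    rw [rf_of_neg (n := (n : ℤ) - i) (by omega)]; ring
  have key := saalschutz_po hq n (P + 1) (-m) (P + w + 2)
  rw [← fa_mul_rf_eq_po hq (x := n + w) (y := w) n (by omega) (by omega) |>.trans
      (congrArg (po q · n) (show w + 1 = P + w + 2 - (P + 1) by ring)),
    ← fa_mul_rf_eq_po hq (x := P + m + n + w + 1) (y := P + w + 1 + m) n (by omega) (by omega)
      |>.trans (congrArg (po q · n) (show P + w + 1 + m + 1 = P + w + 2 - -m by ring))] at key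
  have hK : rf q n * fa q P * rf q m * rf q (P + w + 1 + n) * fa q (m + w) *
      (fa q (n + w) * rf q w * (fa q (P + m + n + w + 1) * rf q (P + w + 1 + m))) =
      fa q P * fa q (m + w) * fa q (n + w) * fa q (P + m + n + w + 1) *
        (rf q m * rf q n * rf q w * rf q (P + w + 1 + m) * rf q (P + w + 1 + n)) := by
    ring
  rw [← hK, ← key, mul_sum]
  refine sum_congr rfl fun s hs => ?_
  have hs' : s ≤ n := by have := mem_range.1 hs; omega
  rw [po_of_nonpos hq m hm,
    ← fa_mul_rf_eq_po hq (x := P + s) (y := P) s (by omega) (by omega),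
    ← (fa_mul_rf_eq_po hq (x := P + w + 1 + n) (y := P + w + 1 + s) (n - s) (by omega)
      (by omega)).trans
      (congrArg (po q · (n - s)) (show P + w + 1 + s + 1 = P + w + 2 + s by ring)),
    ← (fa_mul_rf_eq_po hq (x := m + n + w - s) (y := m + w) (n - s) (by omega)
      (by omega)).trans
      (congrArg (po q · (n - s)) (show m + w + 1 = P + w + 2 - (P + 1) - -m by ring))]
  rw [rf_of_nonneg (n := (n : ℤ)) (by omega), rf_of_nonneg hP, rf_of_nonneg hm,
    rf_of_nonneg hmw, rf_of_nonneg (n := P + w + 1 + n) (by omega)]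
  have h1 := fa_ne_zero hq n
  have h2 := fa_ne_zero hq P
  have h3 := fa_ne_zero hq m
  have h4 := fa_ne_zero hq (m + w)
  have h5 := fa_ne_zero hq (P + w + 1 + n)
  field_simp

/-- The case in which the lower parameter `-(m + n + v)` is nonpositive as well, with upper
parameters `-m` and `-(m + n + u + v + 1)`. -/
lemma saalschutz_neg_lower (hq : 0 < q) (m u v : ℤ) (n L : ℕ) (hm : 0 ≤ m)
    (hmu : 0 ≤ m + u) (hnu : 0 ≤ n + u) (hmv : 0 ≤ m + v) (hnv : 0 ≤ n + v) (hL : n < L) :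
    ∑ s ∈ range L, (-1) ^ s * (fa q (m + n + v - s) * fa q (m + n + u - s)) *
        (rf q s * rf q (m - s) * rf q (n - s) * rf q (m + n + u + v + 1 - s)) =
      fa q (m + v) * fa q (n + v) * fa q (m + u) * fa q (n + u) *
        (rf q m * rf q n * rf q v * rf q u * rf q (m + n + u + v + 1)) := by
  rw [sum_range_of_eq_zero (K := n + 1) _ _ (by omega)]
  swap
  · intro i hi
    rw [rf_of_neg (n := (n : ℤ) - i) (by omega)]; ring
  have key := saalschutz_po hq n (-m) (-(m + n + u + v + 1)) (-(m + n + v))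
  rw [← fa_mul_rf_eq_po hq (x := n + u) (y := u) n (by omega) (by omega) |>.trans
      (congrArg (po q · n) (show u + 1 = -(m + n + v) - -(m + n + u + v + 1) by ring)),
    show -(m + n + v) - -m = -(n + v) by ring, po_of_nonpos hq (n + v) hnv,
    show (n : ℤ) + v - n = v by ring] at key
  have hone : ∀ k : ℕ, ((-1 : ℝ) ^ k) * (-1) ^ k = 1 := fun k => by rw [← mul_pow]; simp
  have hK : (-1) ^ n * (rf q n * rf q m * rf q (m + n + u + v + 1) * fa q (m + v) * fa q (m + u)) *
      ((-1) ^ n * (fa q (n + v) * rf q v) * (fa q (n + u) * rf q u)) =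
      fa q (m + v) * fa q (n + v) * fa q (m + u) * fa q (n + u) *
        (rf q m * rf q n * rf q v * rf q u * rf q (m + n + u + v + 1)) := by
    linear_combination (rf q n * rf q m * rf q (m + n + u + v + 1) * fa q (m + v) * fa q (m + u) *
      ((fa q (n + v) * rf q v) * (fa q (n + u) * rf q u))) * hone n
  rw [← hK, ← key, mul_sum]
  refine sum_congr rfl fun s hs => ?_
  have hs' : s ≤ n := by have := mem_range.1 hs; omega
  rw [po_of_nonpos hq m hm, po_of_nonpos hq (m + n + u + v + 1) (by omega),
    show -(m + n + v) + (s : ℤ) = -(m + n + v - s) by ring,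
    po_of_nonpos hq (m + n + v - s) (by omega),
    show m + n + v - s - ((n - s : ℕ) : ℤ) = m + v by omega,
    ← (fa_mul_rf_eq_po hq (x := m + n + u - s) (y := m + u) (n - s) (by omega)
      (by omega)).trans
      (congrArg (po q · (n - s)) (show m + u + 1 = -(n + v) - -(m + n + u + v + 1) by ring))]
  rw [rf_of_nonneg (n := (n : ℤ)) (by omega), rf_of_nonneg hm, rf_of_nonneg hmu,
    rf_of_nonneg hmv, rf_of_nonneg (n := m + n + u + v + 1) (by omega)]
  have h1 := fa_ne_zero hq n
  have h2 := fa_ne_zero hq m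
  have h3 := fa_ne_zero hq (m + u)
  have h4 := fa_ne_zero hq (m + v)
  have h5 := fa_ne_zero hq (m + n + u + v + 1)
  have h6 : ((-1 : ℝ) ^ n) = (-1) ^ s * (-1) ^ (n - s) := by rw [← pow_add]; congr 1; omega
  have h7 := hone s
  have h8 := hone (n - s)
  rw [h6]
  generalize ((-1 : ℝ) ^ s) = x at *
  generalize ((-1 : ℝ) ^ (n - s)) = y at *
  field_simp
  have h9 : x * y * (x * (x * y)) = x := by
    linear_combination (x * (y * y)) * h7 + x * h8
  linear_combination (-fa q (m + n + v - s) * fa q (m + n + u - s) * rf q s * rf q (n - s) *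
    rf q (m - s) * rf q (m + n + u + v + 1 - s)) * h9

/-! ### Racah's form of the `6j` sum and the mirror transformation -/

/-- The symmetric single-sum form of the `q`-`6j` coefficient, up to normalization. -/
def racahSum (q : ℝ) (L : ℕ) (p₁ p₂ p₃ p₄ u v : ℤ) : ℝ :=
  ∑ t ∈ range L, (-1) ^ t * fa q (p₁ + p₂ + p₃ + p₄ + u + v + 1 - t) *
    (rf q t * rf q (p₁ - t) * rf q (p₂ - t) * rf q (p₃ - t) * rf q (p₄ - t) *
      rf q (u + t) * rf q (v + t))

/-- `saalschutz_neg_neg` read from right to left: a quotient of factorials in `n` is opened into a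
sum. For `n + v < 0` both sides vanish. -/
lemma saalschutz_expand (hq : 0 < q) (p r v : ℤ) (n L : ℕ) (hp : 0 ≤ p) (hr : 0 ≤ r)
    (hpv : 0 ≤ p + v) (hrv : 0 ≤ r + v) (hL : n < L) :
    fa q (p + v + n) * fa q (r + v + n) * (rf q n * rf q (v + n)) =
      fa q p * fa q r * fa q (p + v) * fa q (r + v) * rf q (p + r + v) *
        ∑ t ∈ range L, fa q (p + r + n + v - t) *
          (rf q t * rf q (p - t) * rf q (r - t) * rf q (n - t) * rf q (v + t)) := by
  by_cases hnv : 0 ≤ n + v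
  · rw [saalschutz_neg_neg hq p r v n L hp hr hpv hrv hnv hL]
    rw [rf_of_nonneg hp, rf_of_nonneg hr, rf_of_nonneg hpv, rf_of_nonneg hrv,
      rf_of_nonneg (n := p + r + v) (by omega)]
    have h2 := fa_ne_zero hq p
    have h3 := fa_ne_zero hq r
    have h4 := fa_ne_zero hq (p + v)
    have h5 := fa_ne_zero hq (r + v)
    have h6 := fa_ne_zero hq (p + r + v)
    rw [show p + v + n = p + n + v by ring, show r + v + n = r + n + v by ring,
      add_comm v (n : ℤ)]
    field_simp
  · rw [rf_of_neg (n := v + n) (by omega), sum_eq_zero, mul_zero, mul_zero, mul_zero]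
    intro t _
    by_cases ht : (t : ℤ) ≤ n
    · rw [rf_of_neg (n := v + t) (by omega)]; ring
    · rw [rf_of_neg (n := (n : ℤ) - t) (by omega)]; ring

/-- The factors in `p₁`, `p₂` are opened by `saalschutz_expand`, the sums are exchanged, and the sum
over `z ≥ t` is again balanced and closes by `saalschutz_pos_neg`. -/
theorem sum_eq_racahSum (hq : 0 < q) (L : ℕ) (p₁ p₂ p₃ p₄ u v : ℤ)
    (h₁ : 0 ≤ p₁) (h₂ : 0 ≤ p₂) (h₁v : 0 ≤ p₁ + v) (h₂v : 0 ≤ p₂ + v)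
    (h₁u : 0 ≤ p₁ + u) (h₃u : 0 ≤ p₃ + u) (h₄u : 0 ≤ p₄ + u) (hL : p₄ < L) :
    ∑ z ∈ range L, (-1) ^ z *
        (fa q (p₁ + v + z) * fa q (p₂ + v + z) * fa q (p₃ + p₄ + u - z)) *
        (rf q z * rf q (p₃ - z) * rf q (p₄ - z) * rf q (v + z) *
          rf q (p₁ + p₂ + u + v + 1 + z)) =
      fa q p₁ * fa q p₂ * fa q (p₁ + v) * fa q (p₂ + v) * fa q (p₃ + u) * fa q (p₄ + u) *
        (rf q (p₁ + p₂ + p₃ + u + v + 1) * rf q (p₁ + p₂ + p₄ + u + v + 1)) *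
        racahSum q L p₁ p₂ p₃ p₄ u v := by
  set K := fa q p₁ * fa q p₂ * fa q (p₁ + v) * fa q (p₂ + v) * rf q (p₁ + p₂ + v) with hK
  have step1 : ∀ z ∈ range L, (-1) ^ z *
        (fa q (p₁ + v + z) * fa q (p₂ + v + z) * fa q (p₃ + p₄ + u - z)) *
        (rf q z * rf q (p₃ - z) * rf q (p₄ - z) * rf q (v + z) *
          rf q (p₁ + p₂ + u + v + 1 + z)) =
      ∑ t ∈ range L, K * (rf q t * rf q (p₁ - t) * rf q (p₂ - t) * rf q (v + t)) *
        ((-1) ^ z * (fa q (p₁ + p₂ + z + v - t) * fa q (p₃ + p₄ + u - z)) *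
          (rf q (z - t) * rf q (p₃ - z) * rf q (p₄ - z) * rf q (p₁ + p₂ + u + v + 1 + z))) := by
    intro z hz
    have := saalschutz_expand hq p₁ p₂ v z L h₁ h₂ h₁v h₂v (mem_range.1 hz)
    rw [← hK] at this
    calc _ = (fa q (p₁ + v + z) * fa q (p₂ + v + z) * (rf q z * rf q (v + z))) *
          ((-1) ^ z * fa q (p₃ + p₄ + u - z) *
            (rf q (p₃ - z) * rf q (p₄ - z) * rf q (p₁ + p₂ + u + v + 1 + z))) := by ring
      _ = _ := by
        rw [this, mul_sum, sum_mul]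
        refine sum_congr rfl fun t _ => ?_
        ring
  rw [sum_congr rfl step1, sum_comm, racahSum, mul_sum]
  refine sum_congr rfl fun t ht => ?_
  have htL : t < L := mem_range.1 ht
  rw [← mul_sum]
  rw [sum_range_shift _ htL.le]
  swap
  · intro i hi
    rw [rf_of_neg (n := (i : ℤ) - t) (by omega)]; ring
  by_cases ht3 : (t : ℤ) ≤ p₃
  swap
  · rw [rf_of_neg (n := p₃ - t) (by omega), sum_eq_zero]
    · ring
    intro s _
    rw [rf_of_neg (n := p₃ - ((t + s : ℕ) : ℤ)) (by push_cast; omega)]; ring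
  by_cases ht4 : (t : ℤ) ≤ p₄
  swap
  · rw [rf_of_neg (n := p₄ - t) (by omega), sum_eq_zero]
    · ring
    intro s _
    rw [rf_of_neg (n := p₄ - ((t + s : ℕ) : ℤ)) (by push_cast; omega)]; ring
  obtain ⟨n, hn⟩ : ∃ n : ℕ, p₄ = t + n := ⟨(p₄ - t).toNat, by omega⟩
  subst hn
  have key := saalschutz_pos_neg hq (p₁ + p₂ + v) (p₃ - t) (u + t) n (L - t) (by omega) (by omega)
    (by omega) (by omega) (by omega) (by omega)
  have hs : ∀ s ∈ range (L - t), (-1 : ℝ) ^ (t + s) *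
      (fa q (p₁ + p₂ + ((t + s : ℕ) : ℤ) + v - t) *
        fa q (p₃ + (t + n) + u - ((t + s : ℕ) : ℤ))) *
      (rf q (((t + s : ℕ) : ℤ) - t) * rf q (p₃ - ((t + s : ℕ) : ℤ)) *
        rf q (t + n - ((t + s : ℕ) : ℤ)) * rf q (p₁ + p₂ + u + v + 1 + ((t + s : ℕ) : ℤ))) =
      (-1) ^ t * ((-1) ^ s * (fa q (p₁ + p₂ + v + s) * fa q (p₃ - t + n + (u + t) - s)) *
        (rf q s * rf q (p₃ - t - s) * rf q (n - s) * rf q (p₁ + p₂ + v + (u + t) + 1 + s))) := by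
    intro s _
    rw [pow_add,
      show p₁ + p₂ + ((t + s : ℕ) : ℤ) + v - t = p₁ + p₂ + v + s by push_cast; ring,
      show p₃ + (t + n) + u - ((t + s : ℕ) : ℤ) = p₃ - t + n + (u + t) - s by push_cast; ring,
      show ((t + s : ℕ) : ℤ) - t = s by push_cast; ring,
      show p₃ - ((t + s : ℕ) : ℤ) = p₃ - t - s by push_cast; ring,
      show (t : ℤ) + n - ((t + s : ℕ) : ℤ) = n - s by push_cast; ring,
      show p₁ + p₂ + u + v + 1 + ((t + s : ℕ) : ℤ) = p₁ + p₂ + v + (u + t) + 1 + s by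
        push_cast; ring]
    ring
  rw [sum_congr rfl hs, ← mul_sum, key, hK]
  rw [show p₃ - t + (u + t) = p₃ + u by ring, show (n : ℤ) + (u + t) = t + n + u by ring,
    show p₁ + p₂ + v + (p₃ - t) + n + (u + t) + 1 = p₁ + p₂ + p₃ + (t + n) + u + v + 1 - t by ring,
    show p₁ + p₂ + v + (u + t) + 1 + (p₃ - t) = p₁ + p₂ + p₃ + u + v + 1 by ring,
    show p₁ + p₂ + v + (u + t) + 1 + n = p₁ + p₂ + (t + n) + u + v + 1 by ring,
    show (t : ℤ) + n - t = n by ring]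
  have h6 := fa_mul_rf hq (n := p₁ + p₂ + v) (by omega)
  generalize fa q (p₁ + p₂ + v) = x at *
  generalize rf q (p₁ + p₂ + v) = y at *
  linear_combination (fa q p₁ * fa q p₂ * fa q (p₁ + v) * fa q (p₂ + v) * fa q (p₃ + u) *
    fa q (t + n + u) * (rf q (p₁ + p₂ + p₃ + u + v + 1) * rf q (p₁ + p₂ + (t + n) + u + v + 1)) *
    ((-1) ^ t * fa q (p₁ + p₂ + p₃ + (t + n) + u + v + 1 - t) *
    (rf q t * rf q (p₁ - t) * rf q (p₂ - t) * rf q (p₃ - t) * rf q n *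
      rf q (u + t) * rf q (v + t)))) * h6

/-- The same double-sum argument, opening the factors in `p₃`, `p₄` by `saalschutz_neg_neg` and
closing the sum over `z ≥ t` by `saalschutz_neg_lower`. -/
theorem mirror_sum_eq_racahSum (hq : 0 < q) (L : ℕ) (p₁ p₂ p₃ p₄ u v : ℤ)
    (h₃ : 0 ≤ p₃) (h₄ : 0 ≤ p₄) (h₁v : 0 ≤ p₁ + v) (h₂v : 0 ≤ p₂ + v) (h₃v : 0 ≤ p₃ + v)
    (h₁u : 0 ≤ p₁ + u) (h₂u : 0 ≤ p₂ + u) (h₄v : 0 ≤ p₄ + v) (hL : p₂ < L) :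
    ∑ z ∈ range L, (-1) ^ z *
        (fa q (p₁ + p₂ + v - z) * fa q (p₁ + p₂ + u - z) *
          fa q (p₁ + p₂ + p₃ + p₄ + u + v + 1 - z)) *
        (rf q z * rf q (p₁ - z) * rf q (p₂ - z) * rf q (p₁ + p₂ + p₃ + u + v + 1 - z) *
          rf q (p₁ + p₂ + p₄ + u + v + 1 - z)) =
      fa q (p₁ + u) * fa q (p₁ + v) * fa q (p₂ + u) * fa q (p₂ + v) * fa q p₃ * fa q p₄ *
        (rf q (p₁ + p₂ + p₃ + u + v + 1) * rf q (p₁ + p₂ + p₄ + u + v + 1)) *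
        racahSum q L p₁ p₂ p₃ p₄ u v := by
  set K := fa q p₃ * fa q p₄ * fa q (p₁ + p₂ + u + v + 1) *
    (rf q (p₁ + p₂ + p₃ + u + v + 1) * rf q (p₁ + p₂ + p₄ + u + v + 1)) with hK
  have step1 : ∀ z ∈ range L, (-1) ^ z *
        (fa q (p₁ + p₂ + v - z) * fa q (p₁ + p₂ + u - z) *
          fa q (p₁ + p₂ + p₃ + p₄ + u + v + 1 - z)) *
        (rf q z * rf q (p₁ - z) * rf q (p₂ - z) * rf q (p₁ + p₂ + p₃ + u + v + 1 - z) *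
          rf q (p₁ + p₂ + p₄ + u + v + 1 - z)) =
      ∑ t ∈ range L, K * (fa q (p₁ + p₂ + p₃ + p₄ + u + v + 1 - t) *
          (rf q t * rf q (p₃ - t) * rf q (p₄ - t))) *
        ((-1) ^ z * (fa q (p₁ + p₂ + v - z) * fa q (p₁ + p₂ + u - z)) *
          (rf q (z - t) * rf q (p₁ - z) * rf q (p₂ - z) *
            rf q (p₁ + p₂ + u + v + 1 - z + t))) := by
    intro z hz
    by_cases hz1 : (z : ℤ) ≤ p₁
    swap
    · rw [rf_of_neg (n := p₁ - z) (by omega), sum_eq_zero fun t _ => by ring]; ring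
    have key := saalschutz_neg_neg hq p₃ p₄ (p₁ + p₂ + u + v + 1 - z) z L h₃ h₄ (by omega)
      (by omega) (by omega) (mem_range.1 hz)
    rw [show p₃ + p₄ + (p₁ + p₂ + u + v + 1 - z) = p₁ + p₂ + p₃ + p₄ + u + v + 1 - z by ring,
      show p₃ + z + (p₁ + p₂ + u + v + 1 - z) = p₁ + p₂ + p₃ + u + v + 1 by ring,
      show p₄ + z + (p₁ + p₂ + u + v + 1 - z) = p₁ + p₂ + p₄ + u + v + 1 by ring,
      show p₃ + (p₁ + p₂ + u + v + 1 - z) = p₁ + p₂ + p₃ + u + v + 1 - z by ring,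
      show p₄ + (p₁ + p₂ + u + v + 1 - z) = p₁ + p₂ + p₄ + u + v + 1 - z by ring,
      show (z : ℤ) + (p₁ + p₂ + u + v + 1 - z) = p₁ + p₂ + u + v + 1 by ring] at key
    have e1 : ∀ t ∈ range L, K * (fa q (p₁ + p₂ + p₃ + p₄ + u + v + 1 - t) *
          (rf q t * rf q (p₃ - t) * rf q (p₄ - t))) *
        ((-1) ^ z * (fa q (p₁ + p₂ + v - z) * fa q (p₁ + p₂ + u - z)) *
          (rf q (z - t) * rf q (p₁ - z) * rf q (p₂ - z) *
            rf q (p₁ + p₂ + u + v + 1 - z + t))) =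
        (K * ((-1) ^ z * (fa q (p₁ + p₂ + v - z) * fa q (p₁ + p₂ + u - z)) *
          (rf q (p₁ - z) * rf q (p₂ - z)))) *
        (fa q (p₃ + p₄ + z + (p₁ + p₂ + u + v + 1 - z) - t) * (rf q t * rf q (p₃ - t) *
          rf q (p₄ - t) * rf q (z - t) * rf q (p₁ + p₂ + u + v + 1 - z + t))) := by
      intro t _
      rw [show p₃ + p₄ + z + (p₁ + p₂ + u + v + 1 - z) - t =
        p₁ + p₂ + p₃ + p₄ + u + v + 1 - t by ring]
      ring
    rw [sum_congr rfl e1, ← mul_sum, key, hK, rf_of_nonneg h₃, rf_of_nonneg h₄,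
      rf_of_nonneg (n := p₁ + p₂ + u + v + 1) (by omega),
      rf_of_nonneg (n := p₁ + p₂ + p₃ + u + v + 1) (by omega),
      rf_of_nonneg (n := p₁ + p₂ + p₄ + u + v + 1) (by omega)]
    have h2 := fa_ne_zero hq p₃
    have h3 := fa_ne_zero hq p₄
    have h4 := fa_ne_zero hq (p₁ + p₂ + u + v + 1)
    have h5 := fa_ne_zero hq (p₁ + p₂ + p₃ + u + v + 1)
    have h6 := fa_ne_zero hq (p₁ + p₂ + p₄ + u + v + 1)
    field_simp
  rw [sum_congr rfl step1, sum_comm, racahSum, mul_sum]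
  refine sum_congr rfl fun t ht => ?_
  have htL : t < L := mem_range.1 ht
  rw [← mul_sum]
  rw [sum_range_shift _ htL.le]
  swap
  · intro i hi
    rw [rf_of_neg (n := (i : ℤ) - t) (by omega)]; ring
  by_cases ht1 : (t : ℤ) ≤ p₁
  swap
  · rw [rf_of_neg (n := p₁ - t) (by omega), sum_eq_zero]
    · ring
    intro s _
    rw [rf_of_neg (n := p₁ - ((t + s : ℕ) : ℤ)) (by push_cast; omega)]; ring
  by_cases ht2 : (t : ℤ) ≤ p₂
  swap
  · rw [rf_of_neg (n := p₂ - t) (by omega), sum_eq_zero]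
    · ring
    intro s _
    rw [rf_of_neg (n := p₂ - ((t + s : ℕ) : ℤ)) (by push_cast; omega)]; ring
  obtain ⟨n, hn⟩ : ∃ n : ℕ, p₂ = t + n := ⟨(p₂ - t).toNat, by omega⟩
  subst hn
  have key := saalschutz_neg_lower hq (p₁ - t) (u + t) (v + t) n (L - t) (by omega) (by omega)
    (by omega) (by omega) (by omega) (by omega)
  have hs : ∀ s ∈ range (L - t), (-1 : ℝ) ^ (t + s) *
      (fa q (p₁ + (t + n) + v - ((t + s : ℕ) : ℤ)) *
        fa q (p₁ + (t + n) + u - ((t + s : ℕ) : ℤ))) *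
      (rf q (((t + s : ℕ) : ℤ) - t) * rf q (p₁ - ((t + s : ℕ) : ℤ)) *
        rf q (t + n - ((t + s : ℕ) : ℤ)) *
        rf q (p₁ + (t + n) + u + v + 1 - ((t + s : ℕ) : ℤ) + t)) =
      (-1) ^ t * ((-1) ^ s * (fa q (p₁ - t + n + (v + t) - s) * fa q (p₁ - t + n + (u + t) - s)) *
        (rf q s * rf q (p₁ - t - s) * rf q (n - s) *
          rf q (p₁ - t + n + (u + t) + (v + t) + 1 - s))) := by
    intro s _
    rw [pow_add,
      show p₁ + (t + n) + v - ((t + s : ℕ) : ℤ) = p₁ - t + n + (v + t) - s by push_cast; ring,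
      show p₁ + (t + n) + u - ((t + s : ℕ) : ℤ) = p₁ - t + n + (u + t) - s by push_cast; ring,
      show ((t + s : ℕ) : ℤ) - t = s by push_cast; ring,
      show p₁ - ((t + s : ℕ) : ℤ) = p₁ - t - s by push_cast; ring,
      show (t : ℤ) + n - ((t + s : ℕ) : ℤ) = n - s by push_cast; ring,
      show p₁ + (t + n) + u + v + 1 - ((t + s : ℕ) : ℤ) + t =
        p₁ - t + n + (u + t) + (v + t) + 1 - s by push_cast; ring]
    ring
  rw [sum_congr rfl hs, ← mul_sum, key, hK]
  rw [show p₁ - t + (u + t) = p₁ + u by ring, show (n : ℤ) + (u + t) = t + n + u by ring,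
    show p₁ - t + (v + t) = p₁ + v by ring, show (n : ℤ) + (v + t) = t + n + v by ring,
    show p₁ - t + n + (u + t) + (v + t) + 1 = p₁ + (t + n) + u + v + 1 by ring,
    show (t : ℤ) + n - t = n by ring]
  have h6 := fa_mul_rf hq (n := p₁ + (t + n) + u + v + 1) (by omega)
  generalize fa q (p₁ + (t + n) + u + v + 1) = x at *
  generalize rf q (p₁ + (t + n) + u + v + 1) = y at *
  linear_combination (fa q (p₁ + u) * fa q (p₁ + v) * fa q (t + n + u) * fa q (t + n + v) *
    fa q p₃ * fa q p₄ * (rf q (p₁ + (t + n) + p₃ + u + v + 1) *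
    rf q (p₁ + (t + n) + p₄ + u + v + 1)) *
    ((-1) ^ t * fa q (p₁ + (t + n) + p₃ + p₄ + u + v + 1 - t) *
    (rf q t * rf q (p₁ - t) * rf q n * rf q (p₃ - t) * rf q (p₄ - t) *
      rf q (u + t) * rf q (v + t)))) * h6

lemma racahSum_eq_of_lt (L L' : ℕ) (p₁ p₂ p₃ p₄ u v : ℤ)
    (hL : p₁ < L) (hL' : p₁ < L') :
    racahSum q L p₁ p₂ p₃ p₄ u v = racahSum q L' p₁ p₂ p₃ p₄ u v := by
  have : ∀ M : ℕ, p₁ < M → racahSum q M p₁ p₂ p₃ p₄ u v =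
      racahSum q (p₁ + 1).toNat p₁ p₂ p₃ p₄ u v := by
    intro M hM
    refine sum_range_of_eq_zero _ (fun i hi => ?_) (by omega)
    rw [rf_of_neg (n := p₁ - i) (by omega)]; ring
  rw [this L hL, this L' hL']

lemma racahSum_shift_nat (L w : ℕ) (p₁ p₂ p₃ p₄ v : ℤ) (hL : p₁ + w < L) :
    racahSum q L (p₁ + w) (p₂ + w) (p₃ + w) (p₄ + w) (-w) (v - w) =
      (-1) ^ w * racahSum q L p₁ p₂ p₃ p₄ w v := by
  by_cases hw : w ≤ L
  · rw [racahSum, sum_range_shift _ hw]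
    swap
    · intro i hi
      rw [rf_of_neg (n := -(w : ℤ) + i) (by omega)]; ring
    rw [racahSum_eq_of_lt L (L - w) _ _ _ _ _ _ (by omega) (by omega), racahSum, mul_sum]
    refine sum_congr rfl fun t _ => ?_
    rw [pow_add]
    rw [show p₁ + w + (p₂ + w) + (p₃ + w) + (p₄ + w) + -(w : ℤ) + (v - w) + 1 - ((w + t : ℕ) : ℤ) =
        p₁ + p₂ + p₃ + p₄ + w + v + 1 - t by push_cast; ring,
      show p₁ + w - ((w + t : ℕ) : ℤ) = p₁ - t by push_cast; ring,
      show p₂ + w - ((w + t : ℕ) : ℤ) = p₂ - t by push_cast; ring,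
      show p₃ + w - ((w + t : ℕ) : ℤ) = p₃ - t by push_cast; ring,
      show p₄ + w - ((w + t : ℕ) : ℤ) = p₄ - t by push_cast; ring,
      show -(w : ℤ) + ((w + t : ℕ) : ℤ) = t by push_cast; ring,
      show v - w + ((w + t : ℕ) : ℤ) = v + t by push_cast; ring,
      show ((w + t : ℕ) : ℤ) = w + t by push_cast; ring]
    ring
  · have h1 : ∀ t ∈ range L, (-1 : ℝ) ^ t *
        fa q (p₁ + w + (p₂ + w) + (p₃ + w) + (p₄ + w) + -(w : ℤ) + (v - w) + 1 - t) *
        (rf q t * rf q (p₁ + w - t) * rf q (p₂ + w - t) * rf q (p₃ + w - t) * rf q (p₄ + w - t) *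
          rf q (-(w : ℤ) + t) * rf q (v - w + t)) = 0 := by
      intro t ht
      have := mem_range.1 ht
      rw [rf_of_neg (n := -(w : ℤ) + t) (by omega)]; ring
    have h2 : ∀ t ∈ range L, (-1 : ℝ) ^ t * fa q (p₁ + p₂ + p₃ + p₄ + w + v + 1 - t) *
        (rf q t * rf q (p₁ - t) * rf q (p₂ - t) * rf q (p₃ - t) * rf q (p₄ - t) *
          rf q (w + t) * rf q (v + t)) = 0 := by
      intro t ht
      rw [rf_of_neg (n := p₁ - t) (by omega)]; ring
    rw [racahSum, racahSum, sum_eq_zero h1, sum_eq_zero h2, mul_zero]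

lemma neg_one_zpow_mul_self (n : ℤ) : ((-1 : ℝ) ^ n) * (-1) ^ n = 1 := by
  rw [← mul_zpow]; simp

/-- The arguments `t`, `u + t`, `v + t` play the same role in `racahSum`. The substitution `t ↦ t +
u` exchanges the first two and costs the sign `(-1)^u`. -/
lemma racahSum_shift (L : ℕ) (p₁ p₂ p₃ p₄ u v : ℤ) (hL : p₁ < L) (hL' : p₁ + u < L) :
    racahSum q L (p₁ + u) (p₂ + u) (p₃ + u) (p₄ + u) (-u) (v - u) =
      (-1) ^ u * racahSum q L p₁ p₂ p₃ p₄ u v := by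
  rcases le_total 0 u with h | h
  · obtain ⟨w, rfl⟩ := Int.eq_ofNat_of_zero_le h
    rw [racahSum_shift_nat L w p₁ p₂ p₃ p₄ v hL', zpow_natCast]
  · obtain ⟨w, hw⟩ := Int.eq_ofNat_of_zero_le (neg_nonneg.2 h)
    obtain rfl : u = -w := by omega
    have := racahSum_shift_nat (q := q) L w (p₁ + -w) (p₂ + -w) (p₃ + -w) (p₄ + -w) (v - -w)
      (by omega)
    simp only [neg_add_cancel_right, sub_neg_eq_add, add_sub_cancel_right] at this
    rw [this, neg_neg, sub_neg_eq_add, ← mul_assoc, zpow_neg, zpow_natCast, inv_mul_cancel₀, one_mul]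
    exact pow_ne_zero _ (by norm_num)

/-- The mirror form of the `q`-`6j` sum. -/
theorem sum_eq_mirror_sum (hq : 0 < q) (L : ℕ) (p₁ p₂ p₃ p₄ u v : ℤ)
    (h₁ : 0 ≤ p₁) (h₂ : 0 ≤ p₂)
    (h₁v : 0 ≤ p₁ + v) (h₂v : 0 ≤ p₂ + v) (h₃v : 0 ≤ p₃ + v) (h₄v : 0 ≤ p₄ + v)
    (h₁u : 0 ≤ p₁ + u) (h₂u : 0 ≤ p₂ + u) (h₃u : 0 ≤ p₃ + u) (h₄u : 0 ≤ p₄ + u)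
    (hL : p₄ < L) (hL₁ : p₁ < L) (hL₁u : p₁ + u < L) (hL₂ : p₂ + u < L) :
    ∑ z ∈ range L, (-1) ^ z *
        (fa q (p₁ + v + z) * fa q (p₂ + v + z) * fa q (p₃ + p₄ + u - z)) *
        (rf q z * rf q (p₃ - z) * rf q (p₄ - z) * rf q (v + z) *
          rf q (p₁ + p₂ + u + v + 1 + z)) =
      (-1) ^ u * ∑ z ∈ range L, (-1) ^ z *
        (fa q (p₁ + p₂ + u + v - z) * fa q (p₁ + p₂ + u - z) *
          fa q (p₁ + p₂ + p₃ + p₄ + 2 * u + v + 1 - z)) *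
        (rf q z * rf q (p₁ + u - z) * rf q (p₂ + u - z) *
          rf q (p₁ + p₂ + p₃ + u + v + 1 - z) * rf q (p₁ + p₂ + p₄ + u + v + 1 - z)) := by
  -- The mirror evaluation is used at the shifted parameters, so that `racahSum_shift` brings both
  -- sides to the same `racahSum`.
  have h := mirror_sum_eq_racahSum hq L (p₁ + u) (p₂ + u) (p₃ + u) (p₄ + u) (-u) (v - u)
    (by omega) (by omega) (by omega) (by omega) (by omega) (by omega) (by omega) (by omega) hL₂
  rw [racahSum_shift L p₁ p₂ p₃ p₄ u v hL₁ hL₁u] at h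
  rw [show p₁ + u + (p₂ + u) + (v - u) = p₁ + p₂ + u + v by ring,
    show p₁ + u + (p₂ + u) + -u = p₁ + p₂ + u by ring,
    show p₁ + u + (p₂ + u) + (p₃ + u) + (p₄ + u) + -u + (v - u) + 1 =
      p₁ + p₂ + p₃ + p₄ + 2 * u + v + 1 by ring,
    show p₁ + u + (p₂ + u) + (p₃ + u) + -u + (v - u) + 1 = p₁ + p₂ + p₃ + u + v + 1 by ring,
    show p₁ + u + (p₂ + u) + (p₄ + u) + -u + (v - u) + 1 = p₁ + p₂ + p₄ + u + v + 1 by ring,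
    show p₁ + u + -u = p₁ by ring, show p₂ + u + -u = p₂ by ring,
    show p₁ + u + (v - u) = p₁ + v by ring, show p₂ + u + (v - u) = p₂ + v by ring] at h
  rw [sum_eq_racahSum hq L p₁ p₂ p₃ p₄ u v h₁ h₂ h₁v h₂v h₁u h₃u h₄u hL, h]
  have := neg_one_zpow_mul_self u
  linear_combination (-fa q p₁ * fa q p₂ * fa q (p₁ + v) * fa q (p₂ + v) * fa q (p₃ + u) *
    fa q (p₄ + u) * (rf q (p₁ + p₂ + p₃ + u + v + 1) * rf q (p₁ + p₂ + p₄ + u + v + 1)) *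
    racahSum q L p₁ p₂ p₃ p₄ u v) * this

/-! ### `q`-polynomials and vanishing alternating sums -/

/-- `q`-polynomials of degree `n`: sums of products of `n` factors, each of the form
`[x + s]`, `q ^ s` or `q ^ (-s)`. -/
inductive QPoly (q : ℝ) : ℕ → (ℕ → ℝ) → Prop
  | const (c : ℝ) : QPoly q 0 fun _ => c
  | mul_qi {n : ℕ} {f : ℕ → ℝ} (x : ℤ) : QPoly q n f → QPoly q (n + 1) fun s => f s * qi q (x + s)
  | mul_pow {n : ℕ} {f : ℕ → ℝ} : QPoly q n f → QPoly q (n + 1) fun s => f s * q ^ s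
  | mul_inv {n : ℕ} {f : ℕ → ℝ} : QPoly q n f → QPoly q (n + 1) fun s => f s * (q ^ s)⁻¹
  | add {n : ℕ} {f g : ℕ → ℝ} : QPoly q n f → QPoly q n g → QPoly q n fun s => f s + g s

lemma QPoly.congr {n : ℕ} {f g : ℕ → ℝ} (hf : QPoly q n f) (h : ∀ s, f s = g s) :
    QPoly q n g := by
  rwa [← show f = g from funext h]

lemma QPoly.smul {n : ℕ} {f : ℕ → ℝ} (hf : QPoly q n f) (c : ℝ) :
    QPoly q n fun s => c * f s := by
  induction hf with
  | const d => exact .const _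
  | mul_qi x _ ih => exact (ih.mul_qi x).congr fun s => by ring
  | mul_pow _ ih => exact ih.mul_pow.congr fun s => by ring
  | mul_inv _ ih => exact ih.mul_inv.congr fun s => by ring
  | add _ _ ih ih' => exact (ih.add ih').congr fun s => by ring

lemma QPoly.shift {n : ℕ} {f : ℕ → ℝ} (hf : QPoly q n f) : QPoly q n fun s => f (s + 1) := by
  induction hf with
  | const d => exact .const _
  | mul_qi x _ ih =>
    refine (ih.mul_qi (x + 1)).congr fun s => ?_
    rw [show x + 1 + (s : ℤ) = x + ((s + 1 : ℕ) : ℤ) by push_cast; ring]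
  | mul_pow _ ih => exact (ih.mul_pow.smul q).congr fun s => by simp only [pow_succ]; ring
  | mul_inv _ ih =>
    exact (ih.mul_inv.smul q⁻¹).congr fun s => by simp only [pow_succ, _root_.mul_inv]; ring
  | add _ _ ih ih' => exact (ih.add ih').congr fun s => rfl

/-- For `q ≠ 1`, degree `k` means a combination of `q^(js)` with `|j| ≤ k` and `j ≡ k` modulo 2. The
twisted difference annihilates `j = k` and moves every other `j` to `j + 1`, which lowers the
degree. Constancy in degree zero is recorded separately because it is the base case and there is no
degree below it. -/
lemma QPoly.diff (hq : 0 < q) {k : ℕ} {f : ℕ → ℝ} (hf : QPoly q k f) :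
    (k = 0 → ∀ s, f (s + 1) = f s) ∧
      ∀ n, k = n + 1 → QPoly q n fun s => q ^ s * (f s - (q ^ k)⁻¹ * f (s + 1)) := by
  have hne : ∀ m : ℕ, q ^ m ≠ 0 := fun m => (pow_pos hq m).ne'
  induction hf with
  | const d => exact ⟨fun _ _ => rfl, fun n h => by omega⟩
  | @mul_qi k f x hf ih =>
    refine ⟨fun h => by omega, fun n h => ?_⟩
    obtain rfl : k = n := by omega
    have hid : ∀ s : ℕ, qi q (x + ((s + 1 : ℕ) : ℤ)) = q * qi q (x + s) + (q ^ x)⁻¹ * (q ^ s)⁻¹ := by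
      intro s
      rw [show x + ((s + 1 : ℕ) : ℤ) = x + s + 1 by push_cast; ring, qi_add hq, qi_one hq,
        zpow_add₀ hq.ne', zpow_natCast, zpow_one, _root_.mul_inv, mul_one]
    have hlast : QPoly q k fun s => -((q ^ (k + 1))⁻¹ * (q ^ x)⁻¹) * f (s + 1) := hf.shift.smul _
    have hmain : ∀ s, q ^ s * (f s * qi q (x + s) -
        (q ^ (k + 1))⁻¹ * (f (s + 1) * qi q (x + ((s + 1 : ℕ) : ℤ)))) =
        q ^ s * (f s - (q ^ k)⁻¹ * f (s + 1)) * qi q (x + s) +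
          -((q ^ (k + 1))⁻¹ * (q ^ x)⁻¹) * f (s + 1) := by
      intro s
      rw [hid]
      have h1 := hne s
      have h2 := hne k
      have h3 := (zpow_pos hq x).ne'
      rw [pow_succ]
      field_simp
      ring
    cases k with
    | zero =>
      refine hlast.congr fun s => ?_
      rw [hmain, ih.1 rfl s]
      simp
    | succ k =>
      exact (((ih.2 k rfl).mul_qi x).add hlast).congr fun s => (hmain s).symm
  | @mul_pow k f hf ih =>
    refine ⟨fun h => by omega, fun n h => ?_⟩
    obtain rfl : k = n := by omega
    have hmain : ∀ s, q ^ s * (f s * q ^ s - (q ^ (k + 1))⁻¹ * (f (s + 1) * q ^ (s + 1))) =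
        q ^ s * (f s - (q ^ k)⁻¹ * f (s + 1)) * q ^ s := by
      intro s
      have h2 := hne k
      rw [pow_succ, pow_succ]
      field_simp
    cases k with
    | zero =>
      refine (QPoly.const 0).congr fun s => ?_
      rw [hmain, ih.1 rfl s]
      simp
    | succ k => exact (ih.2 k rfl).mul_pow.congr fun s => (hmain s).symm
  | @mul_inv k f hf ih =>
    refine ⟨fun h => by omega, fun n h => ?_⟩
    obtain rfl : k = n := by omega
    have hlast : QPoly q k fun s => ((q ^ k)⁻¹ - (q ^ (k + 2))⁻¹) * f (s + 1) := hf.shift.smul _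
    have hmain : ∀ s, q ^ s * (f s * (q ^ s)⁻¹ -
        (q ^ (k + 1))⁻¹ * (f (s + 1) * (q ^ (s + 1))⁻¹)) =
        q ^ s * (f s - (q ^ k)⁻¹ * f (s + 1)) * (q ^ s)⁻¹ +
          ((q ^ k)⁻¹ - (q ^ (k + 2))⁻¹) * f (s + 1) := by
      intro s
      have h1 := hne s
      have h2 := hne k
      rw [pow_succ, pow_succ, pow_succ, pow_succ]
      field_simp
      ring
    cases k with
    | zero =>
      refine hlast.congr fun s => ?_
      rw [hmain, ih.1 rfl s]
      simp
    | succ k => exact ((ih.2 k rfl).mul_inv.add hlast).congr fun s => (hmain s).symm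
  | @add k f g hf hg ih ih' =>
    refine ⟨fun h s => by simp only [ih.1 h, ih'.1 h], fun n h => ?_⟩
    exact ((ih.2 n h).add (ih'.2 n h)).congr fun s => by ring

/-- The `q`-Pascal rule: `[n + 1] = q^s [n + 1 - s] + q^(s - n - 1) [s]` splits the weights, and
shifting the index in the second part leaves the twisted difference of `QPoly.diff`. -/
lemma alternating_sum_succ (hq : 0 < q) (n : ℕ) (f : ℕ → ℝ) :
    ∑ s ∈ range (n + 2), (-1) ^ s * (rf q s * rf q ((n : ℤ) + 1 - s)) * f s =
      (qi q (n + 1))⁻¹ * ∑ s ∈ range (n + 1), (-1) ^ s * (rf q s * rf q ((n : ℤ) - s)) *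
        (q ^ s * (f s - (q ^ n)⁻¹ * f (s + 1)) * q) * q⁻¹ := by
  have h0 := (qi_pos hq (show (0 : ℤ) < n + 1 by omega)).ne'
  rw [eq_inv_mul_iff_mul_eq₀ h0, mul_sum]
  have hterm : ∀ s ∈ range (n + 2), qi q (n + 1) *
      ((-1) ^ s * (rf q s * rf q ((n : ℤ) + 1 - s)) * f s) =
      (-1) ^ s * (rf q s * rf q ((n : ℤ) - s)) * (q ^ s * f s) +
      (-1) ^ s * (rf q ((s : ℤ) - 1) * rf q ((n : ℤ) + 1 - s)) * ((q ^ n)⁻¹ * q ^ s * q⁻¹ * f s) := by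
    intro s _
    have h1 := rf_pred hq s
    have h2 := rf_pred hq ((n : ℤ) + 1 - s)
    rw [show (n : ℤ) + 1 - s - 1 = n - s by ring] at h2
    have h3 := qi_add hq ((n : ℤ) + 1 - s) s
    rw [show (n : ℤ) + 1 - s + s = n + 1 by ring, zpow_natCast, zpow_sub₀ hq.ne',
      zpow_add₀ hq.ne', zpow_natCast, zpow_natCast, zpow_one, inv_div] at h3
    rw [h1, h2, h3]
    have h4 := hq.ne'
    have h5 := (pow_pos hq n).ne'
    field_simp
  rw [sum_congr rfl hterm, sum_add_distrib]
  rw [sum_range_succ (fun s : ℕ => (-1 : ℝ) ^ s * (rf q s * rf q ((n : ℤ) - s)) * (q ^ s * f s)),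
    sum_range_succ' (fun s : ℕ => (-1 : ℝ) ^ s * (rf q ((s : ℤ) - 1) * rf q ((n : ℤ) + 1 - s)) *
      ((q ^ n)⁻¹ * q ^ s * q⁻¹ * f s))]
  rw [rf_of_neg (n := (n : ℤ) - ((n + 1 : ℕ) : ℤ)) (by push_cast; omega),
    rf_of_neg (n := ((0 : ℕ) : ℤ) - 1) (by norm_num)]
  simp only [mul_zero, zero_mul, add_zero]
  rw [← sum_add_distrib]
  refine sum_congr rfl fun s _ => ?_
  rw [show ((s + 1 : ℕ) : ℤ) - 1 = s by push_cast; ring,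
    show (n : ℤ) + 1 - ((s + 1 : ℕ) : ℤ) = n - s by push_cast; ring, pow_succ, pow_succ q s]
  have h4 := hq.ne'
  have h5 := (pow_pos hq n).ne'
  field_simp
  ring

theorem QPoly.alternating_sum_eq_zero (hq : 0 < q) {n : ℕ} {f : ℕ → ℝ} (hf : QPoly q n f) :
    ∑ s ∈ range (n + 2), (-1) ^ s * (rf q s * rf q ((n : ℤ) + 1 - s)) * f s = 0 := by
  induction n generalizing f with
  | zero =>
    have h := (hf.diff hq).1 rfl 0
    simp [sum_range_succ, rf_zero, h]
  | succ n ih =>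
    have h := ih ((hf.diff hq).2 n rfl)
    rw [alternating_sum_succ hq]
    rw [show ∑ s ∈ range (n + 1 + 1), (-1 : ℝ) ^ s * (rf q s * rf q (((n + 1 : ℕ) : ℤ) - s)) *
        (q ^ s * (f s - (q ^ (n + 1))⁻¹ * f (s + 1)) * q) * q⁻¹ =
        ∑ s ∈ range (n + 2), (-1) ^ s * (rf q s * rf q ((n : ℤ) + 1 - s)) *
          (q ^ s * (f s - (q ^ (n + 1))⁻¹ * f (s + 1))) from sum_congr rfl fun s _ => by
        push_cast
        have := hq.ne'
        field_simp, h, mul_zero]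

lemma QPoly.mul_po_add {k : ℕ} {f : ℕ → ℝ} (hf : QPoly q k f) (x : ℤ) (n : ℕ) :
    QPoly q (k + n) fun s => f s * po q (x + s) n := by
  induction n with
  | zero => exact hf.congr fun s => by simp [po_zero]
  | succ n ih =>
    refine (ih.mul_qi (x + n)).congr fun s => ?_
    rw [po_succ, show x + n + (s : ℤ) = x + s + n by ring]; ring

lemma QPoly.mul_po_sub {k : ℕ} {f : ℕ → ℝ} (hf : QPoly q k f) (x : ℤ) (n : ℕ) :
    QPoly q (k + n) fun s => f s * po q (x - s) n := by
  induction n with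
  | zero => exact hf.congr fun s => by simp [po_zero]
  | succ n ih =>
    refine ((ih.mul_qi (-x - n)).smul (-1)).congr fun s => ?_
    rw [po_succ, show -x - n + (s : ℤ) = -(x - s + n) by ring, qi_neg]; ring

lemma QPoly.mul_pow_pow {k : ℕ} {f : ℕ → ℝ} (hf : QPoly q k f) (n : ℕ) :
    QPoly q (k + n) fun s => f s * q ^ (n * s) := by
  induction n with
  | zero => exact hf.congr fun s => by simp
  | succ n ih =>
    refine ih.mul_pow.congr fun s => ?_
    rw [add_mul, one_mul, pow_add, mul_assoc]

/-- A sum with alternating `q`-binomial weights of a function that is a `q`-polynomial of small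
degree on the relevant range vanishes. -/
theorem QPoly.sum_eq_zero (hq : 0 < q) {n L : ℕ} {M : ℤ} {f g : ℕ → ℝ} (hf : QPoly q n f)
    (hM : M = n + 1) (hL : M < L)
    (hg : ∀ s : ℕ, (s : ℤ) ≤ M → g s = (-1) ^ s * (rf q s * rf q (M - s)) * f s)
    (hg' : ∀ s : ℕ, M < s → g s = 0) :
    ∑ s ∈ range L, g s = 0 := by
  subst hM
  rw [sum_range_of_eq_zero (K := n + 2) g (fun i hi => hg' i (by omega)) (by omega),
    ← hf.alternating_sum_eq_zero hq]
  exact sum_congr rfl fun s hs => hg s (by have := mem_range.1 hs; omega)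

/-! ### Newton polynomials, quadrature and functionals from recurrences -/

open Polynomial in
lemma exists_newton_basis (v : ℕ → ℝ) :
    ∃ B : Module.Basis ℕ ℝ ℝ[X], ∀ y, B y = ∏ i ∈ range y, (X - C (v i)) := by
  let S : Polynomial.Sequence ℝ :=
    { elems' := fun y => ∏ i ∈ range y, (X - C (v i))
      degree_eq' := fun y => by simp [degree_prod] }
  have hS : ∀ i, IsUnit (S i).leadingCoeff := fun i => by
    have h : S i = ∏ j ∈ range i, (X - C (v j)) := rfl
    rw [h, (monic_prod_of_monic _ _ fun j _ => monic_X_sub_C (v j)).leadingCoeff]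
    exact isUnit_one
  exact ⟨S.basis hS, fun y => by simp [S]⟩

open Polynomial in
/-- A functional vanishing on the Newton polynomials of degree above `K` is a quadrature rule with
nodes `v 0, …, v K`. -/
lemma exists_quadrature (v : ℕ → ℝ) (K : ℕ) (hv : Set.InjOn v (range (K + 1)))
    (Λ : ℝ[X] →ₗ[ℝ] ℝ) (hΛ : ∀ y, K < y → Λ (∏ i ∈ range y, (X - C (v i))) = 0) :
    ∃ w : ℕ → ℝ, ∀ p : ℝ[X], Λ p = ∑ m ∈ range (K + 1), w m * p.eval (v m) := by
  let w : ℕ → ℝ := fun m => Λ (Lagrange.basis (range (K + 1)) v m)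
  let Λ' : ℝ[X] →ₗ[ℝ] ℝ := ∑ m ∈ range (K + 1), w m • Polynomial.leval (v m)
  have hΛeval : ∀ p, Λ' p = ∑ m ∈ range (K + 1), w m * p.eval (v m) := by
    intro p
    simp [Λ', Polynomial.leval]
  obtain ⟨B, hB⟩ := exists_newton_basis v
  have : Λ = Λ' := by
    refine B.ext fun y => ?_
    rw [hΛeval, hB]
    by_cases hy : K < y
    · rw [hΛ y hy]
      symm
      refine sum_eq_zero fun m hm => ?_
      -- A node `v m` with `m ≤ K < y` is a root of the Newton polynomial, so the quadrature sum
      -- vanishes as well. For `y ≤ K` Lagrange interpolation is exact.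
      rw [eval_prod, prod_eq_zero (i := m) (by have := mem_range.1 hm; simp; omega) (by simp),
        mul_zero]
    · set p : ℝ[X] := ∏ i ∈ range y, (X - C (v i)) with hp
      have hdeg : p.degree < (range (K + 1)).card := by
        rw [hp]; simp [degree_prod]; exact_mod_cast Nat.lt_succ_of_le (not_lt.1 hy)
      conv_lhs => rw [Lagrange.eq_interpolate hv hdeg]
      rw [Lagrange.interpolate_apply, map_sum]
      refine sum_congr rfl fun m _ => ?_
      rw [← smul_eq_C_mul, map_smul, smul_eq_mul, mul_comm]
  exact ⟨w, fun p => by rw [this, hΛeval]⟩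

/-- The nodes `[m][T + 1 - m]`. -/
def ell (q : ℝ) (T m : ℤ) : ℝ := qi q m * qi q (T + 1 - m)

/-- The nodes are symmetric under `i ↦ T + 1 - i`, so the difference splits into one factor for each
index. With `m = b + f - j`, the node `ℓ(m) = [b + f - j][b + f + j + 1]` plays the role of a
Casimir eigenvalue. -/
lemma ell_sub (hq : 0 < q) (T m i : ℤ) :
    ell q T m - ell q T i = qi q (m - i) * qi q (T + 1 - m - i) := by
  have := qi_mul_sub_mul hq (x := m) (y := T + 1 - m) (z := i) (w := T + 1 - i) (by ring)
  rw [ell, ell, this, show m - (T + 1 - i) = -(T + 1 - m - i) by ring,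
    show i - m = -(m - i) by ring, qi_neg, qi_neg]
  ring

open Polynomial in
/-- The Newton polynomials `∏ (X - ℓ (c + i))`. -/
def newton (q : ℝ) (T c : ℤ) (y : ℕ) : ℝ[X] := ∏ i ∈ range y, (X - C (ell q T (c + i)))

open Polynomial in
/-- The Newton polynomials `∏ (ℓ (c - i) - X)`. -/
def newtonDown (q : ℝ) (T c : ℤ) (x : ℕ) : ℝ[X] := ∏ i ∈ range x, (C (ell q T (c - i)) - X)

lemma newton_eval (hq : 0 < q) (T c m : ℤ) (y : ℕ) :
    (newton q T c y).eval (ell q T m) = po q (T + 2 - y - m - c) y * po q (m + 1 - y - c) y := by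
  rw [newton, Polynomial.eval_prod, po, po,
    ← prod_range_reflect (fun i : ℕ => qi q (T + 2 - y - m - c + i)),
    ← prod_range_reflect (fun i : ℕ => qi q (m + 1 - y - c + i)), ← prod_mul_distrib]
  refine prod_congr rfl fun i hi => ?_
  have := mem_range.1 hi
  rw [Polynomial.eval_sub, Polynomial.eval_X, Polynomial.eval_C, ell_sub hq, mul_comm]
  congr 2 <;> omega

lemma newtonDown_eval (hq : 0 < q) (T c m : ℤ) (x : ℕ) :
    (newtonDown q T c x).eval (ell q T m) = po q (c - m + 1 - x) x * po q (T + 1 - c - m) x := by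
  rw [newtonDown, Polynomial.eval_prod, po, po,
    ← prod_range_reflect (fun i : ℕ => qi q (c - m + 1 - x + i)), ← prod_mul_distrib]
  refine prod_congr rfl fun i hi => ?_
  have := mem_range.1 hi
  rw [Polynomial.eval_sub, Polynomial.eval_X, Polynomial.eval_C, ell_sub hq]
  congr 2 <;> omega

lemma po_ne_zero_of_pos (hq : 0 < q) {x : ℤ} (n : ℕ) (hx : 0 < x) : po q x n ≠ 0 :=
  prod_ne_zero_iff.2 fun i _ => qi_ne_zero hq (by omega)

lemma po_eq_zero {x : ℤ} {n : ℕ} (hx : x ≤ 0) (hn : 0 < x + n) : po q x n = 0 := by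
  refine prod_eq_zero (i := (-x).toNat) (mem_range.2 (by omega)) ?_
  rw [show x + ((-x).toNat : ℤ) = 0 by omega, qi_zero]

/-- A solution of the three-term recurrence is given by a functional on polynomials. -/
lemma exists_functional_of_rec (hq : 0 < q) (T P : ℤ) (Φ : ℕ → ℕ → ℝ)
    (hrec : ∀ x y : ℕ, Φ (x + 1) y + Φ x (y + 1) =
      qi q (P - x - y) * qi q (T - P + 1 + x - y) * Φ x y) :
    ∃ Λ : Polynomial ℝ →ₗ[ℝ] ℝ, ∀ x y, Λ (newtonDown q T P x * newton q T 0 y) = Φ x y := by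
  obtain ⟨B, hB⟩ := exists_newton_basis (fun i => ell q T (0 + i))
  refine ⟨B.constr ℝ (Φ 0), fun x => ?_⟩
  induction x with
  | zero =>
    intro y
    -- The Newton basis fixes the functional by the row `x = 0`; the recurrence then forces every
    -- other row.
    rw [newtonDown, range_zero, prod_empty, one_mul, newton, ← hB, Module.Basis.constr_basis]
  | succ x ih =>
    intro y
    have h : newtonDown q T P (x + 1) * newton q T 0 y =
        (qi q (P - x - y) * qi q (T - P + 1 + x - y)) • (newtonDown q T P x * newton q T 0 y) -
          newtonDown q T P x * newton q T 0 (y + 1) := by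
      have e : qi q (P - x - y) * qi q (T - P + 1 + x - y) = ell q T (P - x) - ell q T (0 + y) := by
        rw [ell_sub hq]; congr 2 <;> ring
      rw [e, Polynomial.smul_eq_C_mul, newtonDown, prod_range_succ, ← newtonDown, newton, newton,
        prod_range_succ, ← newton, Polynomial.C_sub]
      ring
    rw [h, map_sub, map_smul, ih, ih, smul_eq_mul, ← hrec x y]
    ring

/-! ### The first two `6j` sums and their vanishing outside the triangle conditions -/

/-- The coefficients of the first single sum. -/
def cOne (q : ℝ) (T P G C U H : ℤ) (x : ℕ) : ℝ :=
  (-1) ^ x * (fa q (H + x) * fa q (G + 2 * U - T + C - H + 1 + x)) *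
    (rf q x * rf q (U - P + x) * rf q (U - P + C + 1 + x) * rf q (G + 1 + x))

/-- The coefficients of the second single sum. -/
def cTwo (q : ℝ) (B F C U n : ℤ) (y : ℕ) : ℝ :=
  (-1) ^ y * (fa q (B - y) * fa q (U - y) * fa q (U + C + 1 - y)) *
    (rf q y * rf q (n - y) * rf q (2 * U - F + C - n + 1 - y))

/-- The first `q`-`6j` sum in mirror form, as a function of the summation spin. -/
def tOne (q : ℝ) (T : ℤ) (P : ℕ) (G C U H m : ℤ) : ℝ :=
  ∑ x ∈ range (P + 1), cOne q T P G C U H x * (fa q (T - P - m + x) * rf q (P - m - x))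

/-- The second `q`-`6j` sum in mirror form, as a function of the summation spin. -/
def tTwo (q : ℝ) (B : ℕ) (F C U n m : ℤ) : ℝ :=
  ∑ y ∈ range (B + 1), cTwo q B F C U n y * (rf q (m - y) * rf q (B + F + 1 - m - y))

lemma cOne_eq_zero {T P G C U H : ℤ} {x : ℕ} (h : U - P + x < 0) :
    cOne q T P G C U H x = 0 := by
  rw [cOne, rf_of_neg h]; ring

lemma cTwo_eq_zero {B F C U n : ℤ} {y : ℕ} (h : n < y) : cTwo q B F C U n y = 0 := by
  rw [cTwo, rf_of_neg (n := n - y) (by omega)]; ring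

lemma tOne_eq_zero_of_lt {T : ℤ} {P : ℕ} {G C U H m : ℤ} (h : U < m) :
    tOne q T P G C U H m = 0 := by
  refine sum_eq_zero fun x _ => ?_
  by_cases hx : U - P + x < 0
  · rw [cOne_eq_zero hx, zero_mul]
  · rw [rf_of_neg (n := (P : ℤ) - m - x) (by omega)]; ring

/-- The case `j > a + g`. Three ratios of factorials form a `q`-polynomial of degree `P - m - 1`,
summed against alternating weights of order `P - m`. -/
lemma tOne_eq_zero_of_upper (hq : 0 < q) {T : ℤ} {P : ℕ} {G C U H m : ℤ} (hm : 0 ≤ m)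
    (hmQ : m ≤ T - P) (hH : 0 ≤ H) (h1 : 0 ≤ P - U + H) (h2 : 0 ≤ G + P - T + U - H)
    (h3 : 0 ≤ C + U - P - H) (h : 0 ≤ T - G - P - m - 1) :
    tOne q T P G C U H m = 0 := by
  obtain ⟨d1, hd1⟩ := Int.eq_ofNat_of_zero_le h
  obtain ⟨d2, hd2⟩ := Int.eq_ofNat_of_zero_le h1
  obtain ⟨d3, hd3⟩ := Int.eq_ofNat_of_zero_le h2
  have hf := (((QPoly.const (q := q) 1).mul_po_add (G + 2) d1).mul_po_add (U - P + 1) d2).mul_po_add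
    (U - P + C + 2) d3
  refine hf.sum_eq_zero hq (M := P - m) (by omega) (by omega) (fun x hx => ?_) (fun x hx => ?_)
  · rw [cOne]
    have e1 := fa_mul_rf_eq_po hq (x := T - P - m + x) (y := G + 1 + x) d1 (by omega) (by omega)
    have e2 := fa_mul_rf_eq_po hq (x := H + x) (y := U - P + x) d2 (by omega) (by omega)
    have e3 := fa_mul_rf_eq_po hq (x := G + 2 * U - T + C - H + 1 + x) (y := U - P + C + 1 + x) d3
      (by omega) (by omega)
    rw [show G + 1 + (x : ℤ) + 1 = G + 2 + x by ring] at e1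
    rw [show U - P + (x : ℤ) + 1 = U - P + 1 + x by ring] at e2
    rw [show U - P + C + 1 + (x : ℤ) + 1 = U - P + C + 2 + x by ring] at e3
    rw [← e1, ← e2, ← e3]
    ring
  · rw [rf_of_neg (n := (P : ℤ) - m - x) (by omega)]; ring

/-- The case `j > c + k`; the factorials are paired differently, again with total degree `P - m -
1`. -/
lemma tOne_eq_zero_of_upper' (hq : 0 < q) {T : ℤ} {P : ℕ} {G C U H m : ℤ} (hm : 0 ≤ m)
    (hmQ : m ≤ T - P) (hH : 0 ≤ H) (h1 : 0 ≤ P - U + H) (h2 : 0 ≤ 2 * U - T + C - H)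
    (h3 : 0 ≤ G) (h : 0 ≤ T - U - C - m - 1) :
    tOne q T P G C U H m = 0 := by
  obtain ⟨d1, hd1⟩ := Int.eq_ofNat_of_zero_le h
  obtain ⟨d2, hd2⟩ := Int.eq_ofNat_of_zero_le h1
  obtain ⟨d3, hd3⟩ := Int.eq_ofNat_of_zero_le h2
  have hf := (((QPoly.const (q := q) 1).mul_po_add (U - P + C + 2) d1).mul_po_add (U - P + 1)
    d2).mul_po_add (G + 2) d3
  refine hf.sum_eq_zero hq (M := P - m) (by omega) (by omega) (fun x hx => ?_) (fun x hx => ?_)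
  · rw [cOne]
    have e1 := fa_mul_rf_eq_po hq (x := T - P - m + x) (y := U - P + C + 1 + x) d1 (by omega)
      (by omega)
    have e2 := fa_mul_rf_eq_po hq (x := H + x) (y := U - P + x) d2 (by omega) (by omega)
    have e3 := fa_mul_rf_eq_po hq (x := G + 2 * U - T + C - H + 1 + x) (y := G + 1 + x) d3
      (by omega) (by omega)
    rw [show U - P + C + 1 + (x : ℤ) + 1 = U - P + C + 2 + x by ring] at e1
    rw [show U - P + (x : ℤ) + 1 = U - P + 1 + x by ring] at e2
    rw [show G + 1 + (x : ℤ) + 1 = G + 2 + x by ring] at e3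
    rw [← e1, ← e2, ← e3]
    ring
  · rw [rf_of_neg (n := (P : ℤ) - m - x) (by omega)]; ring

/-- The case `j < c - k`: the three degrees add up to `m - 1`, one less than the order of the
alternating sum. -/
lemma tTwo_eq_zero_of_lower (hq : 0 < q) {B : ℕ} {F C U n m : ℤ}
    (hmB : m ≤ B) (hmU : m ≤ U) (hC : 0 ≤ C) (h1 : 0 ≤ B - n) (h2 : 0 ≤ F - U + n)
    (h : B + F - U < m) :
    tTwo q B F C U n m = 0 := by
  obtain ⟨d1, hd1⟩ := Int.eq_ofNat_of_zero_le (show 0 ≤ U - (B + F) - 1 + m by omega)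
  obtain ⟨d2, hd2⟩ := Int.eq_ofNat_of_zero_le h1
  obtain ⟨d3, hd3⟩ := Int.eq_ofNat_of_zero_le h2
  have hf := (((QPoly.const (q := q) 1).mul_po_sub (B + F + 1 - m + 1) d1).mul_po_sub (n + 1)
    d2).mul_po_sub (2 * U - F + C - n + 1 + 1) d3
  refine hf.sum_eq_zero hq (M := m) (by omega) (by omega) (fun y hy => ?_) (fun y hy => ?_)
  · rw [cTwo]
    have e1 := fa_mul_rf_eq_po hq (x := U - y) (y := B + F + 1 - m - y) d1 (by omega) (by omega)
    have e2 := fa_mul_rf_eq_po hq (x := B - y) (y := n - y) d2 (by omega) (by omega)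
    have e3 := fa_mul_rf_eq_po hq (x := U + C + 1 - y) (y := 2 * U - F + C - n + 1 - y) d3
      (by omega) (by omega)
    rw [show B + F + 1 - m - (y : ℤ) + 1 = B + F + 1 - m + 1 - y by ring] at e1
    rw [show n - (y : ℤ) + 1 = n + 1 - y by ring] at e2
    rw [show 2 * U - F + C - n + 1 - (y : ℤ) + 1 = 2 * U - F + C - n + 1 + 1 - y by ring] at e3
    rw [← e1, ← e2, ← e3]
    ring
  · rw [rf_of_neg (n := m - (y : ℤ)) (by omega)]; ring

/-! ### Splitting off the nodes above `F` -/

/-- Change of Newton basis. -/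
lemma newton_zero_eq_sum (hq : 0 < q) (B F : ℕ) (y : ℕ) :
    newton q (B + F) 0 y = ∑ s ∈ range (y + 1), Polynomial.C (fa q y * rf q s * rf q ((y : ℤ) - s) *
      (po q (F + 2 - y + s) (y - s) * po q (B + 1 - y) (y - s))) * newton q (B + F) (F + 1) s := by
  refine Polynomial.eq_of_infinite_eval_eq _ _ ?_
  -- The nodes beyond `B + F` are pairwise distinct, which gives infinitely many points at which to
  -- compare the polynomials.
  have hinj : Function.Injective fun m : ℕ => ell q (B + F) (B + F + 1 + m) := by
    intro m i h
    by_contra hne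
    have h1 := ell_sub hq (B + F) (B + F + 1 + m) (B + F + 1 + i)
    simp only at h
    rw [h, sub_self] at h1
    have h2 : qi q (B + F + 1 + m - (B + F + 1 + i)) ≠ 0 := qi_ne_zero hq (by omega)
    have h3 : qi q (B + F + 1 - (B + F + 1 + m) - (B + F + 1 + i)) ≠ 0 :=
      qi_ne_zero hq (by omega)
    exact mul_ne_zero h2 h3 h1.symm
  refine Set.infinite_of_injective_forall_mem hinj fun m' => ?_
  generalize (B : ℤ) + F + 1 + m' = m
  simp only [Set.mem_ofPred_eq]
  -- At `ℓ(m)` the connection formula is exactly the balanced summation: `c - a` and `c - b` give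
  -- the two factors of the left polynomial, and `c - a - b = B + 1 - y` does not depend on `m`.
  have key := saalschutz_po hq y (m - B) (F + 1 - m) (F + 2 - y)
  rw [newton_eval hq, Polynomial.eval_finsetSum]
  rw [show (B : ℤ) + F + 2 - y - m - 0 = F + 2 - y - (m - B) by ring,
    show m + 1 - (y : ℤ) - 0 = F + 2 - y - (F + 1 - m) by ring, ← key]
  refine sum_congr rfl fun s _ => ?_
  rw [Polynomial.eval_mul, Polynomial.eval_C]
  have h1 : (newton q (B + F) (F + 1) s).eval (ell q (B + F) m) =
      po q (m - B) s * po q (F + 1 - m) s := by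
    rw [newton, Polynomial.eval_prod, po, po, ← prod_mul_distrib]
    refine prod_congr rfl fun i _ => ?_
    rw [Polynomial.eval_sub, Polynomial.eval_X, Polynomial.eval_C, ell_sub hq,
      show m - (F + 1 + (i : ℤ)) = -(F + 1 - m + i) by ring,
      show (B : ℤ) + F + 1 - m - (F + 1 + i) = -(m - B + i) by ring, qi_neg, qi_neg]
    ring
  rw [h1, show (F : ℤ) + 2 - y - (m - B) - (F + 1 - m) = B + 1 - y by ring]
  ring

/-- The change-of-basis factors supply weights of order `F + 1`, while the remaining ratios have
degree `(U - n) + (F - U + n) = F`. The bound `s < U - F` keeps the argument of `[U - s - r]!`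
nonnegative for all `r ≤ F + 1`. -/
lemma cTwo_newton_coeff_eq_zero (hq : 0 < q) {B F : ℕ} {C U n : ℤ} {s : ℕ} (hsB : s ≤ B)
    (hC : 0 ≤ C) (hnB : n ≤ B) (h1 : 0 ≤ U - n) (h2 : 0 ≤ F - U + n) (hs : s < U - F) :
    ∑ r ∈ range (B + 1 - s), cTwo q B F C U n (s + r) *
      (fa q ((s + r : ℕ) : ℤ) * rf q s * rf q (((s + r : ℕ) : ℤ) - s) *
        (po q (F + 2 - ((s + r : ℕ) : ℤ) + s) r * po q (B + 1 - ((s + r : ℕ) : ℤ)) r)) = 0 := by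
  obtain ⟨d1, hd1⟩ := Int.eq_ofNat_of_zero_le h1
  obtain ⟨d2, hd2⟩ := Int.eq_ofNat_of_zero_le h2
  have hf := (((QPoly.const (q := q) 1).mul_po_sub (n - s + 1) d1).mul_po_sub
    (2 * U - F + C - n + 1 - s + 1) d2).smul ((-1) ^ s * (rf q s * fa q (F + 1) * fa q (B - s)))
  have key : ∑ r ∈ range (B + F + 2), (-1) ^ s * (rf q s * fa q (F + 1) * fa q (B - s)) *
      ((-1) ^ r * (rf q r * rf q (F + 1 - r)) * (fa q (U - s - r) * rf q (n - s - r)) *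
        (fa q (U + C + 1 - s - r) * rf q (2 * U - F + C - n + 1 - s - r))) = 0 := by
    refine hf.sum_eq_zero hq (M := F + 1) (by omega) (by push_cast; omega) (fun r hr => ?_)
      (fun r hr => ?_)
    · have e1 := fa_mul_rf_eq_po hq (x := U - s - r) (y := n - s - r) d1 (by omega) (by omega)
      have e2 := fa_mul_rf_eq_po hq (x := U + C + 1 - s - r) (y := 2 * U - F + C - n + 1 - s - r) d2
        (by omega) (by omega)
      rw [show n - s - (r : ℤ) + 1 = n - s + 1 - r by ring] at e1
      rw [show 2 * U - F + C - n + 1 - s - (r : ℤ) + 1 = 2 * U - F + C - n + 1 - s + 1 - r by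
        ring] at e2
      rw [← e1, ← e2]
      ring
    · rw [rf_of_neg (n := (F : ℤ) + 1 - r) (by omega)]; ring
  rw [← key]
  symm
  rw [sum_range_of_eq_zero (K := B + 1 - s) _ _ (by omega)]
  swap
  · intro r hr
    rw [rf_of_neg (n := n - s - (r : ℤ)) (by omega)]; ring
  refine sum_congr rfl fun r hr => ?_
  have hr' := mem_range.1 hr
  rw [cTwo, show (F : ℤ) + 2 - ((s + r : ℕ) : ℤ) + s = F + 2 - r by push_cast; ring,
    po_eq_fa_mul_rf hq _ _ (by omega), po_eq_fa_mul_rf hq _ _ (by omega)]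
  rw [show (F : ℤ) + 2 - r + r - 1 = F + 1 by ring, show (F : ℤ) + 2 - r - 1 = F + 1 - r by ring,
    show (B : ℤ) + 1 - ((s + r : ℕ) : ℤ) + r - 1 = B - s by push_cast; ring,
    show (B : ℤ) + 1 - ((s + r : ℕ) : ℤ) - 1 = B - ((s + r : ℕ) : ℤ) by ring,
    show U - s - r = U - ((s + r : ℕ) : ℤ) by push_cast; ring,
    show n - s - r = n - ((s + r : ℕ) : ℤ) by push_cast; ring,
    show U + C + 1 - s - r = U + C + 1 - ((s + r : ℕ) : ℤ) by push_cast; ring,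
    show 2 * U - F + C - n + 1 - s - r = 2 * U - F + C - n + 1 - ((s + r : ℕ) : ℤ) by
      push_cast; ring, show ((s + r : ℕ) : ℤ) - s = r by push_cast; ring, pow_add]
  have h3 := fa_mul_rf hq (n := ((s + r : ℕ) : ℤ)) (by omega)
  have h4 := fa_mul_rf hq (n := B - ((s + r : ℕ) : ℤ)) (by omega)
  generalize fa q ((s + r : ℕ) : ℤ) = a1 at *
  generalize rf q ((s + r : ℕ) : ℤ) = a2 at *
  generalize fa q (B - ((s + r : ℕ) : ℤ)) = b1 at *
  generalize rf q (B - ((s + r : ℕ) : ℤ)) = b2 at *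
  have h5 : a1 * a2 * (b1 * b2) = 1 := by rw [h3, h4, one_mul]
  linear_combination -((-1) ^ s * (rf q s * fa q (F + 1) * fa q (B - s)) *
      ((-1) ^ r * (rf q r * rf q (F + 1 - r)) *
        (fa q (U - ((s + r : ℕ) : ℤ)) * rf q (n - ((s + r : ℕ) : ℤ))) *
        (fa q (U + C + 1 - ((s + r : ℕ) : ℤ)) *
          rf q (2 * U - F + C - n + 1 - ((s + r : ℕ) : ℤ))))) * h5

/-- The polynomial of the second single sum in the Newton basis at the lower end of the range of
the summation spin. -/
lemma exists_newton_expansion (hq : 0 < q) {B F : ℕ} {C U n : ℤ}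
    (hC : 0 ≤ C) (hnB : n ≤ B) (h1 : 0 ≤ U - n) (h2 : 0 ≤ F - U + n) :
    ∃ d : ℕ → ℝ, (∀ s : ℕ, s < U - F → d s = 0) ∧
      ∑ y ∈ range (B + 1), Polynomial.C (cTwo q B F C U n y) * newton q (B + F) 0 y =
        ∑ s ∈ range (B + 1), Polynomial.C (d s) * newton q (B + F) (F + 1) s := by
  set κ : ℕ → ℕ → ℝ := fun y s => fa q y * rf q s * rf q ((y : ℤ) - s) *
      (po q (F + 2 - y + s) (y - s) * po q (B + 1 - y) (y - s)) with hκ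
  have hκ0 : ∀ y s : ℕ, y < s → κ y s = 0 := by
    intro y s h
    simp only [hκ]; rw [rf_of_neg (n := (y : ℤ) - s) (by omega)]; ring
  refine ⟨fun s => if s ≤ B then ∑ y ∈ range (B + 1), cTwo q B F C U n y * κ y s else 0,
    fun s hs => ?_, ?_⟩
  · dsimp only
    split_ifs with hsB
    swap
    · rfl
    rw [sum_range_shift _ (show s ≤ B + 1 by omega)
      (fun i hi => by rw [hκ0 i s hi, mul_zero]),
      ← cTwo_newton_coeff_eq_zero hq hsB hC hnB h1 h2 hs]
    refine sum_congr rfl fun r _ => ?_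
    simp only [hκ, Nat.add_sub_cancel_left]
  · have e1 : ∀ y ∈ range (B + 1),
        Polynomial.C (cTwo q B F C U n y) * newton q (B + F) 0 y =
        ∑ s ∈ range (B + 1), Polynomial.C (cTwo q B F C U n y * κ y s) *
          newton q (B + F) (F + 1) s := by
      intro y hy
      have hy' := mem_range.1 hy
      rw [newton_zero_eq_sum hq, mul_sum]
      rw [sum_subset (range_subset_range.2 (show y + 1 ≤ B + 1 by omega))]
      · refine sum_congr rfl fun s _ => ?_
        rw [← mul_assoc, ← Polynomial.C_mul]
      · intro s _ hs
        have : y < s := by simpa using hs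
        have h0 := hκ0 y s this
        simp only [hκ] at h0
        rw [h0]; simp
    rw [sum_congr rfl e1, sum_comm]
    refine sum_congr rfl fun s hs => ?_
    have hs' : s ≤ B := by have := mem_range.1 hs; omega
    simp only [hs', if_true]
    rw [map_sum, sum_mul]

/-- One factor has the nodes `P, P - 1, …` as roots (`x` of them), the other `F + 1, F + 2, …` (`s`
of them). Together they cover `F + 1, …, P` as soon as `x + s ≥ P - F`. -/
lemma newtonDown_dvd (T : ℤ) (P F x s : ℕ) (hP : F ≤ P) (h : P ≤ x + F + s) :
    newtonDown q T P (P - F) ∣ newtonDown q T P x * newton q T (F + 1) s := by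
  by_cases hx : P - F ≤ x
  · exact Dvd.dvd.mul_right (prod_dvd_prod_of_subset _ _ _ (range_subset_range.2 hx)) _
  · obtain ⟨r, hr⟩ : ∃ r, P - F = x + r := ⟨P - F - x, by omega⟩
    rw [hr]
    rw [newtonDown, prod_range_add, ← newtonDown]
    refine mul_dvd_mul_left _ ?_
    rw [← prod_range_reflect]
    have e : ∏ j ∈ range r, (Polynomial.C (ell q T (P - ((x + (r - 1 - j) : ℕ) : ℤ))) -
        Polynomial.X) = (-1) ^ r * newton q T (F + 1) r := by
      rw [newton, ← card_range r, ← prod_const, card_range, ← prod_mul_distrib]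
      refine prod_congr rfl fun j hj => ?_
      have := mem_range.1 hj
      rw [show (P : ℤ) - ((x + (r - 1 - j) : ℕ) : ℤ) = F + 1 + j by omega]
      ring
    rw [e]
    have hdvd : newton q T (F + 1) r ∣ newton q T (F + 1) s :=
      prod_dvd_prod_of_subset _ _ _ (range_subset_range.2 (by omega))
    exact (IsUnit.mul_left_dvd (IsUnit.pow r isUnit_one.neg)).2 hdvd

lemma newtonDown_add (T c : ℤ) (x r : ℕ) :
    newtonDown q T c (x + r) = newtonDown q T c x * newtonDown q T (c - x) r := by
  rw [newtonDown, prod_range_add, ← newtonDown, newtonDown, newtonDown]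
  congr 1
  refine prod_congr rfl fun i _ => ?_
  rw [show c - ((x + i : ℕ) : ℤ) = c - x - i by push_cast; ring]

/-- In the mirror form `m` enters only through `[T - P - m + x]! / [P - m - x]!`, which is the value
of a Newton polynomial times a factor independent of `x`. -/
lemma tOne_eq_eval (hq : 0 < q) (T : ℤ) (P : ℕ) (G C U H m : ℤ) (hmP : m ≤ P) (hmQ : m ≤ T - P) :
    tOne q T P G C U H m = fa q (T - P - m) * rf q (P - m) *
      (∑ x ∈ range (P + 1), Polynomial.C (cOne q T P G C U H x) * newtonDown q T P x).eval
        (ell q T m) := by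
  rw [tOne, Polynomial.eval_finsetSum, mul_sum]
  refine sum_congr rfl fun x _ => ?_
  rw [Polynomial.eval_mul, Polynomial.eval_C, newtonDown_eval hq,
    po_eq_fa_mul_rf hq (P - m + 1 - x) x (by omega), po_eq_fa_mul_rf hq (T + 1 - P - m) x (by omega),
    show (P : ℤ) - m + 1 - x + x - 1 = P - m by ring, show (P : ℤ) - m + 1 - x - 1 = P - m - x by ring,
    show T + 1 - P - m + x - 1 = T - P - m + x by ring, show T + 1 - P - m - 1 = T - P - m by ring]
  have h1 := fa_mul_rf hq (n := T - P - m) (by omega)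
  have h2 := fa_mul_rf hq (n := P - m) (by omega)
  linear_combination (-cOne q T P G C U H x * (fa q (T - P - m + x) * rf q (P - m - x))) *
    (fa q (P - m) * rf q (P - m) * h1 + h2)

lemma tTwo_eq_eval (hq : 0 < q) (B : ℕ) (F C U n m : ℤ) (hm : 0 ≤ m) (hmT : m ≤ B + F + 1) :
    tTwo q B F C U n m = rf q m * rf q (B + F + 1 - m) *
      (∑ y ∈ range (B + 1), Polynomial.C (cTwo q B F C U n y) * newton q (B + F) 0 y).eval
        (ell q (B + F) m) := by
  rw [tTwo, Polynomial.eval_finsetSum, mul_sum]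
  refine sum_congr rfl fun y _ => ?_
  rw [Polynomial.eval_mul, Polynomial.eval_C, newton_eval hq,
    po_eq_fa_mul_rf hq (B + F + 2 - y - m - 0) y (by omega),
    po_eq_fa_mul_rf hq (m + 1 - y - 0) y (by omega),
    show (B : ℤ) + F + 2 - y - m - 0 + y - 1 = B + F + 1 - m by ring,
    show (B : ℤ) + F + 2 - y - m - 0 - 1 = B + F + 1 - m - y by ring,
    show m + 1 - (y : ℤ) - 0 + y - 1 = m by ring, show m + 1 - (y : ℤ) - 0 - 1 = m - y by ring]
  have h1 := fa_mul_rf hq (n := B + F + 1 - m) (by omega)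
  have h2 := fa_mul_rf hq hm
  linear_combination (-cTwo q B F C U n y * (rf q (m - y) * rf q (B + F + 1 - m - y))) *
    (fa q m * rf q m * h1 + h2)

/-- In the product of the polynomials of the first two single sums one can split off the factors
that belong to spins below the range of the summation spin. -/
lemma exists_factorization (hq : 0 < q) (P B F : ℕ) (G C U n H : ℤ) (hC : 0 ≤ C) (hnB : n ≤ B)
    (hUn : 0 ≤ U - n) (hFUn : 0 ≤ F - U + n) :
    newtonDown q (B + F) P (P - F) ∣
      (∑ x ∈ range (P + 1), Polynomial.C (cOne q (B + F) P G C U H x) * newtonDown q (B + F) P x) *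
        ∑ y ∈ range (B + 1), Polynomial.C (cTwo q B F C U n y) * newton q (B + F) 0 y := by
  by_cases hPF : F ≤ P
  swap
  · rw [show P - F = 0 by omega]
    simp [newtonDown]
  obtain ⟨d, hd, hexp⟩ := exists_newton_expansion hq (C := C) (U := U) (n := n) hC hnB hUn hFUn
  rw [hexp, sum_mul_sum]
  refine dvd_sum fun x _ => dvd_sum fun s _ => ?_
  -- Nonzero terms have `x ≥ P - U` and `s ≥ U - F`, hence `x + s ≥ P - F`, as `newtonDown_dvd`
  -- requires.
  by_cases hx : U - P + x < 0
  · rw [cOne_eq_zero hx]; simp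
  by_cases hs : (s : ℤ) < U - F
  · rw [hd s hs]; simp
  rw [mul_mul_mul_comm]
  exact Dvd.dvd.mul_left (newtonDown_dvd _ P F x s hPF (by omega)) _

/-! ### The double sum as a quadrature sum over the coupled spin -/

/-- The left side is `Λ(Q₁ Q₂)`, evaluated by quadrature. The filter on the right is the set of
triangle conditions for `(a, g, j)` and `(c, k, j)` not already implied by `m ≤ min P (min B F)`;
`hBF` and `hFB` give the boundary behaviour of `Φ` in the two orders of `B` and `F`. -/
theorem coupling_sum (hq : 0 < q) (P B F : ℕ) (G C U n H : ℤ)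
    (hH : 0 ≤ H) (hGH : 0 ≤ G - H) (hkH : 0 ≤ 2 * U - (B + F) + C - H)
    (hnB : n ≤ B) (hPU : 0 ≤ P - U + H)
    (hGP : 0 ≤ G + P - (B + F) + U - H) (hCU : 0 ≤ C + U - P - H)
    (hUn : 0 ≤ U - n) (hFUn : 0 ≤ F - U + n) (Φ : ℕ → ℕ → ℝ)
    (hrec : ∀ x y : ℕ, Φ (x + 1) y + Φ x (y + 1) =
      qi q (P - x - y) * qi q (B + F - P + 1 + x - y) * Φ x y)
    (hzero : ∀ x y, P < x + y → Φ x y = 0)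
    (hBF : B ≤ F → ∀ y, B < y → Φ 0 y = 0)
    (hFB : F < B → ∀ m : ℕ, m ≤ F → m ≤ P → (B + F - P : ℤ) < m → Φ (P - m) m = 0) :
    ∑ x ∈ range (P + 1), ∑ y ∈ range (B + 1),
        cOne q (B + F) P G C U H x * cTwo q B F C U n y * Φ x y =
      ∑ m ∈ range (min P (min B F) + 1) with
          (((m : ℕ) : ℤ) ≤ B + F - P ∧ 0 ≤ G + P - (B + F) + ((m : ℕ) : ℤ) ∧
            0 ≤ U + C - (B + F) + ((m : ℕ) : ℤ) ∧ ((m : ℕ) : ℤ) ≤ B + F - U ∧ ((m : ℕ) : ℤ) ≤ U),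
        qi q (B + F + 1 - 2 * m) * Φ (P - m) m * tOne q (B + F) P G C U H m *
          tTwo q B F C U n m := by
  obtain ⟨Λ, hΛ⟩ := exists_functional_of_rec hq (B + F) P Φ hrec
  set Q₁ := ∑ x ∈ range (P + 1), Polynomial.C (cOne q (B + F) P G C U H x) *
    newtonDown q (B + F) P x with hQ₁
  set Q₂ := ∑ y ∈ range (B + 1), Polynomial.C (cTwo q B F C U n y) * newton q (B + F) 0 y with hQ₂
  have hΛQ : Λ (Q₁ * Q₂) = ∑ x ∈ range (P + 1), ∑ y ∈ range (B + 1),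
      cOne q (B + F) P G C U H x * cTwo q B F C U n y * Φ x y := by
    rw [hQ₁, hQ₂, sum_mul_sum, map_sum]
    refine sum_congr rfl fun x _ => ?_
    rw [map_sum]
    refine sum_congr rfl fun y _ => ?_
    rw [mul_mul_mul_comm, ← Polynomial.C_mul, ← Polynomial.smul_eq_C_mul, map_smul, hΛ, smul_eq_mul]
  have hC : 0 ≤ C := by omega
  obtain ⟨X₀, R, hX₀, hX₀', hR⟩ : ∃ (X₀ : ℕ) (R : Polynomial ℝ), (F < B → X₀ = P - F) ∧
      (B ≤ F → X₀ = 0) ∧ Q₁ * Q₂ = newtonDown q (B + F) P X₀ * R := by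
    by_cases h : F < B
    · obtain ⟨R, hR⟩ := exists_factorization hq P B F G C U n H hC hnB hUn hFUn
      exact ⟨P - F, R, fun _ => rfl, fun h' => by omega, hR⟩
    · exact ⟨0, Q₁ * Q₂, fun h' => absurd h' h, fun _ => rfl, by simp [newtonDown]⟩
  set K := min P (min B F) with hK
  obtain ⟨w, hw⟩ := exists_quadrature (fun i => ell q (B + F) (0 + i)) K
    (by
      intro m hm i hi h
      by_contra hne
      simp only [coe_range, Set.mem_Iio] at hm hi
      -- Coinciding nodes would require `m = i` or `m + i = B + F + 1`; the latter is excluded by `K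
      -- ≤ min B F`.
      have h1 := ell_sub hq (B + F) (0 + m) (0 + i)
      simp only at h
      rw [h, sub_self] at h1
      exact mul_ne_zero (qi_ne_zero hq (by omega)) (qi_ne_zero hq (by omega)) h1.symm)
    (Λ ∘ₗ LinearMap.mulLeft ℝ (newtonDown q (B + F) P X₀))
    (by
      intro y hy
      change Λ (newtonDown q (B + F) P X₀ * newton q (B + F) 0 y) = 0
      rw [hΛ]
      -- For `F < B` the cutoff at `F` comes from the split factor of degree `P - F`, which pushes
      -- the total degree above `P`. For `B ≤ F` no factor is needed, since `Φ 0 y` itself vanishes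
      -- beyond `B`.
      by_cases h : F < B
      · exact hzero _ _ (by rw [hX₀ h]; omega)
      · rw [hX₀' (by omega)]
        by_cases hyB : B < y
        · exact hBF (by omega) y hyB
        · exact hzero _ _ (by omega))
  simp only [zero_add, LinearMap.comp_apply, LinearMap.mulLeft_apply] at hw
  rw [← hΛQ, hR, hw, sum_filter]
  refine sum_congr rfl fun m hm => ?_
  have hmK : m ≤ K := by have := mem_range.1 hm; omega
  have hX₀m : X₀ + m ≤ P := by
    by_cases h : F < B
    · rw [hX₀ h]; omega
    · rw [hX₀' (by omega)]; omega
  have hKX₀ : K + X₀ ≤ P := by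
    by_cases h : F < B
    · rw [hX₀ h]; omega
    · rw [hX₀' (by omega)]; omega
  set Y := newtonDown q (B + F) (P - X₀) (P - m - X₀) with hY
  have hsplit : newtonDown q (B + F) P (P - m) = newtonDown q (B + F) P X₀ * Y := by
    rw [hY, ← newtonDown_add, show X₀ + (P - m - X₀) = P - m by omega]
  -- Among the nodes up to `K`, the Newton factor vanishes below `m` and `Y` vanishes above `m`, so
  -- a single weight survives.
  have hΦ : Φ (P - m) m = w m * (Y.eval (ell q (B + F) m) *
      (newton q (B + F) 0 m).eval (ell q (B + F) m)) := by
    rw [← hΛ, hsplit, mul_assoc, hw, sum_eq_single m]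
    · rw [Polynomial.eval_mul]
    · intro i hi him
      have hi' := mem_range.1 hi
      rw [Polynomial.eval_mul]
      rcases lt_or_gt_of_ne him with h | h
      · rw [newton_eval hq, po_eq_zero (x := (i : ℤ) + 1 - m - 0) (by omega) (by omega)]; ring
      · rw [hY, newtonDown_eval hq,
          po_eq_zero (x := (P : ℤ) - X₀ - i + 1 - ((P - m - X₀ : ℕ) : ℤ)) (by omega) (by omega)]
        ring
    · intro h; exact absurd hm h
  have hRe : Q₁.eval (ell q (B + F) m) * Q₂.eval (ell q (B + F) m) =
      (newtonDown q (B + F) P X₀).eval (ell q (B + F) m) * R.eval (ell q (B + F) m) := by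
    rw [← Polynomial.eval_mul, hR, Polynomial.eval_mul]
  by_cases hmQ : (m : ℤ) ≤ B + F - P
  · have main : w m * R.eval (ell q (B + F) m) = qi q (B + F + 1 - 2 * m) * Φ (P - m) m *
        tOne q (B + F) P G C U H m * tTwo q B F C U n m := by
      rw [tOne_eq_eval hq (B + F) P G C U H m (by omega) hmQ,
        tTwo_eq_eval hq B F C U n m (by omega) (by omega), ← hQ₁, ← hQ₂, hΦ]
      have e1 : (newtonDown q (B + F) P X₀).eval (ell q (B + F) m) * Y.eval (ell q (B + F) m) =
          fa q (P - m) * (fa q (B + F - 2 * m) * rf q (B + F - P - m)) := by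
        rw [← Polynomial.eval_mul, ← hsplit, newtonDown_eval hq,
          po_eq_fa_mul_rf hq _ _ (by omega), po_eq_fa_mul_rf hq _ _ (by omega)]
        rw [show (P : ℤ) - m + 1 - ((P - m : ℕ) : ℤ) + ((P - m : ℕ) : ℤ) - 1 = P - m by ring,
          show (P : ℤ) - m + 1 - ((P - m : ℕ) : ℤ) - 1 = 0 by omega,
          show (B : ℤ) + F + 1 - P - m + ((P - m : ℕ) : ℤ) - 1 = B + F - 2 * m by omega,
          show (B : ℤ) + F + 1 - P - m - 1 = B + F - P - m by ring, rf_zero, mul_one]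
      have e2 : (newton q (B + F) 0 m).eval (ell q (B + F) m) =
          fa q (B + F + 1 - m) * rf q (B + F + 1 - 2 * m) * fa q m := by
        rw [newton_eval hq, po_eq_fa_mul_rf hq _ _ (by omega), po_eq_fa_mul_rf hq _ _ (by omega)]
        rw [show (B : ℤ) + F + 2 - m - m - 0 + m - 1 = B + F + 1 - m by ring,
          show (B : ℤ) + F + 2 - m - m - 0 - 1 = B + F + 1 - 2 * m by ring,
          show (m : ℤ) + 1 - m - 0 + m - 1 = m by ring, show (m : ℤ) + 1 - m - 0 - 1 = 0 by ring,
          rf_zero, mul_one]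
      -- The factor `[2j + 1]` originates here: it turns `[B + F - 2m]! / [B + F + 1 - 2m]!`, left
      -- over from the two Newton values, into `1`.
      have e3 : qi q (B + F + 1 - 2 * m) * rf q (B + F + 1 - 2 * m) * fa q (B + F - 2 * m) = 1 := by
        rw [← rf_pred hq, show (B : ℤ) + F + 1 - 2 * m - 1 = B + F - 2 * m by ring, mul_comm,
          fa_mul_rf hq (by omega)]
      have g1 := fa_mul_rf hq (n := B + F - P - m) (by omega)
      have g2 := fa_mul_rf hq (n := P - m) (by omega)
      have g3 := fa_mul_rf hq (n := (m : ℤ)) (by omega)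
      have g4 := fa_mul_rf hq (n := B + F + 1 - m) (by omega)
      rw [e2]
      calc w m * R.eval (ell q (B + F) m) = w m * R.eval (ell q (B + F) m) *
            (qi q (B + F + 1 - 2 * m) * rf q (B + F + 1 - 2 * m) * fa q (B + F - 2 * m)) *
            (fa q (B + F - P - m) * rf q (B + F - P - m)) * (fa q (P - m) * rf q (P - m)) *
            (fa q m * rf q m) * (fa q (B + F + 1 - m) * rf q (B + F + 1 - m)) := by
            rw [e3, g1, g2, g3, g4]; ring
        _ = w m * R.eval (ell q (B + F) m) * qi q (B + F + 1 - 2 * m) *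
            (fa q (P - m) * (fa q (B + F - 2 * m) * rf q (B + F - P - m))) *
            (fa q (B + F + 1 - m) * rf q (B + F + 1 - 2 * m) * fa q m) *
            (fa q (B + F - P - m) * rf q (P - m)) * (rf q m * rf q (B + F + 1 - m)) := by ring
        _ = w m * qi q (B + F + 1 - 2 * m) * Y.eval (ell q (B + F) m) *
            ((newtonDown q (B + F) P X₀).eval (ell q (B + F) m) * R.eval (ell q (B + F) m)) *
            (fa q (B + F + 1 - m) * rf q (B + F + 1 - 2 * m) * fa q m) *
            (fa q (B + F - P - m) * rf q (P - m)) * (rf q m * rf q (B + F + 1 - m)) := by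
            rw [← e1]; ring
        _ = _ := by rw [← hRe]; ring
    rw [main]
    split_ifs with hgood
    · rfl
    by_cases k1 : 0 ≤ G + P - (B + F) + (m : ℤ)
    swap
    · rw [tOne_eq_zero_of_upper hq (by omega) hmQ hH hPU hGP hCU (by omega)]; ring
    by_cases k2 : 0 ≤ U + C - (B + F) + (m : ℤ)
    swap
    · rw [tOne_eq_zero_of_upper' hq (by omega) hmQ hH hPU hkH (by omega) (by omega)]; ring
    by_cases k3 : (m : ℤ) ≤ U
    swap
    · rw [tOne_eq_zero_of_lt (by omega)]; ring
    by_cases k4 : (m : ℤ) ≤ B + F - U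
    · exact absurd ⟨hmQ, k1, k2, k4, k3⟩ hgood
    · rw [tTwo_eq_zero_of_lower hq (by omega) k3 hC (by omega) hFUn (by omega)]; ring
  -- Here `j < a - g`, where the evaluation formula for `tOne` is unavailable. For `F < B` the
  -- weight vanishes by `hFB`; otherwise `Q₁` vanishes at the node when `j ≥ c - k`, and `Q₂` when
  -- `j < c - k`.
  · rw [if_neg fun h => hmQ h.1]
    by_cases h : F < B
    · have hY0 : Y.eval (ell q (B + F) m) ≠ 0 := by
        rw [hY, newtonDown_eval hq]
        refine mul_ne_zero (po_ne_zero_of_pos hq _ ?_) (po_ne_zero_of_pos hq _ ?_)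
        · omega
        · have := hX₀ h; omega
      have hN0 : (newton q (B + F) 0 m).eval (ell q (B + F) m) ≠ 0 := by
        rw [newton_eval hq]
        exact mul_ne_zero (po_ne_zero_of_pos hq _ (by omega)) (po_ne_zero_of_pos hq _ (by omega))
      rw [hFB h m (by omega) (by omega) (by omega)] at hΦ
      have : w m = 0 := by
        rcases mul_eq_zero.1 hΦ.symm with h0 | h0
        · exact h0
        · exact absurd h0 (mul_ne_zero hY0 hN0)
      rw [this, zero_mul]
    · have hBF' : B ≤ F := by omega
      have h1 : (newtonDown q (B + F) P X₀).eval (ell q (B + F) m) = 1 := by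
        rw [hX₀' hBF']; simp [newtonDown]
      rw [h1, one_mul] at hRe
      rw [← hRe]
      by_cases k : (m : ℤ) ≤ B + F - U
      · have : Q₁.eval (ell q (B + F) m) = 0 := by
          rw [hQ₁, Polynomial.eval_finsetSum]
          refine sum_eq_zero fun x _ => ?_
          by_cases hx : U - P + x < 0
          · rw [cOne_eq_zero hx]; simp
          · rw [Polynomial.eval_mul, newtonDown_eval hq,
              po_eq_zero (x := (B : ℤ) + F + 1 - P - m) (by omega) (by omega)]
            ring
        rw [this]; ring
      · have h2 := tTwo_eq_zero_of_lower hq (B := B) (F := F) (C := C) (U := U) (n := n) (m := m)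
          (by omega) (by omega) hC (by omega) hFUn (by omega)
        rw [tTwo_eq_eval hq B F C U n m (by omega) (by omega), ← hQ₂] at h2
        rcases mul_eq_zero.1 h2 with h3 | h3
        · exact absurd h3 (mul_ne_zero (rf_ne_zero hq (by omega)) (rf_ne_zero hq (by omega)))
        · rw [h3]; ring

/-! ### The two inner sums: recurrence, cutoffs and antidiagonal -/

/-- The inner sum of the first triple-sum formula. -/
def phiOne (q : ℝ) (P B F E : ℕ) (G : ℤ) (x y : ℕ) : ℝ :=
  ∑ z ∈ range (E + 1), (-1) ^ z * (fa q (B - E + z) * fa q (G + P - F - E + z)) *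
    (rf q z * rf q (E - z) * rf q (F - P + E - z) * rf q (G + 2 * P - F - 2 * E + 1 + z)) *
    q ^ (-(x : ℤ) * (B - E - y + z) + y * (F - P + E - z + 1) + z * P) *
    (fa q (F - P + E + x - z) * rf q (P - x - y) * rf q (B - E - y + z))

/-- The inner sum of the second triple-sum formula. -/
def phiTwo (q : ℝ) (P B F E : ℕ) (G : ℤ) (x y : ℕ) : ℝ :=
  (-1) ^ y * ∑ z ∈ range ((G + 2 * P - (B + F) - E).toNat + 1), (-1) ^ z *
    fa q (G + 2 * P - F - 2 * E - z) *
    (rf q z * rf q (G + 2 * P - (B + F) - E - z) * rf q (P - E - z) *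
      rf q (G + 2 * P - F - E + 1 - z) * rf q (G + P - E + 1 - z)) *
    q ^ ((x : ℤ) * (G + 2 * P - (B + F) - E + y - z + 1) + y * (G + P - E - z + 2) + z * P) *
    (fa q (G + P - E + 1 + x - z) * fa q (G + 2 * P - (B + F) - E + y - z) * rf q (P - x - y))

/-- Holds term by term in `z`: the shifts in `x` and in `y` produce the two summands of `qi_add` for
`B + F - P + 1 + x - y = (B - E - y + z) + (F - P + E + x - z + 1)`. The power of `q` in the summand
is the one that makes this work. -/
lemma phiOne_rec (hq : 0 < q) (P B F E : ℕ) (G : ℤ) (x y : ℕ) :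
    phiOne q P B F E G (x + 1) y + phiOne q P B F E G x (y + 1) =
      qi q (P - x - y) * qi q (B + F - P + 1 + x - y) * phiOne q P B F E G x y := by
  rw [phiOne, phiOne, phiOne, ← sum_add_distrib, mul_sum]
  refine sum_congr rfl fun z _ => ?_
  by_cases hz : (F : ℤ) - P + E - z < 0
  · rw [rf_of_neg hz]; ring
  have h1 : fa q ((F : ℤ) - P + E + ((x + 1 : ℕ) : ℤ) - z) =
      qi q (F - P + E + x - z + 1) * fa q (F - P + E + x - z) := by
    rw [← fa_succ (by omega)]; congr 1; push_cast; ring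
  have h2 : rf q ((P : ℤ) - ((x + 1 : ℕ) : ℤ) - y) = qi q (P - x - y) * rf q (P - x - y) := by
    rw [← rf_pred hq]; congr 1; push_cast; ring
  have h3 : rf q ((P : ℤ) - x - ((y + 1 : ℕ) : ℤ)) = qi q (P - x - y) * rf q (P - x - y) := by
    rw [← rf_pred hq]; congr 1; push_cast; ring
  have h4 : rf q ((B : ℤ) - E - ((y + 1 : ℕ) : ℤ) + z) =
      qi q (B - E - y + z) * rf q (B - E - y + z) := by
    rw [← rf_pred hq]; congr 1; push_cast; ring
  have h5 : q ^ (-((x + 1 : ℕ) : ℤ) * (B - E - y + z) + y * (F - P + E - z + 1) + z * P) =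
      q ^ (-(x : ℤ) * (B - E - y + z) + y * (F - P + E - z + 1) + z * P) *
        (q ^ ((B : ℤ) - E - y + z))⁻¹ := by
    rw [← zpow_neg, ← zpow_add₀ hq.ne']; congr 1; push_cast; ring
  have h6 : q ^ (-(x : ℤ) * (B - E - ((y + 1 : ℕ) : ℤ) + z) +
        ((y + 1 : ℕ) : ℤ) * (F - P + E - z + 1) + z * P) =
      q ^ (-(x : ℤ) * (B - E - y + z) + y * (F - P + E - z + 1) + z * P) *
        q ^ ((F : ℤ) - P + E + x - z + 1) := by
    rw [← zpow_add₀ hq.ne']; congr 1; push_cast; ring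
  have h7 := qi_add hq ((B : ℤ) - E - y + z) (F - P + E + x - z + 1)
  rw [show (B : ℤ) - E - y + z + (F - P + E + x - z + 1) = B + F - P + 1 + x - y by ring] at h7
  rw [h1, h2, h3, h4, h5, h6, h7]
  ring

lemma phiOne_eq_zero {P B F E : ℕ} {G : ℤ} {x y : ℕ} (h : P < x + y) :
    phiOne q P B F E G x y = 0 := by
  refine sum_eq_zero fun z _ => ?_
  rw [rf_of_neg (n := (P : ℤ) - x - y) (by omega)]; ring

lemma phiOne_eq_zero_of_lt {P B F E : ℕ} {G : ℤ} {x y : ℕ} (h : B < y) :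
    phiOne q P B F E G x y = 0 := by
  refine sum_eq_zero fun z hz => ?_
  have := mem_range.1 hz
  rw [rf_of_neg (n := (B : ℤ) - E - y + z) (by omega)]; ring

/-- The two reciprocal factorials would need `z ≤ F - P + E` and `z ≥ E + m - B`, which is
impossible for `m > B + F - P`. -/
lemma phiOne_eq_zero_of_lower {P B F E : ℕ} {G : ℤ} {x m : ℕ} (h : (B + F - P : ℤ) < m) :
    phiOne q P B F E G x m = 0 := by
  refine sum_eq_zero fun z _ => ?_
  by_cases hz : (F : ℤ) - P + E - z < 0
  · rw [rf_of_neg hz]; ring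
  · rw [rf_of_neg (n := (B : ℤ) - E - m + z) (by omega)]; ring

/-- For `x + y = P` the terms of the exponent containing `z` cancel, which leaves an ordinary `6j`
sum. -/
lemma phiOne_diag (hq : 0 < q) (P B F E : ℕ) (G : ℤ) (m : ℕ) (hm : m ≤ P) :
    phiOne q P B F E G (P - m) m = q ^ ((P : ℤ) * (F - P + E + 1)) *
      (q ^ (((P : ℤ) - m) * (B + F - P - m + 1)))⁻¹ *
      ∑ z ∈ range (E + 1), (-1) ^ z *
        (fa q (B - E + z) * fa q (G + P - F - E + z) * fa q (F + E - m - z)) *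
        (rf q z * rf q (F - P + E - z) * rf q (E - z) * rf q (B - E - m + z) *
          rf q (G + 2 * P - F - 2 * E + 1 + z)) := by
  rw [phiOne, mul_sum]
  refine sum_congr rfl fun z _ => ?_
  rw [← zpow_neg, ← zpow_add₀ hq.ne',
    show ((P - m : ℕ) : ℤ) = P - m by omega,
    show -((P : ℤ) - m) * (B - E - m + z) + m * (F - P + E - z + 1) + z * P =
      P * (F - P + E + 1) + -((P - m) * (B + F - P - m + 1)) by ring,
    show (F : ℤ) - P + E + (P - m) - z = F + E - m - z by ring,
    show (P : ℤ) - (P - m) - m = 0 by ring, rf_zero]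
  ring

/-- Again term by term; now the factor is a difference of two arguments, and the sign `(-1)^y`
supplies the minus in `qi_neg`. -/
lemma phiTwo_rec (hq : 0 < q) (P B F E : ℕ) (G : ℤ) (hG : 0 ≤ G) (x y : ℕ) :
    phiTwo q P B F E G (x + 1) y + phiTwo q P B F E G x (y + 1) =
      qi q (P - x - y) * qi q (B + F - P + 1 + x - y) * phiTwo q P B F E G x y := by
  rw [phiTwo, phiTwo, phiTwo, mul_sum, mul_sum, mul_sum, ← sum_add_distrib, mul_sum]
  refine sum_congr rfl fun z _ => ?_
  by_cases hz : G + 2 * P - (B + F) - E - z < 0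
  · rw [rf_of_neg hz]; ring
  by_cases hz' : (P : ℤ) - E - z < 0
  · rw [rf_of_neg hz']; ring
  have h1 : fa q (G + P - E + 1 + ((x + 1 : ℕ) : ℤ) - z) =
      qi q (G + P - E + 1 + x - z + 1) * fa q (G + P - E + 1 + x - z) := by
    rw [← fa_succ (by omega)]; congr 1; push_cast; ring
  have h2 : rf q ((P : ℤ) - ((x + 1 : ℕ) : ℤ) - y) = qi q (P - x - y) * rf q (P - x - y) := by
    rw [← rf_pred hq]; congr 1; push_cast; ring
  have h3 : rf q ((P : ℤ) - x - ((y + 1 : ℕ) : ℤ)) = qi q (P - x - y) * rf q (P - x - y) := by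
    rw [← rf_pred hq]; congr 1; push_cast; ring
  have h4 : fa q (G + 2 * P - (B + F) - E + ((y + 1 : ℕ) : ℤ) - z) =
      qi q (G + 2 * P - (B + F) - E + y - z + 1) * fa q (G + 2 * P - (B + F) - E + y - z) := by
    rw [← fa_succ (by omega)]; congr 1; push_cast; ring
  have h5 : q ^ (((x + 1 : ℕ) : ℤ) * (G + 2 * P - (B + F) - E + y - z + 1) +
        y * (G + P - E - z + 2) + z * P) =
      q ^ ((x : ℤ) * (G + 2 * P - (B + F) - E + y - z + 1) + y * (G + P - E - z + 2) + z * P) *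
        q ^ (G + 2 * P - (B + F) - E + y - z + 1) := by
    rw [← zpow_add₀ hq.ne']; congr 1; push_cast; ring
  have h6 : q ^ ((x : ℤ) * (G + 2 * P - (B + F) - E + ((y + 1 : ℕ) : ℤ) - z + 1) +
        ((y + 1 : ℕ) : ℤ) * (G + P - E - z + 2) + z * P) =
      q ^ ((x : ℤ) * (G + 2 * P - (B + F) - E + y - z + 1) + y * (G + P - E - z + 2) + z * P) *
        q ^ (G + P - E + 1 + x - z + 1) := by
    rw [← zpow_add₀ hq.ne']; congr 1; push_cast; ring
  have h7 := qi_add hq (-(G + 2 * P - (B + F) - E + y - z + 1)) (G + P - E + 1 + x - z + 1)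
  rw [show -(G + 2 * P - (B + F) - E + y - z + 1) + (G + P - E + 1 + x - z + 1) =
    (B : ℤ) + F - P + 1 + x - y by ring, qi_neg, zpow_neg, inv_inv] at h7
  rw [h1, h2, h3, h4, h5, h6, h7, pow_succ]
  ring

lemma phiTwo_eq_zero {P B F E : ℕ} {G : ℤ} {x y : ℕ} (h : P < x + y) :
    phiTwo q P B F E G x y = 0 := by
  rw [phiTwo, sum_eq_zero, mul_zero]
  intro z _
  rw [rf_of_neg (n := (P : ℤ) - x - y) (by omega)]; ring

/-- Unlike for `phiOne`, the terms do not vanish individually. At `x = 0` two factorials cancel and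
the power of `q` contributes degree `P - y`, so the total degree is one less than the order `G + 2P
- (B + F) - E`. -/
lemma phiTwo_eq_zero_of_lt (hq : 0 < q) {P B F E : ℕ} {G : ℤ} {y : ℕ} (h : B < y)
    (hG : 0 ≤ G) (hEB : E ≤ B) (h1 : 0 ≤ G + P - F - E) :
    phiTwo q P B F E G 0 y = 0 := by
  by_cases hyP : P < y
  · exact phiTwo_eq_zero (by omega)
  rw [phiTwo]
  refine mul_eq_zero_of_right _ ?_
  obtain ⟨d1, hd1⟩ : ∃ d : ℕ, y = B + 1 + d := ⟨y - B - 1, by omega⟩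
  obtain ⟨d2, hd2⟩ := Int.eq_ofNat_of_zero_le h1
  obtain ⟨d3, hd3⟩ : ∃ d : ℕ, P = y + d := ⟨P - y, by omega⟩
  have hf := ((((QPoly.const (q := q) (q ^ ((y : ℤ) * (G + P - E + 2)) * rf q (P - y))).mul_po_sub
    (G + 2 * P - F - E + 2) d1).mul_po_sub (P - E + 1) d2).mul_pow_pow d3)
  refine hf.sum_eq_zero hq (M := G + 2 * P - (B + F) - E) (by omega) (by omega) (fun z hz => ?_)
    (fun z hz => ?_)
  · have e2 := fa_mul_rf_eq_po hq (x := G + 2 * P - F - 2 * E - z) (y := P - E - z) d2 (by omega)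
      (by omega)
    have e1 := fa_mul_rf_eq_po hq (x := G + 2 * P - (B + F) - E + y - z)
      (y := G + 2 * P - F - E + 1 - z) d1 (by omega) (by omega)
    rw [show (P : ℤ) - E - z + 1 = P - E + 1 - z by ring] at e2
    rw [show G + 2 * P - F - E + 1 - (z : ℤ) + 1 = G + 2 * P - F - E + 2 - z by ring] at e1
    rw [← e1, ← e2]
    by_cases hz' : (P : ℤ) - E - z < 0
    · rw [rf_of_neg hz']; ring
    have e3 := fa_mul_rf hq (n := G + P - E + 1 - z) (by omega)
    have e4 : q ^ (((0 : ℕ) : ℤ) * (G + 2 * P - (B + F) - E + y - z + 1) + y * (G + P - E - z + 2) +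
        z * P) = q ^ ((y : ℤ) * (G + P - E + 2)) * q ^ (d3 * z) := by
      rw [← zpow_natCast q (d3 * z), ← zpow_add₀ hq.ne']
      congr 1
      rw [hd3]; push_cast; ring
    rw [e4, show G + P - E + 1 + ((0 : ℕ) : ℤ) - z = G + P - E + 1 - z by push_cast; ring,
      show (P : ℤ) - ((0 : ℕ) : ℤ) - y = P - y by push_cast; ring]
    generalize fa q (G + P - E + 1 - z) = u at *
    generalize rf q (G + P - E + 1 - z) = v at *
    linear_combination ((-1) ^ z * fa q (G + 2 * P - F - 2 * E - z) *
      (rf q z * rf q (G + 2 * P - (B + F) - E - z) * rf q (P - E - z) *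
      rf q (G + 2 * P - F - E + 1 - z)) * (q ^ ((y : ℤ) * (G + P - E + 2)) * q ^ (d3 * z)) *
      (fa q (G + 2 * P - (B + F) - E + y - z) * rf q (P - y))) * e3
  · rw [rf_of_neg (n := G + 2 * P - (B + F) - E - z) (by omega)]; ring

lemma phiTwo_diag (hq : 0 < q) (P B F E : ℕ) (G : ℤ) (m : ℕ) (hm : m ≤ P) :
    phiTwo q P B F E G (P - m) m = (-1) ^ m * q ^ ((P : ℤ) * (G + P - E + 2)) *
      (q ^ (((P : ℤ) - m) * (B + F - P - m + 1)))⁻¹ *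
      ∑ z ∈ range ((G + 2 * P - (B + F) - E).toNat + 1), (-1) ^ z *
        (fa q (G + 2 * P - F - 2 * E - z) * fa q (G + 2 * P - (B + F) - E + m - z) *
          fa q (G + 2 * P - E + 1 - m - z)) *
        (rf q z * rf q (P - E - z) * rf q (G + 2 * P - (B + F) - E - z) *
          rf q (G + P - E + 1 - z) * rf q (G + 2 * P - F - E + 1 - z)) := by
  rw [phiTwo, mul_sum, mul_sum]
  refine sum_congr rfl fun z _ => ?_
  rw [← zpow_neg, mul_assoc ((-1 : ℝ) ^ m) (q ^ _), ← zpow_add₀ hq.ne',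
    show ((P - m : ℕ) : ℤ) = P - m by omega,
    show ((P : ℤ) - m) * (G + 2 * P - (B + F) - E + m - z + 1) + m * (G + P - E - z + 2) + z * P =
      P * (G + P - E + 2) + -((P - m) * (B + F - P - m + 1)) by ring,
    show G + P - E + 1 + ((P : ℤ) - m) - z = G + 2 * P - E + 1 - m - z by ring,
    show (P : ℤ) - (P - m) - m = 0 by ring, rf_zero]
  ring

/-- On the antidiagonal the three ratios have total degree `P - E - 1`, against alternating weights
of order `P - E`. -/
lemma phiTwo_eq_zero_of_lower (hq : 0 < q) {P B F E : ℕ} {G : ℤ} {m : ℕ} (hmP : m ≤ P)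
    (hmF : m ≤ F) (h : (B + F - P : ℤ) < m) (hG : 0 ≤ G) (hEB : E ≤ B)
    (h1 : 0 ≤ G + P - F - E) :
    phiTwo q P B F E G (P - m) m = 0 := by
  rw [phiTwo_diag hq P B F E G m hmP]
  refine mul_eq_zero_of_right _ ?_
  rw [← sum_range_of_eq_zero (L := (G + 2 * P - (B + F) - E).toNat + 1 + (P + 1)) _ _ (by omega)]
  swap
  · intro z hz
    rw [rf_of_neg (n := G + 2 * P - (B + F) - E - z) (by omega)]; ring
  obtain ⟨d1, hd1⟩ := Int.eq_ofNat_of_zero_le (show 0 ≤ (P : ℤ) - (B + F) + m - 1 by omega)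
  obtain ⟨d2, hd2⟩ : ∃ d : ℕ, B = E + d := ⟨B - E, by omega⟩
  obtain ⟨d3, hd3⟩ : ∃ d : ℕ, F = m + d := ⟨F - m, by omega⟩
  have hf := (((QPoly.const (q := q) 1).mul_po_sub (G + P - E + 2) d1).mul_po_sub
    (G + 2 * P - (B + F) - E + 1) d2).mul_po_sub (G + 2 * P - F - E + 2) d3
  refine hf.sum_eq_zero hq (M := P - E) (by omega) (by omega) (fun z hz => ?_) (fun z hz => ?_)
  · have e1 := fa_mul_rf_eq_po hq (x := G + 2 * P - (B + F) - E + m - z) (y := G + P - E + 1 - z) d1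
      (by omega) (by omega)
    have e2 := fa_mul_rf_eq_po hq (x := G + 2 * P - F - 2 * E - z)
      (y := G + 2 * P - (B + F) - E - z) d2 (by omega) (by omega)
    have e3 := fa_mul_rf_eq_po hq (x := G + 2 * P - E + 1 - m - z)
      (y := G + 2 * P - F - E + 1 - z) d3 (by omega) (by omega)
    rw [show G + P - E + 1 - (z : ℤ) + 1 = G + P - E + 2 - z by ring] at e1
    rw [show G + 2 * P - (B + F) - E - (z : ℤ) + 1 = G + 2 * P - (B + F) - E + 1 - z by ring] at e2
    rw [show G + 2 * P - F - E + 1 - (z : ℤ) + 1 = G + 2 * P - F - E + 2 - z by ring] at e3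
    rw [← e1, ← e2, ← e3]
    ring
  · rw [rf_of_neg (n := (P : ℤ) - E - z) (by omega)]; ring

/-! ### From spins to integer parameters -/

lemma qFact_eq_fa {x : ℝ} {n : ℤ} (h : x = n) : qFact q x = fa q n := by rw [h, fa]

lemma sgn_eq_zpow {x : ℝ} {n : ℤ} (h : x = n) : sgn x = (-1) ^ n := by
  rw [h, sgn, Int.floor_intCast]

lemma natFloor_eq_toNat {x : ℝ} {n : ℤ} (h : x = n) : ⌊x⌋₊ = n.toNat := by
  rw [h, ← Int.floor_toNat, Int.floor_intCast]

lemma neg_one_zpow_congr {m n : ℤ} (h : Even (m - n)) : (-1 : ℝ) ^ m = (-1) ^ n := by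
  rw [show m = (m - n) + n by ring, zpow_add₀ (by norm_num), h.neg_one_zpow, one_mul]

/-- A `q`-`6j` coefficient as an unrestricted sum with integer parameters. -/
lemma sixJ_eq {a b e d c f : ℝ} {s n₁ n₂ n₃ d₁ d₂ d₃ d₄ : ℤ} (L : ℕ)
    (hs : a + b + c + d = s) (hn₁ : c + f - a = n₁) (hn₂ : b + f - d = n₂)
    (hn₃ : a + d + e - f = n₃) (hd₁ : a + c - f = d₁) (hd₂ : b + d - f = d₂)
    (hd₃ : e + f - a - d = d₃) (hd₄ : 2 * f + 1 = d₄) (h₄ : 0 ≤ d₄) (hL : d₁ < L) (hL0 : 0 < L) :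
    sixJ q a b e d c f = nabla q a c f * nabla q d b f / (nabla q a b e * nabla q d c e) *
      ((-1) ^ s * ∑ z ∈ range L, (-1) ^ z * (fa q (n₁ + z) * fa q (n₂ + z) * fa q (n₃ - z)) *
        (rf q z * rf q (d₁ - z) * rf q (d₂ - z) * rf q (d₃ + z) * rf q (d₄ + z))) := by
  rw [sixJ, natFloor_eq_toNat hd₁]
  congr 1
  rw [sum_range_of_eq_zero (K := d₁.toNat + 1) _ _ (by omega), mul_sum, sum_filter]
  swap
  · intro z hz
    rw [rf_of_neg (n := d₁ - z) (by omega)]; ring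
  refine sum_congr rfl fun z _ => ?_
  have e1 : a + c - f - z = ((d₁ - z : ℤ) : ℝ) := by push_cast; linarith
  have e2 : b + d - f - z = ((d₂ - z : ℤ) : ℝ) := by push_cast; linarith
  have e3 : e + f - a - d + z = ((d₃ + z : ℤ) : ℝ) := by push_cast; linarith
  rw [e1, e2, e3]
  simp only [Int.cast_nonneg_iff]
  split_ifs with hc
  · obtain ⟨c1, c2, c3⟩ := hc
    rw [sgn_eq_zpow (n := s + z) (by push_cast; linarith),
      qFact_eq_fa (x := c + f - a + z) (n := n₁ + z) (by push_cast; linarith),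
      qFact_eq_fa (x := b + f - d + z) (n := n₂ + z) (by push_cast; linarith),
      qFact_eq_fa (x := a + d + e - f - z) (n := n₃ - z) (by push_cast; linarith),
      qFact_eq_fa (x := z) (n := z) (by push_cast; rfl),
      qFact_eq_fa (x := 2 * f + z + 1) (n := d₄ + z) (by push_cast; linarith),
      qFact_eq_fa rfl, qFact_eq_fa rfl, qFact_eq_fa rfl,
      rf_of_nonneg c1, rf_of_nonneg c2, rf_of_nonneg c3, rf_of_nonneg (n := (z : ℤ)) (by omega),
      rf_of_nonneg (n := d₄ + z) (by omega), zpow_add₀ (by norm_num), zpow_natCast, div_eq_mul_inv,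
      mul_inv, mul_inv, mul_inv, mul_inv]
    ring
  · by_cases c1 : 0 ≤ d₁ - z
    · by_cases c2 : 0 ≤ d₂ - z
      · rw [rf_of_neg (n := d₃ + z) (by by_contra h; exact hc ⟨c1, c2, by omega⟩)]; ring
      · rw [rf_of_neg (n := d₂ - z) (by omega)]; ring
    · rw [rf_of_neg (n := d₁ - z) (by omega)]; ring

/-- The mirror transformation followed by the reversal `z = P - m - x`, after which only two
factorials in each term depend on `m`. -/
lemma sum_eq_tOne (hq : 0 < q) {T : ℤ} {P : ℕ} {G C U H : ℤ} {m : ℕ} (L : ℕ)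
    (hH : 0 ≤ H) (hGH : 0 ≤ G - H) (hkH : 0 ≤ 2 * U - T + C - H) (hPU : 0 ≤ P - U + H)
    (hGP : 0 ≤ G + P - T + U - H) (hCU : 0 ≤ C + U - P - H)
    (hmP : m ≤ P) (hmQ : m ≤ T - P) (hmU : m ≤ U) (hmTU : m ≤ T - U)
    (hL : G + P - T + m < L) (hLH : H < L) (hLU : U < L) (hLP : P < L) :
    ∑ z ∈ range L, (-1) ^ z *
        (fa q (T - P - m + z) * fa q (T - U - m + z) * fa q (2 * U + C + G + P - 2 * T + m - H - z)) *
        (rf q z * rf q (G + P - T + m - z) * rf q (U + C - T + m - z) * rf q (T - P - m - H + z) *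
          rf q (T - 2 * m + 1 + z)) =
      (-1) ^ (U - H + P) * tOne q T P G C U H m := by
  have key := sum_eq_mirror_sum hq L H (P - U + H) (U + C - T + m) (G + P - T + m) (U - m - H)
    (T - P - m - H) hH hPU (by omega) (by omega) (by omega) (by omega) (by omega) (by omega)
    (by omega) (by omega) hL hLH (by omega) (by omega)
  have e1 : ∑ z ∈ range L, (-1) ^ z *
        (fa q (T - P - m + z) * fa q (T - U - m + z) * fa q (2 * U + C + G + P - 2 * T + m - H - z)) *
        (rf q z * rf q (G + P - T + m - z) * rf q (U + C - T + m - z) * rf q (T - P - m - H + z) *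
          rf q (T - 2 * m + 1 + z)) =
      (-1) ^ (U - m - H) * ∑ z ∈ range L, (-1) ^ z *
        (fa q (T - 2 * m - z) * fa q (P + H - m - z) *
          fa q (P + 2 * U + C + G - T - m - H + 1 - z)) *
        (rf q z * rf q (U - m - z) * rf q (P - m - z) *
          rf q (U + C - m + 1 - z) * rf q (G + P - m + 1 - z)) := by
    refine Eq.trans (sum_congr rfl fun z _ => ?_) (key.trans (congrArg _ (sum_congr rfl fun z _ => ?_)))
    · rw [show H + (T - P - m - H) + (z : ℤ) = T - P - m + z by ring,
        show P - U + H + (T - P - m - H) + (z : ℤ) = T - U - m + z by ring,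
        show U + C - T + m + (G + P - T + m) + (U - m - H) - (z : ℤ) =
          2 * U + C + G + P - 2 * T + m - H - z by ring,
        show H + (P - U + H) + (U - m - H) + (T - P - m - H) + 1 + (z : ℤ) = T - 2 * m + 1 + z by ring]
      ring
    · rw [show H + (P - U + H) + (U - m - H) + (T - P - m - H) - (z : ℤ) = T - 2 * m - z by ring,
        show H + (P - U + H) + (U - m - H) - (z : ℤ) = P + H - m - z by ring,
        show H + (P - U + H) + (U + C - T + m) + (G + P - T + m) + 2 * (U - m - H) +
          (T - P - m - H) + 1 - (z : ℤ) = P + 2 * U + C + G - T - m - H + 1 - z by ring,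
        show H + (U - m - H) - (z : ℤ) = U - m - z by ring,
        show P - U + H + (U - m - H) - (z : ℤ) = P - m - z by ring,
        show H + (P - U + H) + (U + C - T + m) + (U - m - H) + (T - P - m - H) + 1 - (z : ℤ) =
          U + C - m + 1 - z by ring,
        show H + (P - U + H) + (G + P - T + m) + (U - m - H) + (T - P - m - H) + 1 - (z : ℤ) =
          G + P - m + 1 - z by ring]
  rw [e1, sum_range_of_eq_zero (K := P - m + 1) _ _ (by omega), ← sum_range_reflect, tOne,
    sum_range_of_eq_zero (K := P - m + 1) (L := P + 1) _ _ (by omega), mul_sum, mul_sum]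
  · refine sum_congr rfl fun x hx => ?_
    have hx' := mem_range.1 hx
    have e : ((P - m + 1 - 1 - x : ℕ) : ℤ) = P - m - x := by omega
    rw [e, cOne, show T - 2 * m - (P - m - x) = T - P - m + (x : ℤ) by ring,
      show P + H - m - (P - m - x) = H + (x : ℤ) by ring,
      show P + 2 * U + C + G - T - m - H + 1 - (P - m - x) = G + 2 * U - T + C - H + 1 + (x : ℤ) by ring,
      show U - m - (P - m - x) = U - P + (x : ℤ) by ring,
      show (P : ℤ) - m - (P - m - x) = x by ring,
      show U + C - m + 1 - (P - m - x) = U - P + C + 1 + (x : ℤ) by ring,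
      show G + P - m + 1 - (P - m - x) = G + 1 + (x : ℤ) by ring]
    have hs : (-1 : ℝ) ^ (U - m - H) * (-1) ^ (P - m + 1 - 1 - x) = (-1) ^ (U - H + P) * (-1) ^ x := by
      rw [← zpow_natCast, ← zpow_natCast, e, ← zpow_add₀ (by norm_num), ← zpow_add₀ (by norm_num)]
      exact neg_one_zpow_congr ⟨-m - x, by ring⟩
    linear_combination (fa q (T - P - m + x) * fa q (H + x) * fa q (G + 2 * U - T + C - H + 1 + x) *
      (rf q (P - m - x) * rf q (U - P + x) * rf q x * rf q (U - P + C + 1 + x) *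
        rf q (G + 1 + x))) * hs
  · intro x hx
    rw [rf_of_neg (n := (P : ℤ) - m - x) (by omega)]; ring
  · intro x hx
    rw [rf_of_neg (n := (P : ℤ) - m - x) (by omega)]; ring

lemma sum_eq_tTwo (hq : 0 < q) {B F : ℕ} {C U n : ℤ} {m : ℕ} (L : ℕ)
    (hn : 0 ≤ n) (hnB : n ≤ B)
    (hFUn : 0 ≤ F - U + n) (hUn : 0 ≤ U - n) (hCn : 0 ≤ U + C - F - n)
    (hmB : m ≤ B) (hmU : m ≤ U) (hmTU : m ≤ B + F - U)
    (hmC : 0 ≤ U + C - (B + F) + m)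
    (hL : 2 * U - (B + F) + C - n < L) (hLU : U < L) (hLB : B < L) :
    ∑ z ∈ range L, (-1) ^ z *
        (fa q (B - n + z) * fa q (B - m + z) * fa q (U + C - B - z)) *
        (rf q z * rf q (2 * U - (B + F) + C - n - z) * rf q (F - m - z) * rf q (B - U + z) *
          rf q (B + 1 + z)) =
      (-1) ^ (m + n - U) * tTwo q B F C U n m := by
  have key := sum_eq_mirror_sum hq L (U - n) (U - m) (F - m) (2 * U - (B + F) + C - n) (m + n - U)
    (B - U) hUn (by omega) (by omega) (by omega) (by omega) (by omega) (by omega) (by omega)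
    (by omega) (by omega) hL (by omega) (by omega) (by omega)
  rw [tTwo, ← sum_range_of_eq_zero (K := B + 1) (L := L) _ _ (by omega)]
  · refine Eq.trans (sum_congr rfl fun z _ => ?_) (key.trans (congrArg _ (sum_congr rfl fun z _ => ?_)))
    · rw [show U - n + (B - U) + (z : ℤ) = B - n + z by ring,
        show U - m + (B - U) + (z : ℤ) = B - m + z by ring,
        show (F : ℤ) - m + (2 * U - (B + F) + C - n) + (m + n - U) - z = U + C - B - z by ring,
        show U - n + (U - m) + (m + n - U) + (B - U) + 1 + (z : ℤ) = B + 1 + z by ring]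
      ring
    · rw [cTwo, show U - n + (U - m) + (m + n - U) + (B - U) - (z : ℤ) = B - z by ring,
        show U - n + (U - m) + (m + n - U) - (z : ℤ) = U - z by ring,
        show U - n + (U - m) + (F - m) + (2 * U - (B + F) + C - n) + 2 * (m + n - U) + (B - U) + 1 -
          (z : ℤ) = U + C + 1 - z by ring,
        show U - n + (m + n - U) - (z : ℤ) = m - z by ring,
        show U - m + (m + n - U) - (z : ℤ) = n - z by ring,
        show U - n + (U - m) + (F - m) + (m + n - U) + (B - U) + 1 - (z : ℤ) =
          B + F + 1 - m - z by ring,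
        show U - n + (U - m) + (2 * U - (B + F) + C - n) + (m + n - U) + (B - U) + 1 - (z : ℤ) =
          2 * U - F + C - n + 1 - z by ring]
      ring
  · intro y hy
    rw [rf_of_neg (n := (m : ℤ) - y) (by omega)]; ring

/-- On the antidiagonal the two inner sums are mirror forms of the same `6j` sum. This accounts for
the change of sign and power of `q` between the two formulas. -/
lemma phiTwo_diag_eq (hq : 0 < q) {P B F E : ℕ} {G : ℤ} {m : ℕ}
    (hEB : E ≤ B) (hEP : E ≤ P) (ha : 0 ≤ G + 2 * P - (B + F) - E) (hF : 0 ≤ (F : ℤ) - P + E)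
    (hG : 0 ≤ G + P - F - E) (hmP : m ≤ P) (hmB : m ≤ B) (hmF : m ≤ F) (hmQ : (m : ℤ) ≤ B + F - P)
    (hmG : 0 ≤ G + P - (B + F) + m) :
    phiTwo q P B F E G (P - m) m = (-1) ^ (P - E) * q ^ ((P : ℤ) * (G + 2 * P - F - 2 * E + 1)) *
      phiOne q P B F E G (P - m) m := by
  set L := E + P + B + F + G.toNat + (G + 2 * P - (B + F) - E).toNat + 1 with hL
  have key := sum_eq_mirror_sum hq L m (G + P - (B + F) + m) (F - P + E) E (P - E - m)
    (B - E - m) (by omega) (by omega) (by omega) (by omega) (by omega) (by omega) (by omega)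
    (by omega) (by omega) (by omega) (by omega) (by omega) (by omega) (by omega)
  rw [phiOne_diag hq _ _ _ _ _ _ hmP, phiTwo_diag hq _ _ _ _ _ _ hmP]
  rw [← sum_range_of_eq_zero (L := L) (K := E + 1) _ _ (by omega),
    ← sum_range_of_eq_zero (L := L) (K := _ + 1) _ _ (by omega)]
  · have e1 : ∑ z ∈ range L, (-1) ^ z *
          (fa q (B - E + z) * fa q (G + P - F - E + z) * fa q (F + E - m - z)) *
          (rf q z * rf q (F - P + E - z) * rf q (E - z) * rf q (B - E - m + z) *
            rf q (G + 2 * P - F - 2 * E + 1 + z)) =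
        (-1) ^ ((P : ℤ) - E - m) * ∑ z ∈ range L, (-1) ^ z *
        (fa q (G + 2 * P - F - 2 * E - z) * fa q (G + 2 * P - (B + F) - E + m - z) *
          fa q (G + 2 * P - E + 1 - m - z)) *
        (rf q z * rf q (P - E - z) * rf q (G + 2 * P - (B + F) - E - z) *
          rf q (G + P - E + 1 - z) * rf q (G + 2 * P - F - E + 1 - z)) := by
      refine Eq.trans (sum_congr rfl fun z _ => ?_) (key.trans (congrArg _ (sum_congr rfl fun z _ => ?_)))
      · rw [show (m : ℤ) + (B - E - m) + z = B - E + z by ring,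
          show G + P - (B + F) + m + (B - E - m) + (z : ℤ) = G + P - F - E + z by ring,
          show (F : ℤ) - P + E + E + (P - E - m) - z = F + E - m - z by ring,
          show m + (G + P - (B + F) + m) + (P - E - m) + (B - E - m) + 1 + (z : ℤ) =
            G + 2 * P - F - 2 * E + 1 + z by ring]
      · rw [show m + (G + P - (B + F) + m) + (P - E - m) + (B - E - m) - (z : ℤ) =
            G + 2 * P - F - 2 * E - z by ring,
          show m + (G + P - (B + F) + m) + (P - E - m) - (z : ℤ) =
            G + 2 * P - (B + F) - E + m - z by ring,
          show m + (G + P - (B + F) + m) + (F - P + E) + E + 2 * (P - E - m) + (B - E - m) + 1 -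
            (z : ℤ) = G + 2 * P - E + 1 - m - z by ring,
          show (m : ℤ) + (P - E - m) - z = P - E - z by ring,
          show G + P - (B + F) + m + (P - E - m) - (z : ℤ) = G + 2 * P - (B + F) - E - z by ring,
          show m + (G + P - (B + F) + m) + (F - P + E) + (P - E - m) + (B - E - m) + 1 - (z : ℤ) =
            G + P - E + 1 - z by ring,
          show m + (G + P - (B + F) + m) + E + (P - E - m) + (B - E - m) + 1 - (z : ℤ) =
            G + 2 * P - F - E + 1 - z by ring]
    rw [e1, show (P : ℤ) * (G + P - E + 2) = P * (G + 2 * P - F - 2 * E + 1) + P * (F - P + E + 1) by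
      ring, zpow_add₀ hq.ne']
    have hs : (-1 : ℝ) ^ (P - E) * (-1) ^ ((P : ℤ) - E - m) = (-1) ^ m := by
      rw [← zpow_natCast, ← zpow_natCast, ← zpow_add₀ (by norm_num)]
      exact neg_one_zpow_congr ⟨P - E - m, by rw [Nat.cast_sub hEP]; ring⟩
    rw [← hs]
    ring
  · intro z hz
    rw [rf_of_neg (n := G + 2 * P - (B + F) - E - z) (by omega)]; ring
  · intro z hz
    rw [rf_of_neg (n := (E : ℤ) - z) (by omega)]; ring

lemma qFact_pos (hq : 0 < q) (x : ℝ) : 0 < qFact q x := by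
  refine prod_pos fun i _ => ?_
  have := qi_pos hq (n := (i : ℤ) + 1) (by omega)
  simpa [qi] using this

lemma nabla_ne_zero (hq : 0 < q) (x y z : ℝ) : nabla q x y z ≠ 0 := by
  have h := qFact_pos hq
  exact (Real.sqrt_pos.2 (div_pos (mul_pos (mul_pos (h _) (h _)) (h _)) (h _))).ne'

lemma nabla_swap (x y z : ℝ) : nabla q x y z = nabla q x z y := by
  rw [nabla, nabla, show x + y - z = x - z + y by ring, show x - y + z = x + z - y by ring,
    show x + y + z + 1 = x + z + y + 1 by ring, show y + z - x = z + y - x by ring,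
    mul_comm (qFact q (x - z + y))]

lemma triad_iff {x y z : ℝ} {X Y Z : ℤ} (hX : 2 * x = X) (hY : 2 * y = Y) (hZ : 2 * z = Z) :
    Triad x y z ↔ X - Y ≤ Z ∧ Y - X ≤ Z ∧ Z ≤ X + Y ∧ 2 ∣ X + Y + Z := by
  rw [Triad, abs_le]
  have h1 : X - Y ≤ Z ↔ x - y ≤ z := by
    rw [← Int.cast_le (R := ℝ)]; push_cast; constructor <;> intro h <;> linarith
  have h2 : Y - X ≤ Z ↔ -z ≤ x - y := by
    rw [← Int.cast_le (R := ℝ)]; push_cast; constructor <;> intro h <;> linarith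
  have h3 : Z ≤ X + Y ↔ z ≤ x + y := by
    rw [← Int.cast_le (R := ℝ)]; push_cast; constructor <;> intro h <;> linarith
  have h4 : 2 ∣ X + Y + Z ↔ ∃ n : ℤ, x + y + z = n := by
    constructor
    · rintro ⟨n, hn⟩
      have : ((X + Y + Z : ℤ) : ℝ) = ((2 * n : ℤ) : ℝ) := by rw [hn]
      push_cast at this
      exact ⟨n, by linarith⟩
    · rintro ⟨n, hn⟩
      refine ⟨n, ?_⟩
      have : ((X + Y + Z : ℤ) : ℝ) = ((2 * n : ℤ) : ℝ) := by push_cast; linarith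
      exact_mod_cast this
  rw [h1, h2, h3, h4]
  tauto

/-- Integer parameters of an array of nine spins whose rows and columns are triads. -/
structure IntParams (a b e c d f h k g : ℝ) (P B F E : ℕ) (G C U n H : ℤ) : Prop where
  eqB : 2 * b = B
  eqF : 2 * f = F
  eqG : 2 * g = G
  eqC : 2 * c = C
  eqP : a + b + f - g = P
  eqE : a + b - e = E
  eqU : b + f + k - c = U
  eqn : b + k - d = n
  eqH : g + k - h = H
  abe₁ : E ≤ B
  abe₂ : 0 ≤ G + 2 * P - (B + F) - E
  efg₁ : 0 ≤ (F : ℤ) - P + E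
  efg₂ : 0 ≤ G + P - F - E
  efg₃ : E ≤ P
  hkg₁ : 0 ≤ H
  hkg₂ : 0 ≤ G - H
  hkg₃ : 0 ≤ 2 * U - (B + F) + C - H
  bdk₁ : 0 ≤ n
  bdk₂ : n ≤ B
  bdk₃ : 0 ≤ 2 * U - (B + F) + C - n
  ach₁ : 0 ≤ P - U + H
  ach₂ : 0 ≤ G + P - (B + F) + U - H
  ach₃ : 0 ≤ C + U - P - H
  cdf₁ : 0 ≤ F - U + n
  cdf₂ : 0 ≤ U - n
  cdf₃ : 0 ≤ U + C - F - n

lemma exists_intParams {a b e c d f h k g : ℝ}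
    (ha : IsSpin a) (hb : IsSpin b) (he : IsSpin e)
    (hc : IsSpin c) (hd : IsSpin d) (hf : IsSpin f)
    (hh : IsSpin h) (hk : IsSpin k) (hg : IsSpin g)
    (habe : Triad a b e) (hcdf : Triad c d f) (hhkg : Triad h k g)
    (hach : Triad a c h) (hbdk : Triad b d k) (hefg : Triad e f g) :
    ∃ (P B F E : ℕ) (G C U n H : ℤ), IntParams a b e c d f h k g P B F E G C U n H := by
  obtain ⟨a', ha⟩ := ha
  obtain ⟨b', hb⟩ := hb
  obtain ⟨e', he⟩ := he
  obtain ⟨c', hc⟩ := hc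
  obtain ⟨d', hd⟩ := hd
  obtain ⟨f', hf⟩ := hf
  obtain ⟨h', hh⟩ := hh
  obtain ⟨k', hk⟩ := hk
  obtain ⟨g', hg⟩ := hg
  have ha2 : 2 * a = (a' : ℤ) := by push_cast; linarith
  have hb2 : 2 * b = (b' : ℤ) := by push_cast; linarith
  have he2 : 2 * e = (e' : ℤ) := by push_cast; linarith
  have hc2 : 2 * c = (c' : ℤ) := by push_cast; linarith
  have hd2 : 2 * d = (d' : ℤ) := by push_cast; linarith
  have hf2 : 2 * f = (f' : ℤ) := by push_cast; linarith
  have hh2 : 2 * h = (h' : ℤ) := by push_cast; linarith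
  have hk2 : 2 * k = (k' : ℤ) := by push_cast; linarith
  have hg2 : 2 * g = (g' : ℤ) := by push_cast; linarith
  rw [triad_iff ha2 hb2 he2] at habe
  rw [triad_iff hc2 hd2 hf2] at hcdf
  rw [triad_iff hh2 hk2 hg2] at hhkg
  rw [triad_iff ha2 hc2 hh2] at hach
  rw [triad_iff hb2 hd2 hk2] at hbdk
  rw [triad_iff he2 hf2 hg2] at hefg
  obtain ⟨P, hP⟩ : ∃ P : ℕ, (2 * P : ℤ) = a' + b' + f' - g' :=
    ⟨(((a' : ℤ) + b' + f' - g') / 2).toNat, by omega⟩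
  obtain ⟨E, hE⟩ : ∃ E : ℕ, (2 * E : ℤ) = a' + b' - e' :=
    ⟨(((a' : ℤ) + b' - e') / 2).toNat, by omega⟩
  obtain ⟨U, hU⟩ : ∃ U : ℤ, 2 * U = b' + f' + k' - c' :=
    ⟨((b' : ℤ) + f' + k' - c') / 2, by omega⟩
  obtain ⟨n, hn⟩ : ∃ n : ℤ, 2 * n = b' + k' - d' := ⟨((b' : ℤ) + k' - d') / 2, by omega⟩
  obtain ⟨H, hH⟩ : ∃ H : ℤ, 2 * H = g' + k' - h' := ⟨((g' : ℤ) + k' - h') / 2, by omega⟩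
  have hP' : (2 * P : ℝ) = a' + b' + f' - g' := by exact_mod_cast congrArg (Int.cast (R := ℝ)) hP
  have hE' : (2 * E : ℝ) = a' + b' - e' := by exact_mod_cast congrArg (Int.cast (R := ℝ)) hE
  have hU' : (2 * U : ℝ) = b' + f' + k' - c' := by exact_mod_cast congrArg (Int.cast (R := ℝ)) hU
  have hn' : (2 * n : ℝ) = b' + k' - d' := by exact_mod_cast congrArg (Int.cast (R := ℝ)) hn
  have hH' : (2 * H : ℝ) = g' + k' - h' := by exact_mod_cast congrArg (Int.cast (R := ℝ)) hH
  refine ⟨P, b', f', E, g', c', U, n, H, ⟨?_, ?_, hg2, hc2, ?_, ?_, ?_, ?_, ?_, ?_, ?_, ?_, ?_, ?_,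
    ?_, ?_, ?_, ?_, ?_, ?_, ?_, ?_, ?_, ?_, ?_, ?_⟩⟩
  all_goals first | omega | linarith

lemma div_mul_div_mul_div_cancel {r s t : ℝ} (hr : r ≠ 0) (hs : s ≠ 0) (ht : t ≠ 0)
    (x y z u v w : ℝ) : z * u * v / (x * y * w) =
      r * s / (x * w) * (v * t / (s * y)) * (z * u / (r * t)) := by
  have h1 : r * r⁻¹ = 1 := mul_inv_cancel₀ hr
  have h2 : s * s⁻¹ = 1 := mul_inv_cancel₀ hs
  have h3 : t * t⁻¹ = 1 := mul_inv_cancel₀ ht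
  simp only [div_eq_mul_inv, mul_inv]
  linear_combination (-(z * u * v * x⁻¹ * y⁻¹ * w⁻¹)) *
    (h1 * (s * s⁻¹ * (t * t⁻¹)) + h2 * (t * t⁻¹) + h3)

set_option maxHeartbeats 1000000 in
/-- The `q`-`9j` coefficient in terms of the sums `phiOne`, `tOne` and `tTwo`. -/
theorem nineJ_eq (hq : 0 < q) {a b e c d f h k g : ℝ} {P B F E : ℕ} {G C U n H : ℤ}
    (p : IntParams a b e c d f h k g P B F E G C U n H) :
    nineJ q a b e c d f h k g = (-1) ^ (P - U + H) *
      (nabla q a b e * nabla q f e g * nabla q k b d /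
        (nabla q a c h * nabla q f c d * nabla q k g h)) *
      q ^ (zExp d e h - (g - a) * (g - a + 1) - ((P * (F - P + E + 1) : ℤ) : ℝ)) *
      ∑ m ∈ range (min P (min B F) + 1) with
          (((m : ℕ) : ℤ) ≤ B + F - P ∧ 0 ≤ G + P - (B + F) + ((m : ℕ) : ℤ) ∧
            0 ≤ U + C - (B + F) + ((m : ℕ) : ℤ) ∧ ((m : ℕ) : ℤ) ≤ B + F - U ∧ ((m : ℕ) : ℤ) ≤ U),
        qi q (B + F + 1 - 2 * m) * phiOne q P B F E G (P - m) m * tOne q (B + F) P G C U H m *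
          tTwo q B F C U n m := by
  obtain ⟨eqB, eqF, eqG, eqC, eqP, eqE, eqU, eqn, eqH, abe₁, abe₂, efg₁, efg₂, efg₃, hkg₁, hkg₂,
    hkg₃, bdk₁, bdk₂, bdk₃, ach₁, ach₂, ach₃, cdf₁, cdf₂, cdf₃⟩ := p
  have eqA : 2 * a = ((G + 2 * P - (B + F) : ℤ) : ℝ) := by push_cast; linarith
  have eqK : 2 * k = ((2 * U - (B + F) + C : ℤ) : ℝ) := by push_cast; linarith
  have eqB' : 2 * b = ((B : ℤ) : ℝ) := by push_cast; linarith
  have eqF' : 2 * f = ((F : ℤ) : ℝ) := by push_cast; linarith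
  have eqN (i : ℕ) : 2 * ((i : ℝ) / 2) = ((i : ℤ) : ℝ) := by push_cast; ring
  rw [nineJ, natFloor_eq_toNat (n := 2 * G + 2 * P - (B + F)) (by push_cast; linarith), mul_sum]
  simp only [triad_iff eqA eqG (eqN _), triad_iff eqB' eqF' (eqN _), triad_iff eqC eqK (eqN _)]
  symm
  -- The substitution `2j = B + F - 2m`, that is `m = b + f - j`; the parity of `2j` comes from the
  -- triad `(b, f, j)`.
  refine sum_bij' (fun m _ => B + F - 2 * m) (fun i _ => (B + F - i) / 2) ?_ ?_ ?_ ?_ ?_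
  · intro m hm
    simp only [mem_filter, mem_range] at hm ⊢
    omega
  · intro m hm
    simp only [mem_filter, mem_range] at hm ⊢
    omega
  · intro m hm
    simp only [mem_filter, mem_range] at hm
    omega
  · intro m hm
    simp only [mem_filter, mem_range] at hm
    omega
  intro m hm
  simp only [mem_filter, mem_range] at hm
  obtain ⟨hmin, hmQ, hmG, hmC, hmTU, hmU⟩ := hm
  have hmP : m ≤ P := by omega
  have hmB : m ≤ B := by omega
  have hmF : m ≤ F := by omega
  have hN : ((B + F - 2 * m : ℕ) : ℤ) = B + F - 2 * m := by omega
  have hNr : ((B + F - 2 * m : ℕ) : ℝ) = B + F - 2 * m := by exact_mod_cast congrArg (Int.cast (R := ℝ)) hN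
  have eqj : ((B + F - 2 * m : ℕ) : ℝ) / 2 = b + f - m := by rw [hNr]; linarith
  set L := P + B + F + E + G.toNat + C.toNat + U.toNat + H.toNat + 1 +
    (2 * U - (B + F) + C - n).toNat with hL
  have D1 := sixJ_eq (q := q) (a := a) (b := c) (e := h) (d := k) (c := g) (f := b + f - m)
    (s := G + P + U + C - (B + F)) (n₁ := B + F - P - m) (n₂ := B + F - U - m)
    (n₃ := 2 * U + C + G + P - 2 * (B + F) + m - H) (d₁ := G + P - (B + F) + m)
    (d₂ := U + C - (B + F) + m) (d₃ := B + F - P - m - H) (d₄ := B + F - 2 * m + 1) L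
    (by push_cast; linarith) (by push_cast; linarith) (by push_cast; linarith)
    (by push_cast; linarith) (by push_cast; linarith) (by push_cast; linarith)
    (by push_cast; linarith) (by push_cast; linarith) (by omega) (by omega) (by omega)
  rw [sum_eq_tOne hq L hkg₁ hkg₂ hkg₃ ach₁ ach₂ ach₃ hmP hmQ hmU hmTU (by omega) (by omega)
    (by omega) (by omega)] at D1
  have D2 := sixJ_eq (q := q) (a := k) (b := b + f - m) (e := c) (d := f) (c := d) (f := b)
    (s := 2 * U + C - n - m) (n₁ := B - n) (n₂ := B - m)
    (n₃ := U + C - B) (d₁ := 2 * U - (B + F) + C - n)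
    (d₂ := F - m) (d₃ := B - U) (d₄ := B + 1) L
    (by push_cast; linarith) (by push_cast; linarith) (by push_cast; linarith)
    (by push_cast; linarith) (by push_cast; linarith) (by push_cast; linarith)
    (by push_cast; linarith) (by push_cast; linarith) (by omega) (by omega) (by omega)
  rw [sum_eq_tTwo hq L bdk₁ bdk₂ cdf₁ cdf₂ cdf₃ hmB hmU hmTU hmC (by omega) (by omega)
    (by omega)] at D2
  have D3 := sixJ_eq (q := q) (a := a) (b := g) (e := b + f - m) (d := f) (c := b) (f := e)
    (s := G + P) (n₁ := B - E) (n₂ := G + P - F - E)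
    (n₃ := F + E - m) (d₁ := E) (d₂ := F - P + E) (d₃ := B - E - m)
    (d₄ := G + 2 * P - F - 2 * E + 1) (E + 1)
    (by push_cast; linarith) (by push_cast; linarith) (by push_cast; linarith)
    (by push_cast; linarith) (by push_cast; linarith) (by push_cast; linarith)
    (by push_cast; linarith) (by push_cast; linarith) (by omega) (by omega) (by omega)
  -- With `P - m = j - (g - a)`, this rests on `(P - m)(B + F - P - m + 1) = j(j + 1) - (g - a)(g -
  -- a + 1)`.
  have hpow : q ^ (zExp d e h - (b + f - m) * (b + f - m + 1)) =
      q ^ (zExp d e h - (g - a) * (g - a + 1) - ((P * (F - P + E + 1) : ℤ) : ℝ)) *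
        (q ^ ((P : ℤ) * (F - P + E + 1)) * (q ^ (((P : ℤ) - m) * (B + F - P - m + 1)))⁻¹) := by
    rw [← zpow_neg, ← zpow_add₀ hq.ne', ← Real.rpow_intCast, ← Real.rpow_add hq]
    congr 1
    push_cast
    rw [← eqP, ← eqB, ← eqF]
    ring
  have hsign : (-1 : ℝ) ^ (B + F - 2 * m) * ((-1) ^ (G + P + U + C - (B + F)) * (-1) ^ (U - H + P)) *
      ((-1) ^ (2 * U + C - n - m) * (-1) ^ (m + n - U)) * (-1) ^ (G + P) = (-1) ^ (P - U + H) := by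
    rw [← zpow_natCast, hN, ← zpow_add₀ (by norm_num), ← zpow_add₀ (by norm_num),
      ← zpow_add₀ (by norm_num), ← zpow_add₀ (by norm_num), ← zpow_add₀ (by norm_num)]
    exact neg_one_zpow_congr ⟨G + P + C + 2 * U - H - m, by ring⟩
  have hqN : qNum q (((B + F - 2 * m : ℕ) : ℝ) + 1) = qi q (B + F + 1 - 2 * m) := by
    rw [qi, hNr]; congr 1; push_cast; ring
  have hS : ∑ z ∈ range (E + 1), (-1) ^ z *
        (fa q (B - E + z) * fa q (G + P - F - E + z) * fa q (F + E - m - z)) *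
        (rf q z * rf q (F - P + E - z) * rf q (E - z) * rf q (B - E - m + z) *
          rf q (G + 2 * P - F - 2 * E + 1 + z)) =
      ∑ z ∈ range (E + 1), (-1) ^ z *
        (fa q (B - E + z) * fa q (G + P - F - E + z) * fa q (F + E - m - z)) *
        (rf q z * rf q (E - z) * rf q (F - P + E - z) * rf q (B - E - m + z) *
          rf q (G + 2 * P - F - 2 * E + 1 + z)) := sum_congr rfl fun z _ => by ring
  rw [hqN, eqj, hpow, D1, D2, D3, phiOne_diag hq _ _ _ _ _ _ hmP, hS, ← hsign,
    nabla_swap k d b, nabla_swap f (b + f - m) b, nabla_swap k (b + f - m) c, nabla_swap f d c,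
    nabla_swap f g e]
  have n1 := nabla_ne_zero hq a g (b + f - m)
  have n2 := nabla_ne_zero hq k c (b + f - m)
  have n3 := nabla_ne_zero hq f b (b + f - m)
  generalize nabla q a g (b + f - m) = N₁ at *
  generalize nabla q k c (b + f - m) = N₂ at *
  generalize nabla q f b (b + f - m) = N₃ at *
  rw [div_mul_div_mul_div_cancel n1 n2 n3]
  ring

/-! ### The triple sums in integer parameters -/

lemma rpow_eq_zpow {x : ℝ} {m : ℤ} (h : x = m) : q ^ x = q ^ m := by rw [h, Real.rpow_intCast]

lemma IntParams.tripleSum_one {a b e c d f h k g : ℝ} {P B F E : ℕ} {G C U n H : ℤ}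
    (p : IntParams a b e c d f h k g P B F E G C U n H) :
    ∑ z₁ ∈ range (⌊a + b + f - g⌋₊ + 1), ∑ z₂ ∈ range (⌊b + k - d⌋₊ + 1),
        ∑ z₃ ∈ range (⌊a + b - e⌋₊ + 1) with
          (0 ≤ g + k - a - c + z₁ ∧ 0 ≤ b + k - d - z₂ ∧ 0 ≤ a + b - e - ((z₃ : ℕ) : ℝ) ∧
            0 ≤ f + g - e - ((z₃ : ℕ) : ℝ) ∧ 0 ≤ a + b + f - g - z₁ - z₂ ∧
            0 ≤ b + e - a - z₂ + ((z₃ : ℕ) : ℝ)),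
          (-1) ^ (z₁ + z₂ + z₃) *
          (qFact q (g - h + k + z₁) * qFact q (g + h + k + z₁ + 1) /
            (qFact q z₁ * qFact q (g + k - a - c + z₁) * qFact q (c + g + k - a + z₁ + 1))) *
          (qFact q (2 * b - z₂) * qFact q (b + f + k - c - z₂) * qFact q (b + f + k + c - z₂ + 1) /
            (qFact q (2 * g + z₁ + 1) * qFact q z₂ * qFact q (b + k - d - z₂) *
              qFact q (b + d + k - z₂ + 1))) *
          (qFact q (b + e - a + z₃) * qFact q (e - f + g + z₃) /
            (qFact q z₃ * qFact q (a + b - e - z₃) * qFact q (f + g - e - z₃) *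
              qFact q (2 * e + z₃ + 1))) *
          q ^ (-z₁ * (b + e - a - z₂ + z₃) + z₂ * (f + g - e - z₃ + 1) + z₃ * (a + b + f - g)) *
          (qFact q (f + g - e + z₁ - z₃) /
            (qFact q (a + b + f - g - z₁ - z₂) * qFact q (b + e - a - z₂ + z₃))) =
      ∑ x ∈ range (P + 1), ∑ y ∈ range (B + 1),
        cOne q (B + F) P G C U H x * cTwo q B F C U n y * phiOne q P B F E G x y := by
  obtain ⟨eqB, eqF, eqG, eqC, eqP, eqE, eqU, eqn, eqH, abe₁, abe₂, efg₁, efg₂, efg₃, hkg₁, hkg₂,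
    hkg₃, bdk₁, bdk₂, bdk₃, ach₁, ach₂, ach₃, cdf₁, cdf₂, cdf₃⟩ := p
  rw [natFloor_eq_toNat (n := P) eqP, natFloor_eq_toNat eqn, natFloor_eq_toNat (n := E) eqE,
    Int.toNat_natCast, Int.toNat_natCast]
  refine sum_congr rfl fun x _ => ?_
  -- Extending the range of `y` from `n` to `B` adds only zeros, as `cTwo` vanishes for `y > n`.
  rw [sum_range_of_eq_zero (K := n.toNat + 1) (L := B + 1) _ _ (by omega)]
  swap
  · intro y hy
    rw [cTwo_eq_zero (by omega)]; ring
  refine sum_congr rfl fun y _ => ?_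
  rw [phiOne, mul_sum, sum_filter]
  refine sum_congr rfl fun z _ => ?_
  have e1 : g + k - a - c + x = ((U - P + x : ℤ) : ℝ) := by push_cast; linarith
  have e2 : b + k - d - y = ((n - y : ℤ) : ℝ) := by push_cast; linarith
  have e3 : a + b - e - z = ((E - z : ℤ) : ℝ) := by push_cast; linarith
  have e4 : f + g - e - z = ((F - P + E - z : ℤ) : ℝ) := by push_cast; linarith
  have e5 : a + b + f - g - x - y = ((P - x - y : ℤ) : ℝ) := by push_cast; linarith
  have e6 : b + e - a - y + z = ((B - E - y + z : ℤ) : ℝ) := by push_cast; linarith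
  rw [rpow_eq_zpow (m := -(x : ℤ) * (B - E - y + z) + y * (F - P + E - z + 1) + z * P)
    (by rw [e4, e6, eqP]; push_cast; ring), e1, e2, e3, e4, e5, e6]
  simp only [Int.cast_nonneg_iff]
  split_ifs with hc
  · obtain ⟨c1, c2, c3, c4, c5, c6⟩ := hc
    rw [qFact_eq_fa (x := g - h + k + x) (n := H + x) (by push_cast; linarith),
      qFact_eq_fa (x := g + h + k + x + 1) (n := G + 2 * U - (B + F) + C - H + 1 + x)
        (by push_cast; linarith),
      qFact_eq_fa (x := c + g + k - a + x + 1) (n := U - P + C + 1 + x) (by push_cast; linarith),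
      qFact_eq_fa (x := 2 * b - y) (n := B - y) (by push_cast; linarith),
      qFact_eq_fa (x := b + f + k - c - y) (n := U - y) (by push_cast; linarith),
      qFact_eq_fa (x := b + f + k + c - y + 1) (n := U + C + 1 - y) (by push_cast; linarith),
      qFact_eq_fa (x := 2 * g + x + 1) (n := G + 1 + x) (by push_cast; linarith),
      qFact_eq_fa (x := b + d + k - y + 1) (n := 2 * U - F + C - n + 1 - y)
        (by push_cast; linarith),
      qFact_eq_fa (x := b + e - a + z) (n := B - E + z) (by push_cast; linarith),
      qFact_eq_fa (x := e - f + g + z) (n := G + P - F - E + z) (by push_cast; linarith),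
      qFact_eq_fa (x := 2 * e + z + 1) (n := G + 2 * P - F - 2 * E + 1 + z)
        (by push_cast; linarith),
      qFact_eq_fa (x := f + g - e + x - z) (n := F - P + E + x - z) (by push_cast; linarith),
      qFact_eq_fa (x := x) (n := x) (by push_cast; rfl),
      qFact_eq_fa (x := y) (n := y) (by push_cast; rfl),
      qFact_eq_fa (x := z) (n := z) (by push_cast; rfl)]
    rw [cOne, cTwo, rf_of_nonneg c1, rf_of_nonneg c2, rf_of_nonneg c3, rf_of_nonneg c4,
      rf_of_nonneg c5, rf_of_nonneg c6, rf_of_nonneg (n := (x : ℤ)) (by omega),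
      rf_of_nonneg (n := (y : ℤ)) (by omega), rf_of_nonneg (n := (z : ℤ)) (by omega),
      rf_of_nonneg (n := U - P + C + 1 + x) (by omega), rf_of_nonneg (n := G + 1 + x) (by omega),
      rf_of_nonneg (n := 2 * U - F + C - n + 1 - y) (by omega),
      rf_of_nonneg (n := G + 2 * P - F - 2 * E + 1 + z) (by omega)]
    simp only [fa, div_eq_mul_inv, mul_inv, pow_add]
    ring
  · have h0 : U - P + x < 0 ∨ n - y < 0 ∨ (E : ℤ) - z < 0 ∨ (F : ℤ) - P + E - z < 0 ∨
        (P : ℤ) - x - y < 0 ∨ (B : ℤ) - E - y + z < 0 := by omega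
    rcases h0 with h0 | h0 | h0 | h0 | h0 | h0
    · rw [cOne_eq_zero h0]; ring
    · rw [cTwo_eq_zero (by omega)]; ring
    all_goals rw [rf_of_neg h0]; ring

lemma IntParams.tripleSum_two {a b e c d f h k g : ℝ} {P B F E : ℕ} {G C U n H : ℤ}
    (p : IntParams a b e c d f h k g P B F E G C U n H) :
    ∑ z₁ ∈ range (⌊a + b + f - g⌋₊ + 1), ∑ z₂ ∈ range (⌊b + k - d⌋₊ + 1),
        ∑ z₃ ∈ range (⌊a - b + e⌋₊ + 1) with
          (0 ≤ g + k - a - c + z₁ ∧ 0 ≤ b + k - d - z₂ ∧ 0 ≤ a - b + e - ((z₃ : ℕ) : ℝ) ∧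
            0 ≤ e + f - g - ((z₃ : ℕ) : ℝ) ∧ 0 ≤ a + b + f - g - z₁ - z₂),
          (-1) ^ (z₁ + z₃) *
          (qFact q (g - h + k + z₁) * qFact q (g + h + k + z₁ + 1) /
            (qFact q z₁ * qFact q (g + k - a - c + z₁) * qFact q (c + g + k - a + z₁ + 1))) *
          (qFact q (2 * b - z₂) * qFact q (b + f + k - c - z₂) * qFact q (b + f + k + c - z₂ + 1) /
            (qFact q (2 * g + z₁ + 1) * qFact q z₂ * qFact q (b + k - d - z₂) *
              qFact q (b + d + k - z₂ + 1))) *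
          (qFact q (2 * e - z₃) /
            (qFact q z₃ * qFact q (a - b + e - z₃) * qFact q (e + f - g - z₃) *
              qFact q (a + b + e - z₃ + 1))) *
          q ^ (z₁ * (a - b + e + z₂ - z₃ + 1) + z₂ * (e + f + g - z₃ + 2) +
            z₃ * (a + b + f - g)) *
          (qFact q (e + f + g + z₁ - z₃ + 1) * qFact q (a - b + e + z₂ - z₃) /
            (qFact q (e + f + g - z₃ + 1) * qFact q (a + b + f - g - z₁ - z₂))) =
      ∑ x ∈ range (P + 1), ∑ y ∈ range (B + 1),
        cOne q (B + F) P G C U H x * cTwo q B F C U n y * phiTwo q P B F E G x y := by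
  obtain ⟨eqB, eqF, eqG, eqC, eqP, eqE, eqU, eqn, eqH, abe₁, abe₂, efg₁, efg₂, efg₃, hkg₁, hkg₂,
    hkg₃, bdk₁, bdk₂, bdk₃, ach₁, ach₂, ach₃, cdf₁, cdf₂, cdf₃⟩ := p
  rw [natFloor_eq_toNat (n := P) eqP, natFloor_eq_toNat eqn,
    natFloor_eq_toNat (x := a - b + e) (n := G + 2 * P - (B + F) - E) (by push_cast; linarith),
    Int.toNat_natCast]
  refine sum_congr rfl fun x _ => ?_
  rw [sum_range_of_eq_zero (K := n.toNat + 1) (L := B + 1) _ _ (by omega)]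
  swap
  · intro y hy
    rw [cTwo_eq_zero (by omega)]; ring
  refine sum_congr rfl fun y _ => ?_
  rw [phiTwo, mul_sum, mul_sum, sum_filter]
  refine sum_congr rfl fun z _ => ?_
  have e1 : g + k - a - c + x = ((U - P + x : ℤ) : ℝ) := by push_cast; linarith
  have e2 : b + k - d - y = ((n - y : ℤ) : ℝ) := by push_cast; linarith
  have e3 : a - b + e - z = ((G + 2 * P - (B + F) - E - z : ℤ) : ℝ) := by push_cast; linarith
  have e4 : e + f - g - z = ((P - E - z : ℤ) : ℝ) := by push_cast; linarith
  have e5 : a + b + f - g - x - y = ((P - x - y : ℤ) : ℝ) := by push_cast; linarith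
  have e6 : a - b + e + y - z = ((G + 2 * P - (B + F) - E + y - z : ℤ) : ℝ) := by
    push_cast; linarith
  have e7 : e + f + g - z + 2 = ((G + P - E - z + 2 : ℤ) : ℝ) := by push_cast; linarith
  rw [rpow_eq_zpow (m := (x : ℤ) * (G + 2 * P - (B + F) - E + y - z + 1) + y * (G + P - E - z + 2) +
      z * P) (by rw [e6, e7, eqP]; push_cast; ring), e1, e2, e3, e4, e5, e6]
  simp only [Int.cast_nonneg_iff]
  split_ifs with hc
  · obtain ⟨c1, c2, c3, c4, c5⟩ := hc
    rw [qFact_eq_fa (x := g - h + k + x) (n := H + x) (by push_cast; linarith),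
      qFact_eq_fa (x := g + h + k + x + 1) (n := G + 2 * U - (B + F) + C - H + 1 + x)
        (by push_cast; linarith),
      qFact_eq_fa (x := c + g + k - a + x + 1) (n := U - P + C + 1 + x) (by push_cast; linarith),
      qFact_eq_fa (x := 2 * b - y) (n := B - y) (by push_cast; linarith),
      qFact_eq_fa (x := b + f + k - c - y) (n := U - y) (by push_cast; linarith),
      qFact_eq_fa (x := b + f + k + c - y + 1) (n := U + C + 1 - y) (by push_cast; linarith),
      qFact_eq_fa (x := 2 * g + x + 1) (n := G + 1 + x) (by push_cast; linarith),
      qFact_eq_fa (x := b + d + k - y + 1) (n := 2 * U - F + C - n + 1 - y)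
        (by push_cast; linarith),
      qFact_eq_fa (x := 2 * e - z) (n := G + 2 * P - F - 2 * E - z) (by push_cast; linarith),
      qFact_eq_fa (x := a + b + e - z + 1) (n := G + 2 * P - F - E + 1 - z)
        (by push_cast; linarith),
      qFact_eq_fa (x := e + f + g + x - z + 1) (n := G + P - E + 1 + x - z)
        (by push_cast; linarith),
      qFact_eq_fa (x := e + f + g - z + 1) (n := G + P - E + 1 - z) (by push_cast; linarith),
      qFact_eq_fa (x := x) (n := x) (by push_cast; rfl),
      qFact_eq_fa (x := y) (n := y) (by push_cast; rfl),
      qFact_eq_fa (x := z) (n := z) (by push_cast; rfl)]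
    rw [cOne, cTwo, rf_of_nonneg c1, rf_of_nonneg c2, rf_of_nonneg c3, rf_of_nonneg c4,
      rf_of_nonneg c5, rf_of_nonneg (n := (x : ℤ)) (by omega),
      rf_of_nonneg (n := (y : ℤ)) (by omega), rf_of_nonneg (n := (z : ℤ)) (by omega),
      rf_of_nonneg (n := U - P + C + 1 + x) (by omega), rf_of_nonneg (n := G + 1 + x) (by omega),
      rf_of_nonneg (n := 2 * U - F + C - n + 1 - y) (by omega),
      rf_of_nonneg (n := G + 2 * P - F - E + 1 - z) (by omega),
      rf_of_nonneg (n := G + P - E + 1 - z) (by omega)]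
    -- The signs `(-1)^y` of `cTwo` and `phiTwo` cancel, which is why the second formula carries no
    -- `(-1)^z₂`.
    have hy : (-1 : ℝ) ^ y * (-1) ^ y = 1 := by rw [← mul_pow]; simp
    simp only [fa, div_eq_mul_inv, mul_inv, pow_add]
    generalize (-1 : ℝ) ^ y = s at *
    rw [show ∀ X Y Z W : ℝ, X * (s * Y * Z) * (s * W) = (s * s) * (X * Y * Z * W) from
      fun _ _ _ _ => by ring, hy, one_mul]
    ring
  · have h0 : U - P + x < 0 ∨ n - y < 0 ∨ G + 2 * P - (B + F) - E - z < 0 ∨ (P : ℤ) - E - z < 0 ∨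
        (P : ℤ) - x - y < 0 := by omega
    rcases h0 with h0 | h0 | h0 | h0 | h0
    · rw [cOne_eq_zero h0]; ring
    · rw [cTwo_eq_zero (by omega)]; ring
    all_goals rw [rf_of_neg h0]; ring

end QNineJ

end

/-! ### Assembly of the two formulas -/

theorem mainTheorem2 (q : ℝ) (hq : 0 < q) (a b e c d f h k g : ℝ)
    (ha : IsSpin a) (hb : IsSpin b) (he : IsSpin e)
    (hc : IsSpin c) (hd : IsSpin d) (hf : IsSpin f)
    (hh : IsSpin h) (hk : IsSpin k) (hg : IsSpin g)
    (habe : Triad a b e) (hcdf : Triad c d f) (hhkg : Triad h k g)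
    (hach : Triad a c h) (hbdk : Triad b d k) (hefg : Triad e f g) :
    nineJ q a b e c d f h k g =
      sgn (a + c - h) *
      (nabla q a b e * nabla q f e g * nabla q k b d /
        (nabla q a c h * nabla q f c d * nabla q k g h)) *
      q ^ (zExp d e h - (a + b + f - g) * (f + g - e + 1) - (g - a) * (g - a + 1)) *
      ∑ z₁ ∈ range (⌊a + b + f - g⌋₊ + 1), ∑ z₂ ∈ range (⌊b + k - d⌋₊ + 1),
        ∑ z₃ ∈ range (⌊a + b - e⌋₊ + 1) with
          (0 ≤ g + k - a - c + z₁ ∧ 0 ≤ b + k - d - z₂ ∧ 0 ≤ a + b - e - ((z₃ : ℕ) : ℝ) ∧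
            0 ≤ f + g - e - ((z₃ : ℕ) : ℝ) ∧ 0 ≤ a + b + f - g - z₁ - z₂ ∧ 0 ≤ b + e - a - z₂ + ((z₃ : ℕ) : ℝ)),
          (-1) ^ (z₁ + z₂ + z₃) *
          (qFact q (g - h + k + z₁) * qFact q (g + h + k + z₁ + 1) /
            (qFact q z₁ * qFact q (g + k - a - c + z₁) * qFact q (c + g + k - a + z₁ + 1))) *
          (qFact q (2 * b - z₂) * qFact q (b + f + k - c - z₂) * qFact q (b + f + k + c - z₂ + 1) /
            (qFact q (2 * g + z₁ + 1) * qFact q z₂ * qFact q (b + k - d - z₂) *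
              qFact q (b + d + k - z₂ + 1))) *
          (qFact q (b + e - a + z₃) * qFact q (e - f + g + z₃) /
            (qFact q z₃ * qFact q (a + b - e - z₃) * qFact q (f + g - e - z₃) *
              qFact q (2 * e + z₃ + 1))) *
          q ^ (-z₁ * (b + e - a - z₂ + z₃) + z₂ * (f + g - e - z₃ + 1) + z₃ * (a + b + f - g)) *
          (qFact q (f + g - e + z₁ - z₃) /
            (qFact q (a + b + f - g - z₁ - z₂) * qFact q (b + e - a - z₂ + z₃)))
    ∧
    nineJ q a b e c d f h k g =
      sgn (a + c - h - e - f + g) *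
      (nabla q a b e * nabla q f e g * nabla q k b d /
        (nabla q a c h * nabla q f c d * nabla q k g h)) *
      q ^ (zExp d e h - (a + b + f - g) * (e + f + g + 2) - (g - a) * (g - a + 1)) *
      ∑ z₁ ∈ range (⌊a + b + f - g⌋₊ + 1), ∑ z₂ ∈ range (⌊b + k - d⌋₊ + 1),
        ∑ z₃ ∈ range (⌊a - b + e⌋₊ + 1) with
          (0 ≤ g + k - a - c + z₁ ∧ 0 ≤ b + k - d - z₂ ∧ 0 ≤ a - b + e - ((z₃ : ℕ) : ℝ) ∧
            0 ≤ e + f - g - ((z₃ : ℕ) : ℝ) ∧ 0 ≤ a + b + f - g - z₁ - z₂),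
          (-1) ^ (z₁ + z₃) *
          (qFact q (g - h + k + z₁) * qFact q (g + h + k + z₁ + 1) /
            (qFact q z₁ * qFact q (g + k - a - c + z₁) * qFact q (c + g + k - a + z₁ + 1))) *
          (qFact q (2 * b - z₂) * qFact q (b + f + k - c - z₂) * qFact q (b + f + k + c - z₂ + 1) /
            (qFact q (2 * g + z₁ + 1) * qFact q z₂ * qFact q (b + k - d - z₂) *
              qFact q (b + d + k - z₂ + 1))) *
          (qFact q (2 * e - z₃) /
            (qFact q z₃ * qFact q (a - b + e - z₃) * qFact q (e + f - g - z₃) *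
              qFact q (a + b + e - z₃ + 1))) *
          q ^ (z₁ * (a - b + e + z₂ - z₃ + 1) + z₂ * (e + f + g - z₃ + 2) +
            z₃ * (a + b + f - g)) *
          (qFact q (e + f + g + z₁ - z₃ + 1) * qFact q (a - b + e + z₂ - z₃) /
            (qFact q (e + f + g - z₃ + 1) * qFact q (a + b + f - g - z₁ - z₂))) := by
  obtain ⟨P, B, F, E, G, C, U, n, H, p⟩ := exists_intParams ha hb he hc hd hf hh hk hg habe hcdf hhkg
    hach hbdk hefg
  rw [p.tripleSum_one, p.tripleSum_two]
  have key := nineJ_eq hq p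
  obtain ⟨eqB, eqF, eqG, eqC, eqP, eqE, eqU, eqn, eqH, abe₁, abe₂, efg₁, efg₂, efg₃, hkg₁, hkg₂,
    hkg₃, bdk₁, bdk₂, bdk₃, ach₁, ach₂, ach₃, cdf₁, cdf₂, cdf₃⟩ := p
  rw [coupling_sum hq P B F G C U n H hkg₁ hkg₂ hkg₃ bdk₂ ach₁ ach₂ ach₃ cdf₂ cdf₁ _
      (phiOne_rec hq P B F E G) (fun x y => phiOne_eq_zero) (fun _ y => phiOne_eq_zero_of_lt)
      (fun _ m _ _ => phiOne_eq_zero_of_lower),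
    coupling_sum hq P B F G C U n H hkg₁ hkg₂ hkg₃ bdk₂ ach₁ ach₂ ach₃ cdf₂ cdf₁ _
      (phiTwo_rec hq P B F E G (by omega)) (fun x y => phiTwo_eq_zero)
      (fun _ y hy => phiTwo_eq_zero_of_lt hq hy (by omega) abe₁ efg₂)
      (fun _ m hmF hmP hm => phiTwo_eq_zero_of_lower hq hmP hmF hm (by omega) abe₁ efg₂)]
  constructor
  · rw [key, sgn_eq_zpow (n := P - U + H) (by push_cast; linarith)]
    congr 3
    rw [eqP, show f + g - e = F - P + E by linarith]
    push_cast
    ring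
  · rw [key, sgn_eq_zpow (n := P - U + H - (P - E)) (by push_cast; linarith), mul_assoc,
      mul_assoc _ (q ^ _)]
    have hs : (-1 : ℝ) ^ (P - U + H - (P - E)) * (-1) ^ (P - E) = (-1) ^ (P - U + H) := by
      rw [← zpow_natCast, ← zpow_add₀ (by norm_num), Nat.cast_sub efg₃, sub_add_cancel]
    have hr : q ^ (zExp d e h - (a + b + f - g) * (e + f + g + 2) - (g - a) * (g - a + 1)) *
        q ^ ((P : ℤ) * (G + 2 * P - F - 2 * E + 1)) =
        q ^ (zExp d e h - (g - a) * (g - a + 1) - ((P * (F - P + E + 1) : ℤ) : ℝ)) := by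
      rw [← Real.rpow_intCast, ← Real.rpow_add hq]
      congr 1
      rw [eqP, show e + f + g + 2 = G + P - E + 2 by linarith]
      push_cast
      ring
    rw [← hs, ← hr, mul_sum, mul_sum, mul_sum, mul_sum]
    refine sum_congr rfl fun m hm => ?_
    simp only [mem_filter, mem_range] at hm
    rw [phiTwo_diag_eq hq abe₁ efg₃ abe₂ efg₁ efg₂ (by omega) (by omega) (by omega) hm.2.1 hm.2.2.1]
    ring
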